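/- Let $\mathbb D\subset\mathbb C$ be the open unit disk. A simple chord in $(\mathbb D;-1,1)$ is the image $\eta=c([0,1])$ of an injective continuous path $c:[0,1]\to\overline{\mathbb D}$ with $c(0)=-1$, $c(1)=1$ and $c(t)\in\mathbb D$ for $0<t<1$. Let $\mathcal{SC}$ be the space of simple chords in $(\mathbb D;-1,1)$, with the topology induced by the Hausdorff distance (for the Euclidean metric) between compact sets. Let $\gamma_0=[-1,1]$, and for $0<\epsilon<\pi/2$ let $A_\epsilon\subset\mathbb D$ be the domain containing $(-1,1)$ that is bounded by the hyperbolic geodesic from $e^{i\epsilon}$ to $-e^{-i\epsilon}$, the hyperbolic geodesic from $-e^{i\epsilon}$ to $e^{-i\epsilon}$, and two arcs of the unit circle. Let $\gamma\in\mathcal{SC}$, $0<\epsilon_0<\pi/2$, and let $f$ be an injective holomorphic map on $A_{\epsilon_0}$ such that $f(A_{\epsilon_0})\subset\mathbb D$ coincides with $\mathbb D$ near $-1$ and near $1$, $f(z)\to-1$ as $z\to-1$ and $f(z)\to1$ as $z\to1$ in $A_{\epsilon_0}$, and $\gamma\setminus\{-1,1\}=f((-1,1))$. For $0<\epsilon<\epsilon_0$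 the set $$O_\epsilon(\gamma)=O_{\epsilon}^{f}(\gamma):=\{\eta\in\mathcal{SC} : \eta\setminus\{-1,1\}\subset f(A_\epsilon)\}$$ is called an admissible neighborhood of $\gamma$. Theorem. The admissible neighborhoods form a neighborhood basis for the Hausdorff topology on $\mathcal{SC}$: the collection of all sets $O_\epsilon^f(\gamma)$ (over all such $\gamma$, $\epsilon_0$, $f$ and $\epsilon$) is a basis of this topology, that is, each of them is open and every open subset of $\mathcal{SC}$ is a union of such sets. Moreover, for each fixed such $\gamma$, $\epsilon_0$ and $f$, the family $(O_\epsilon^f(\gamma))_{0<\epsilon<\epsilon_0}$ is a neighborhood basis at $\gamma$. -/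

import Mathlib

open Set Filter Topology TopologicalSpace

/-- The open unit disk `𝔻`. -/
abbrev unitDisk : Set ℂ := Metric.ball (0 : ℂ) 1

/-- `K` is (the trace, endpoints included, of) a simple chord in `(𝔻; -1, 1)`: the image of an
injective path from `-1` to `1` which stays in `𝔻` at all intermediate times. -/
def IsSimpleChord (K : Set ℂ) : Prop :=
  ∃ c : ℝ → ℂ, ContinuousOn c (Icc 0 1) ∧ InjOn c (Icc 0 1) ∧ c 0 = -1 ∧ c 1 = 1 ∧
    (∀ t ∈ Ioo (0 : ℝ) 1, c t ∈ unitDisk) ∧ K = c '' Icc 0 1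

/-- The space of simple chords in `(𝔻; -1, 1)`, as a subspace of the nonempty compact subsets of
`ℂ`. Mathlib's metric on `NonemptyCompacts ℂ` is the Hausdorff distance, so the topology here is
the relative topology of the Hausdorff metric. -/
abbrev SimpleChord : Type :=
  {K : NonemptyCompacts ℂ // IsSimpleChord (K : Set ℂ)}

/-- The chord without its two endpoints. -/
def SimpleChord.openPart (η : SimpleChord) : Set ℂ := (η.1 : Set ℂ) \ {-1, 1}

/-- The reference chord `γ₀ = (-1, 1)` (without endpoints), the hyperbolic geodesic of `𝔻` from
`-1` to `1`. -/
def referenceChord : Set ℂ := (fun t : ℝ => (t : ℂ)) '' Ioo (-1) 1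

/-- For `0 < ε < π / 2`, the domain `A_ε` in `𝔻` containing `γ₀` and bounded by the hyperbolic
geodesic from `exp (iε)` to `-exp (-iε)`, the hyperbolic geodesic from `-exp (iε)` to `exp (-iε)`,
and two arcs of the unit circle around `-1` and `1`. The circles centred at `± i / sin ε` with
radius `cot ε` are orthogonal to the unit circle and meet it at these points, so the two geodesics
are their parts inside `𝔻`. -/
def standardNhd (ε : ℝ) : Set ℂ :=
  unitDisk \ (Metric.closedBall (Complex.I / (Real.sin ε : ℂ)) (Real.cos ε / Real.sin ε) ∪
    Metric.closedBall (-Complex.I / (Real.sin ε : ℂ)) (Real.cos ε / Real.sin ε))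

/-- `V ⊆ 𝔻` coincides with `𝔻` near the boundary point `p`. -/
def AgreesWithDiskNear (V : Set ℂ) (p : ℂ) : Prop :=
  ∃ r > 0, V ∩ Metric.ball p r = unitDisk ∩ Metric.ball p r

/-- `f` is a conformal map of `A_{ε₀}` onto a domain `f(A_{ε₀}) ⊆ 𝔻` which coincides with `𝔻` near
`-1 = f(-1)` and `1 = f(1)` (boundary values in the sense of limits), and `γ = f(γ₀)`. -/
structure IsLocalConformalMap (ε₀ : ℝ) (f : ℂ → ℂ) (γ : SimpleChord) : Prop where
  pos : 0 < ε₀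
  lt_pi_div_two : ε₀ < Real.pi / 2
  differentiableOn : DifferentiableOn ℂ f (standardNhd ε₀)
  injOn : InjOn f (standardNhd ε₀)
  image_subset : f '' standardNhd ε₀ ⊆ unitDisk
  tendsto_neg_one : Tendsto f (𝓝[standardNhd ε₀] (-1)) (𝓝 (-1))
  tendsto_one : Tendsto f (𝓝[standardNhd ε₀] 1) (𝓝 1)
  agrees_neg_one : AgreesWithDiskNear (f '' standardNhd ε₀) (-1)
  agrees_one : AgreesWithDiskNear (f '' standardNhd ε₀) 1
  image_reference : γ.openPart = f '' referenceChord

/-- The set `O_ε` of simple chords in `(f(A_ε); -1, 1)`. -/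
def admissibleNhd (f : ℂ → ℂ) (ε : ℝ) : Set SimpleChord :=
  {η | η.openPart ⊆ f '' standardNhd ε}

/-- The family of all admissible neighborhoods `O_ε(γ)`, over all simple chords `γ` of the form
`γ = f(γ₀)`, all such conformal maps `f` on some `A_{ε₀}`, and all `0 < ε < ε₀`. -/
def admissibleNhds : Set (Set SimpleChord) :=
  {O | ∃ (ε₀ : ℝ) (f : ℂ → ℂ) (γ : SimpleChord), IsLocalConformalMap ε₀ f γ ∧
    ∃ ε, 0 < ε ∧ ε < ε₀ ∧ O = admissibleNhd f ε}

/-! A chord that is Hausdorff close to γ lies in a thin neighborhood of γ. Conversely, since γ is an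
arc, a chord lying in a sufficiently thin neighborhood of γ passes near every point of γ
(`SimpleChord.exists_dist_lt_of_subset_thickening`). So the Hausdorff topology is governed by the
one-sided condition of lying in a thickening, and the theorem amounts to comparing thickenings with
the sets f(A_ε).

Openness (`IsLocalConformalMap.isOpen_admissibleNhd`): f(A_ε) is open, so only the endpoints ±1 need
care. Near them both A_ε₀ and its image agree with the disk, so |f| tends to 1 at the circle and
Schwarz reflection (`exists_boundary_value`) extends f across it. Hence the smaller set f(A_ε) still
contains all points of the disk near ±1.

Local basis for fixed f: as ε decreases to 0, A_ε shrinks to the diameter, and by compactness f(A_ε)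
enters every thickening of γ (`IsLocalConformalMap.exists_image_subset_thickening`).

Global basis: a given γ need not itself be the image of the diameter under a conformal map, so it is
placed in an admissible neighborhood of another chord (`SimpleChord.exists_isLocalConformalMap`). An
arc does not separate the plane (`isPreconnected_compl_arc`), so everything far from γ can be
removed from the disk while keeping the complement connected. What remains around γ is a thin domain
(`SimpleChord.exists_thin_domain`) on which Cauchy's theorem yields primitives, and therefore a
Riemann map g (`HasPrimitives.exists_riemann_map`), normalized to fix ±1. The image of γ under g
lies in some A_ε, and f is the inverse of g. -/

/-! ### Injective holomorphic maps and the maximum principle. -/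

theorem nhds_le_map_nhds_of_injOn {f : ℂ → ℂ} {A : Set ℂ} (hA : IsOpen A)
    (hf : DifferentiableOn ℂ f A) (hi : InjOn f A) {z : ℂ} (hz : z ∈ A) :
    𝓝 (f z) ≤ map f (𝓝 z) := by
  have han : AnalyticAt ℂ f z := hf.analyticAt (hA.mem_nhds hz)
  rcases han.eventually_constant_or_nhds_le_map_nhds with h | h
  · exfalso
    have h2 : ∀ᶠ w in 𝓝[≠] z, w ∈ A ∧ f w = f z :=
      nhdsWithin_le_nhds ((hA.eventually_mem hz).and h)
    obtain ⟨w, ⟨hwA, hw⟩, hne⟩ := (h2.and self_mem_nhdsWithin).exists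
    exact hne (hi hwA hz hw)
  · exact h

theorem isOpen_image_of_injOn {f : ℂ → ℂ} {A : Set ℂ} (hA : IsOpen A)
    (hf : DifferentiableOn ℂ f A) (hi : InjOn f A) : IsOpen (f '' A) := by
  rw [isOpen_iff_mem_nhds]
  rintro _ ⟨z, hz, rfl⟩
  exact nhds_le_map_nhds_of_injOn hA hf hi hz (image_mem_map (hA.mem_nhds hz))

/-- The inverse of an injective holomorphic map is holomorphic. -/
theorem differentiableOn_invFunOn {f : ℂ → ℂ} {A : Set ℂ} (hA : IsOpen A)
    (hf : DifferentiableOn ℂ f A) (hi : InjOn f A) :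
    DifferentiableOn ℂ (Function.invFunOn f A) (f '' A) := by
  set g := Function.invFunOn f A with hg
  have hleft : ∀ z ∈ A, g (f z) = z := fun z hz => hi.leftInvOn_invFunOn hz
  have hW := isOpen_image_of_injOn hA hf hi
  have hcont : ∀ z ∈ A, ContinuousAt g (f z) := by
    intro z hz
    rw [ContinuousAt, hleft z hz]
    refine (map_mono (nhds_le_map_nhds_of_injOn hA hf hi hz)).trans ?_
    rw [map_map]
    refine (Filter.map_congr ?_ : map (g ∘ f) (𝓝 z) = map id (𝓝 z)).le.trans (by simp)
    filter_upwards [hA.mem_nhds hz] with w hw using hleft w hw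
  have hder : ∀ z ∈ A, deriv f z ≠ 0 → DifferentiableAt ℂ g (f z) := by
    intro z hz hne
    have h1 : HasDerivAt f (deriv f z) (g (f z)) := by
      rw [hleft z hz]
      exact (hf.differentiableAt (hA.mem_nhds hz)).hasDerivAt
    refine (HasDerivAt.of_local_left_inverse (hcont z hz) h1 hne ?_).differentiableAt
    filter_upwards [hW.mem_nhds (mem_image_of_mem f hz)] with w hw
    exact Function.invFunOn_eq hw
  rintro _ ⟨z, hz, rfl⟩
  refine DifferentiableAt.differentiableWithinAt ?_
  have hand : AnalyticAt ℂ (deriv f) z := (hf.analyticAt (hA.mem_nhds hz)).deriv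
  -- Either f' vanishes near z, and f is locally constant against injectivity, or z is an isolated
  -- zero at worst, and f z is a removable singularity of the continuous inverse.
  rcases hand.eventually_eq_zero_or_eventually_ne_zero with h | h
  · exfalso
    have hev : ∀ᶠ w in 𝓝 z, w ∈ A ∧ deriv f w = 0 :=
      (hA.eventually_mem hz).and h
    obtain ⟨r, hr, hball⟩ := Metric.eventually_nhds_iff_ball.1 hev
    have hc : ∀ w ∈ Metric.ball z r, f w = f z := by
      intro w hw
      refine (convex_ball z r).is_const_of_fderivWithin_eq_zero (𝕜 := ℂ)
        (hf.mono fun w hw => (hball w hw).1) ?_ hw (Metric.mem_ball_self hr)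
      intro x hx
      rw [fderivWithin_of_isOpen Metric.isOpen_ball hx]
      ext
      simpa using (hball x hx).2
    have h2 : ∀ᶠ w in 𝓝[≠] z, w ∈ A ∧ f w = f z := by
      refine nhdsWithin_le_nhds ?_
      filter_upwards [Metric.ball_mem_nhds z hr] with w hw using ⟨(hball w hw).1, hc w hw⟩
    obtain ⟨w, ⟨hwA, hw⟩, hne⟩ := (h2.and self_mem_nhdsWithin).exists
    exact hne (hi hwA hz hw)
  · refine (Complex.analyticAt_of_differentiable_on_punctured_nhds_of_continuousAt ?_
      (hcont z hz)).differentiableAt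
    have h1 : ∀ᶠ w in 𝓝 z, w ≠ z → deriv f w ≠ 0 := eventually_nhdsWithin_iff.1 h
    have h2 : ∀ᶠ w in 𝓝 (f z), g w ≠ z → deriv f (g w) ≠ 0 := by
      have := hcont z hz
      rw [ContinuousAt, hleft z hz] at this
      exact this.eventually h1
    rw [eventually_nhdsWithin_iff]
    filter_upwards [h2, hW.mem_nhds (mem_image_of_mem f hz)] with w hw hwW hne
    obtain ⟨x, hx, rfl⟩ := hwW
    rw [hleft x hx] at hw
    exact hder x hx (hw fun h => hne (by simp [h]))

/-- An injective holomorphic map is proper onto its image. -/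
theorem eventually_notMem_of_isCompact {f : ℂ → ℂ} {A K : Set ℂ} (hA : IsOpen A)
    (hf : DifferentiableOn ℂ f A) (hi : InjOn f A) (hK : IsCompact K) (hKA : K ⊆ f '' A)
    {ζ : ℂ} (hζ : ζ ∉ A) : ∀ᶠ z in 𝓝[A] ζ, f z ∉ K := by
  have hcomp : IsCompact (Function.invFunOn f A '' K) :=
    hK.image_of_continuousOn ((differentiableOn_invFunOn hA hf hi).continuousOn.mono hKA)
  have hsub : ζ ∉ Function.invFunOn f A '' K := by
    rintro ⟨w, hw, rfl⟩
    exact hζ (Function.invFunOn_mem (hKA hw))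
  have := hcomp.isClosed.isOpen_compl.mem_nhds hsub
  filter_upwards [nhdsWithin_le_nhds this, self_mem_nhdsWithin] with z hz hzA hfz
  exact hz ⟨f z, hfz, hi.leftInvOn_invFunOn hzA⟩

/-- Maximum modulus principle with boundary values in the sense of upper limits. -/
theorem norm_le_of_eventually_frontier_le {k : ℂ → ℂ} {U : Set ℂ} {M : ℝ} (hU : IsOpen U)
    (hb : Bornology.IsBounded U) (hk : DifferentiableOn ℂ k U)
    (hM : ∀ ζ ∈ frontier U, ∀ M' > M, ∀ᶠ z in 𝓝[U] ζ, ‖k z‖ ≤ M') {z : ℂ} (hz : z ∈ U) :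
    ‖k z‖ ≤ M := by
  by_contra! hlt
  obtain ⟨M', hM1, hM2⟩ := exists_between hlt
  -- The boundary condition makes this superlevel set compact, so the modulus attains its maximum
  -- over U inside U.
  set K : Set ℂ := {w | w ∈ U ∧ M' ≤ ‖k w‖} with hKdef
  have hKc : IsClosed K := by
    rw [isClosed_iff_frequently]
    intro ζ hfr
    by_cases hζ : ζ ∈ U
    · refine ⟨hζ, ?_⟩
      have hcont : ContinuousAt (fun w => ‖k w‖) ζ :=
        (hk.differentiableAt (hU.mem_nhds hζ)).continuousAt.norm
      by_contra! h
      have hev := hcont.eventually (gt_mem_nhds h)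
      obtain ⟨w, hw, hw2⟩ := (hfr.and_eventually hev).exists
      exact absurd hw.2 (not_le.2 hw2)
    · exfalso
      have hcl : ζ ∈ closure U := by
        rw [mem_closure_iff_frequently]
        exact hfr.mono fun w hw => hw.1
      have hfrU : ζ ∈ frontier U := by rw [hU.frontier_eq]; exact ⟨hcl, hζ⟩
      obtain ⟨M'', h1, h2⟩ := exists_between hM1
      have hev := eventually_nhdsWithin_iff.1 (hM ζ hfrU M'' h1)
      obtain ⟨w, hw, hw2⟩ := (hfr.and_eventually hev).exists
      have := hw2 hw.1
      have h3 := hw.2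
      linarith
  have hKcomp : IsCompact K := Metric.isCompact_of_isClosed_isBounded hKc
    (hb.subset fun w hw => hw.1)
  obtain ⟨c, hcK, hcmax⟩ := hKcomp.exists_isMaxOn ⟨z, hz, by linarith⟩
    ((hk.continuousOn.mono fun w hw => hw.1).norm)
  have hmax : IsMaxOn (norm ∘ k) U c := by
    intro w hw
    by_cases h : M' ≤ ‖k w‖
    · exact hcmax (⟨hw, h⟩ : w ∈ K)
    · have := hcK.2
      simp only [mem_ofPred_eq, Function.comp]
      linarith
  -- the connected component of `c` is clopen
  set C := connectedComponentIn U c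
  have hCo : IsOpen C := hU.connectedComponentIn
  have hcC : c ∈ C := mem_connectedComponentIn hcK.1
  have hCU : C ⊆ U := connectedComponentIn_subset U c
  have heq : EqOn (norm ∘ k) (Function.const ℂ ‖k c‖) C :=
    Complex.norm_eqOn_of_isPreconnected_of_isMaxOn isPreconnected_connectedComponentIn hCo
      (hk.mono hCU) hcC fun w hw => hmax (hCU hw)
  have hCK : C ⊆ K := fun w hw => ⟨hCU hw, by
    have h1 : ‖k w‖ = ‖k c‖ := heq hw
    rw [h1]; exact hcK.2⟩
  have hCne : C ≠ univ := by
    intro h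
    have h1 : Bornology.IsBounded (univ : Set ℂ) := hb.subset (h ▸ hCU)
    exact NormedSpace.unbounded_univ ℝ ℂ h1
  have hCclosed : IsClosed C := by
    refine isClosed_of_closure_subset fun w hw => ?_
    have hwK : w ∈ K := closure_minimal hCK hKc hw
    have : (connectedComponentIn U w ∩ C).Nonempty :=
      mem_closure_iff.1 hw _ hU.connectedComponentIn (mem_connectedComponentIn hwK.1)
    obtain ⟨x, hx1, hx2⟩ := this
    have h3 : connectedComponentIn U w = C :=
      (connectedComponentIn_eq hx1).trans (connectedComponentIn_eq hx2).symm
    exact h3 ▸ mem_connectedComponentIn hwK.1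
  rcases isClopen_iff.1 ⟨hCclosed, hCo⟩ with h | h
  · rw [h] at hcC; exact hcC
  · exact hCne h

/-! ### Schwarz reflection by polynomial approximation. -/

open ComplexConjugate in
/-- A continuous function on a circle centred at `0` that is odd under complex conjugation is a
uniform limit of imaginary parts of real polynomials. -/
theorem exists_real_polynomial_im_near {w : ℂ → ℝ} {ρ : ℝ} (hρ : 0 < ρ)
    (hw : ContinuousOn w (Metric.sphere 0 ρ))
    (hodd : ∀ s ∈ Metric.sphere (0 : ℂ) ρ, w (conj s) = -w s) {ε : ℝ} (hε : 0 < ε) :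
    ∃ q : Polynomial ℝ, ∀ s ∈ Metric.sphere (0 : ℂ) ρ,
      |(Polynomial.aeval s q).im - w s| < ε := by
  have : Fact (0 < 2 * Real.pi) := ⟨Real.two_pi_pos⟩
  let e : AddCircle (2 * Real.pi) → ℂ := fun x => (AddCircle.toCircle x : ℂ)
  have he : ∀ x, ‖e x‖ = 1 := fun x => Circle.norm_coe _
  have he_neg : ∀ x, e (-x) = conj (e x) := fun x => by
    simp only [e, AddCircle.toCircle_neg, Circle.coe_inv_eq_conj]
  have he_cont : Continuous e := by
    exact continuous_subtype_val.comp AddCircle.continuous_toCircle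
  have hmem : ∀ x, (ρ : ℂ) * e x ∈ Metric.sphere (0 : ℂ) ρ := fun x => by
    simp [he, abs_of_pos hρ]
  have hF : Continuous fun x => ((w (ρ * e x) : ℝ) : ℂ) :=
    Complex.continuous_ofReal.comp
      (hw.comp_continuous (continuous_const.mul he_cont) hmem)
  let F : C(AddCircle (2 * Real.pi), ℂ) := ⟨_, hF⟩
  -- The odd part of a trigonometric polynomial is a sine polynomial, whose real part is the
  -- imaginary part of a real polynomial on the circle. Quantifying over `c` lets the induction pass
  -- through complex scalars.
  have hP : ∀ f ∈ Submodule.span ℂ (range (@fourier (2 * Real.pi))), ∀ c : ℂ,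
      ∃ q : Polynomial ℝ, ∀ x, (Polynomial.aeval ((ρ : ℂ) * e x) q).im
        = ((c * f x - c * f (-x)) / 2).re := by
    intro f hf
    induction hf using Submodule.span_induction with
    | mem f hf =>
      obtain ⟨n, rfl⟩ := hf
      intro c
      have hnat : ∀ (m : ℕ) (d : ℝ), ∃ q : Polynomial ℝ, ∀ x,
          (Polynomial.aeval ((ρ : ℂ) * e x) q).im = d * (e x ^ m).im := by
        intro m d
        refine ⟨Polynomial.C (d / ρ ^ m) * Polynomial.X ^ m, fun x => ?_⟩
        have h0 : (ρ : ℂ) ^ m ≠ 0 := pow_ne_zero _ (by exact_mod_cast hρ.ne')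
        have : Polynomial.aeval ((ρ : ℂ) * e x) (Polynomial.C (d / ρ ^ m) * Polynomial.X ^ m)
            = ((d : ℝ) : ℂ) * e x ^ m := by
          simp only [map_mul, Polynomial.aeval_C, map_pow, Polynomial.aeval_X,
            Complex.coe_algebraMap]
          push_cast
          rw [mul_pow]
          field_simp
        rw [this, Complex.im_ofReal_mul]
      have hfour : ∀ x, (fourier n x : ℂ) = e x ^ n := by
        intro x
        rw [fourier_apply, AddCircle.toCircle_zsmul, Circle.coe_zpow]
      have hconj : ∀ x, (fourier n (-x) : ℂ) = conj (e x ^ n) := by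
        intro x
        rw [hfour, he_neg, map_zpow₀]
      have hre : ∀ z : ℂ, ((c * z - c * conj z) / 2).re = -c.im * z.im := by
        intro z
        have : (c * z - c * conj z) / 2 = c * (z.im * Complex.I) := by
          rw [← mul_sub, Complex.sub_conj]; push_cast; ring
        rw [this]; simp
      simp_rw [hconj, hfour, hre]
      rcases Int.eq_nat_or_neg n with ⟨m, rfl | rfl⟩
      · simpa using hnat m (-c.im)
      · obtain ⟨q, hq⟩ := hnat m c.im
        refine ⟨q, fun x => ?_⟩
        rw [hq, zpow_neg, zpow_natCast]
        have h1 : (e x ^ m)⁻¹ = conj (e x ^ m) := by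
          rw [Complex.inv_eq_conj]; simp [he]
        rw [h1, Complex.conj_im]; ring
    | zero => exact fun c => ⟨0, by simp⟩
    | add f g _ _ hf hg =>
      intro c
      obtain ⟨q1, h1⟩ := hf c
      obtain ⟨q2, h2⟩ := hg c
      refine ⟨q1 + q2, fun x => ?_⟩
      rw [map_add, Complex.add_im, h1, h2, ← Complex.add_re]
      congr 1
      simp only [ContinuousMap.add_apply]; ring
    | smul a f _ hf =>
      intro c
      obtain ⟨q, h⟩ := hf (c * a)
      refine ⟨q, fun x => ?_⟩
      rw [h]
      congr 1
      simp only [ContinuousMap.smul_apply, smul_eq_mul]; ring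
  have hcl : F ∈ closure (Submodule.span ℂ (range (@fourier (2 * Real.pi))) :
      Set C(AddCircle (2 * Real.pi), ℂ)) := by
    have : F ∈ (Submodule.span ℂ (range (@fourier (2 * Real.pi)))).topologicalClosure := by
      rw [span_fourier_closure_eq_top]; trivial
    exact this
  obtain ⟨f, hf, hfF⟩ := Metric.mem_closure_iff.1 hcl ε hε
  obtain ⟨q, hq⟩ := hP f hf 1
  refine ⟨q, fun s hs => ?_⟩
  have hs' : ‖s‖ = ρ := by simpa using hs
  obtain ⟨x, rfl⟩ : ∃ x, s = ρ * e x := by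
    have hcirc : ‖s / ρ‖ = 1 := by
      simp [hs', abs_of_pos hρ, hρ.ne']
    obtain ⟨x, hx⟩ := (AddCircle.homeomorphCircle Real.two_pi_pos.ne').surjective
      ⟨s / ρ, mem_sphere_zero_iff_norm.2 hcirc⟩
    refine ⟨x, ?_⟩
    have h1 : e x = s / ρ := by
      have := congrArg (fun c : Circle => (c : ℂ)) hx
      simpa [e, AddCircle.homeomorphCircle_apply] using this
    rw [h1]
    have : (ρ : ℂ) ≠ 0 := by exact_mod_cast hρ.ne'
    field_simp
  rw [hq]
  have hd : ∀ y, ‖F y - f y‖ < ε := fun y => by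
    rw [← dist_eq_norm]; exact (ContinuousMap.dist_apply_le_dist y).trans_lt hfF
  -- Since F is odd, passing to the odd part of the approximation f does not increase the error.
  have hFneg : F (-x) = -F x := by
    show ((w (ρ * e (-x)) : ℝ) : ℂ) = -((w (ρ * e x) : ℝ) : ℂ)
    rw [he_neg, ← Complex.conj_ofReal ρ, ← map_mul, Complex.conj_ofReal, hodd _ (hmem x)]
    push_cast; rfl
  have hFx : (F x).re = w (ρ * e x) := Complex.ofReal_re _
  have h1 := hd x
  have h2 := hd (-x)
  rw [hFneg] at h2
  rw [← hFx, ← Complex.sub_re, one_mul, one_mul]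
  refine (Complex.abs_re_le_norm _).trans_lt ?_
  have : (f x - f (-x)) / 2 - F x = -((F x - f x) - (-F x - f (-x))) / 2 := by ring
  rw [this, norm_div, norm_neg, Complex.norm_ofNat]
  have := norm_sub_le (F x - f x) (-F x - f (-x))
  linarith

/-- The open upper half disk of radius `ρ`. -/
def halfDisk (ρ : ℝ) : Set ℂ := Metric.ball 0 ρ ∩ {s | 0 < s.im}

theorem isOpen_halfDisk (ρ : ℝ) : IsOpen (halfDisk ρ) :=
  Metric.isOpen_ball.inter (isOpen_lt continuous_const Complex.continuous_im)

theorem isPreconnected_halfDisk (ρ : ℝ) : IsPreconnected (halfDisk ρ) :=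
  ((convex_ball (0 : ℂ) ρ).inter (convex_halfSpace_im_gt 0)).isPreconnected

theorem halfDisk_nonempty {ρ : ℝ} (hρ : 0 < ρ) : (halfDisk ρ).Nonempty := by
  refine ⟨((ρ / 2 : ℝ) : ℂ) * Complex.I, ?_, ?_⟩
  · simp [abs_of_pos hρ]; linarith
  · simp; linarith

open ComplexConjugate in
/-- The odd reflection of `-log ‖h‖` in the real axis. -/
noncomputable def oddLogNorm (h : ℂ → ℂ) (s : ℂ) : ℝ :=
  if 0 < s.im then -Real.log ‖h s‖ else if s.im < 0 then Real.log ‖h (conj s)‖ else 0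

open ComplexConjugate in
theorem oddLogNorm_conj (h : ℂ → ℂ) (s : ℂ) : oddLogNorm h (conj s) = -oddLogNorm h s := by
  unfold oddLogNorm
  rcases lt_trichotomy s.im 0 with hs | hs | hs
  · simp [hs, not_lt.2 hs.le]
  · simp [hs]
  · simp [hs, not_lt.2 hs.le]

-- The pieces fit together because `‖h‖` tends to 1 at the diameter, so its logarithm tends to 0
-- from above and, by reflection, from below.
open ComplexConjugate in
theorem continuousOn_oddLogNorm {h : ℂ → ℂ} {R : ℝ} (hc : ContinuousOn h (halfDisk R))
    (h0 : ∀ s ∈ halfDisk R, h s ≠ 0)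
    (hb : ∀ x : ℂ, ‖x‖ < R → x.im = 0 → Tendsto (fun s => ‖h s‖) (𝓝[{s | 0 < s.im}] x) (𝓝 1)) :
    ContinuousOn (oddLogNorm h) (Metric.ball 0 R) := by
  have hup : ∀ s ∈ halfDisk R, ContinuousAt (oddLogNorm h) s := by
    intro s hs
    have h1 : ContinuousAt (fun s => -Real.log ‖h s‖) s :=
      ((hc.continuousAt ((isOpen_halfDisk R).mem_nhds hs)).norm.log
        (norm_ne_zero_iff.2 (h0 s hs))).neg
    refine h1.congr ?_
    filter_upwards [(isOpen_halfDisk R).mem_nhds hs] with t ht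
    have : 0 < t.im := ht.2
    simp [oddLogNorm, this]
  intro s hs
  refine ContinuousAt.continuousWithinAt ?_
  have hs' : ‖s‖ < R := by simpa using hs
  rcases lt_trichotomy s.im 0 with hi | hi | hi
  · have h1 : ContinuousAt (oddLogNorm h) (conj s) :=
      hup _ ⟨by simpa using hs, by simpa using hi⟩
    have h2 : ContinuousAt (fun t => -oddLogNorm h (conj t)) s :=
      (ContinuousAt.comp (f := fun t : ℂ => conj t) h1 Complex.continuous_conj.continuousAt).neg
    refine h2.congr (Eventually.of_forall fun t => ?_)
    simp [oddLogNorm_conj]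
  · have hval : oddLogNorm h s = 0 := by simp [oddLogNorm, hi]
    rw [ContinuousAt, hval]
    have h1 : Tendsto (fun s => Real.log ‖h s‖) (𝓝[{s | 0 < s.im}] s) (𝓝 0) := by
      have := (hb s hs' hi).log one_ne_zero
      rwa [Real.log_one] at this
    rw [Metric.tendsto_nhds]
    intro ε hε
    have h2 := eventually_nhdsWithin_iff.1 (Metric.tendsto_nhds.1 h1 ε hε)
    have hcs : conj s = s := Complex.conj_eq_iff_im.2 hi
    have h3 : ∀ᶠ t in 𝓝 s, conj t ∈ {s : ℂ | 0 < s.im} →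
        dist (Real.log ‖h (conj t)‖) 0 < ε := by
      have : Tendsto (fun t : ℂ => conj t) (𝓝 s) (𝓝 s) := by
        have := Complex.continuous_conj.tendsto s
        rwa [hcs] at this
      exact this.eventually h2
    filter_upwards [h2, h3] with t ht1 ht2
    unfold oddLogNorm
    split_ifs with ha hb
    · simpa using ht1 ha
    · exact ht2 (by simpa using hb)
    · simpa using hε
  · exact hup s ⟨hs, hi⟩

open ComplexConjugate in
theorem aeval_conj_real (q : Polynomial ℝ) (s : ℂ) :
    Polynomial.aeval (conj s) q = conj (Polynomial.aeval s q) := by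
  simpa using Polynomial.aeval_algHom_apply (Complex.conjAe : ℂ ≃ₐ[ℝ] ℂ).toAlgHom s q

/-- Turns bounds on `z.im + Real.log ‖a‖` into bounds on a modulus, so that the maximum modulus
principle can replace a maximum principle for harmonic functions. -/
theorem norm_mul_exp_neg_I {a z : ℂ} (ha : a ≠ 0) :
    ‖a * Complex.exp (-Complex.I * z)‖ = Real.exp (z.im + Real.log ‖a‖) := by
  rw [norm_mul, Complex.norm_exp, Real.exp_add, Real.exp_log (norm_pos_iff.2 ha), mul_comm]
  simp

open ComplexConjugate in
/-- If `Im q` is close to the odd reflection of `-log ‖h‖` on a circle, then so it is inside. -/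
theorem abs_im_sub_oddLogNorm_le {h : ℂ → ℂ} {R ρ ε : ℝ} (hρR : ρ < R)
    (hd : DifferentiableOn ℂ h (halfDisk R)) (h0 : ∀ s ∈ halfDisk R, h s ≠ 0)
    (hb : ∀ x : ℂ, ‖x‖ < R → x.im = 0 → Tendsto (fun s => ‖h s‖) (𝓝[{s | 0 < s.im}] x) (𝓝 1))
    (hε : 0 ≤ ε) {q : Polynomial ℝ}
    (hq : ∀ s ∈ Metric.sphere (0 : ℂ) ρ, |(Polynomial.aeval s q).im - oddLogNorm h s| ≤ ε)
    {s : ℂ} (hs : s ∈ Metric.ball (0 : ℂ) ρ) :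
    |(Polynomial.aeval s q).im - oddLogNorm h s| ≤ ε := by
  set E : ℂ → ℝ := fun s => (Polynomial.aeval s q).im - oddLogNorm h s with hE
  have hreal : ∀ s : ℂ, s.im = 0 → E s = 0 := by
    intro s hs
    have h1 := aeval_conj_real q s
    rw [Complex.conj_eq_iff_im.2 hs] at h1
    have h2 := Complex.conj_eq_iff_im.1 h1.symm
    simp [hE, oddLogNorm, hs, h2]
  have hEc : ContinuousOn E (Metric.ball 0 R) := by
    refine ContinuousOn.sub ?_ (continuousOn_oddLogNorm hd.continuousOn h0 hb)
    exact (Complex.continuous_im.comp (Polynomial.continuous_aeval q)).continuousOn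
  have hsub : halfDisk ρ ⊆ halfDisk R := fun s hs =>
    ⟨Metric.ball_subset_ball hρR.le hs.1, hs.2⟩
  have hEfr : ∀ ζ ∈ frontier (halfDisk ρ), ∀ ε' > ε, ∀ᶠ z in 𝓝[halfDisk ρ] ζ, |E z| ≤ ε' := by
    intro ζ hζ ε' hε'
    rw [(isOpen_halfDisk ρ).frontier_eq] at hζ
    have hn : ‖ζ‖ ≤ ρ := by
      have := closure_mono (inter_subset_left : halfDisk ρ ⊆ _) hζ.1
      simpa using Metric.closure_ball_subset_closedBall this
    have hi : 0 ≤ ζ.im := by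
      have h1 : halfDisk ρ ⊆ {s : ℂ | 0 ≤ s.im} := fun s hs =>
        (show 0 < s.im from hs.2).le
      exact closure_minimal h1 (isClosed_le continuous_const Complex.continuous_im) hζ.1
    have hle : |E ζ| ≤ ε := by
      rcases hi.eq_or_lt with hi | hi
      · rw [hreal ζ hi.symm]; simpa using hε
      · rcases hn.eq_or_lt with hn | hn
        · exact hq ζ (by simpa using hn)
        · exact absurd ⟨by simpa using hn, hi⟩ hζ.2
    have hcont : ContinuousAt (fun z => |E z|) ζ :=
      (hEc.continuousAt (Metric.isOpen_ball.mem_nhds (by simpa using hn.trans_lt hρR))).abs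
    exact nhdsWithin_le_nhds ((hcont.eventually (gt_mem_nhds (hle.trans_lt hε'))).mono
      fun z hz => le_of_lt hz)
  have hup : ∀ s ∈ halfDisk ρ, |E s| ≤ ε := by
    -- On the half disk `‖k‖` is the exponential of E, so the maximum modulus principle for k and
    -- for 1/k bounds E from above and from below.
    set k : ℂ → ℂ := fun s => h s * Complex.exp (-Complex.I * Polynomial.aeval s q) with hk
    have hkd : DifferentiableOn ℂ k (halfDisk ρ) := by
      refine (hd.mono hsub).mul (Differentiable.differentiableOn ?_)
      exact Complex.differentiable_exp.comp
        ((differentiable_const _).mul (Polynomial.differentiable_aeval q))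
    have hkn : ∀ s ∈ halfDisk ρ, ‖k s‖ = Real.exp (E s) := by
      intro s hs
      have : 0 < s.im := hs.2
      rw [hk, norm_mul_exp_neg_I (h0 s (hsub hs))]
      simp [hE, oddLogNorm, this]
    have hk0 : ∀ s ∈ halfDisk ρ, k s ≠ 0 := fun s hs => by
      rw [← norm_pos_iff, hkn s hs]; exact Real.exp_pos _
    have hbd : Bornology.IsBounded (halfDisk ρ) := Metric.isBounded_ball.subset inter_subset_left
    have hfin : ∀ ζ ∈ frontier (halfDisk ρ), ∀ M' > Real.exp ε, ∀ᶠ z in 𝓝[halfDisk ρ] ζ,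
        ‖k z‖ ≤ M' ∧ ‖(k z)⁻¹‖ ≤ M' := by
      intro ζ hζ M' hM'
      have hM0 : 0 < M' := (Real.exp_pos _).trans hM'
      filter_upwards [hEfr ζ hζ (Real.log M') ((Real.lt_log_iff_exp_lt hM0).2 hM'),
        self_mem_nhdsWithin] with z hz hzH
      rw [norm_inv, hkn z hzH, ← Real.exp_neg]
      have := abs_le.1 hz
      constructor
      · rw [← Real.le_log_iff_exp_le hM0]; linarith
      · rw [← Real.le_log_iff_exp_le hM0]; linarith
    intro s hs
    have h1 := norm_le_of_eventually_frontier_le (isOpen_halfDisk ρ) hbd hkd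
      (fun ζ hζ M' hM' => (hfin ζ hζ M' hM').mono fun _ h => h.1) hs
    have h2 := norm_le_of_eventually_frontier_le (isOpen_halfDisk ρ) hbd (hkd.inv hk0)
      (fun ζ hζ M' hM' => (hfin ζ hζ M' hM').mono fun _ h => h.2) hs
    rw [Pi.inv_apply, norm_inv, hkn s hs, ← Real.exp_neg, Real.exp_le_exp] at h2
    rw [hkn s hs, Real.exp_le_exp] at h1
    exact abs_le.2 ⟨by linarith, h1⟩
  show |E s| ≤ ε
  rcases lt_trichotomy s.im 0 with hi | hi | hi
  · have h1 := hup (conj s) ⟨by simpa using hs, by simpa using hi⟩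
    have h2 : E (conj s) = -E s := by
      simp only [hE, aeval_conj_real, oddLogNorm_conj, Complex.conj_im]; ring
    rwa [h2, abs_neg] at h1
  · rw [hreal s hi]; simpa using hε
  · exact hup s ⟨hs, hi⟩

open ComplexConjugate in
/-- Schwarz reflection for a zero-free function on a half disk whose modulus tends to `1` at the
diameter. -/
theorem exists_eq_exp_of_norm_tendsto_one {h : ℂ → ℂ} {R ρ : ℝ} (hρ : 0 < ρ) (hρR : ρ < R)
    (hd : DifferentiableOn ℂ h (halfDisk R)) (h0 : ∀ s ∈ halfDisk R, h s ≠ 0)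
    (hb : ∀ x : ℂ, ‖x‖ < R → x.im = 0 →
      Tendsto (fun s => ‖h s‖) (𝓝[{s | 0 < s.im}] x) (𝓝 1)) :
    ∃ (q : ℂ → ℂ) (c : ℂ), DifferentiableOn ℂ q (Metric.ball 0 (ρ / 2)) ∧ ‖c‖ = 1 ∧
      (∀ s ∈ Metric.ball (0 : ℂ) (ρ / 2), q (conj s) = conj (q s)) ∧
      ∀ s ∈ halfDisk (ρ / 2), h s = c * Complex.exp (Complex.I * q s) := by
  have hwc : ContinuousOn (oddLogNorm h) (Metric.sphere 0 ρ) :=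
    (continuousOn_oddLogNorm hd.continuousOn h0 hb).mono fun s hs => by
      have : ‖s‖ = ρ := by simpa using hs
      simpa [this] using hρR
  choose p hp using fun n : ℕ => exists_real_polynomial_im_near hρ hwc
    (fun s _ => oddLogNorm_conj h s) (Nat.one_div_pos_of_nat (α := ℝ) (n := n))
  have hp2 : ∀ n : ℕ, ∀ s ∈ Metric.ball (0 : ℂ) ρ,
      |(Polynomial.aeval s (p n)).im - oddLogNorm h s| ≤ 1 / ((n : ℝ) + 1) := fun n s hs =>
    abs_im_sub_oddLogNorm_le hρR hd h0 hb (by positivity) (fun s hs => (hp n s hs).le) hs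
  -- The subtracted constants are real, so imaginary parts do not change, while all Q n now vanish
  -- at 0 as Borel–Carathéodory requires.
  set Q : ℕ → ℂ → ℂ := fun n s => Polynomial.aeval s (p n) - Polynomial.aeval 0 (p n) with hQ
  have hQd : ∀ n, Differentiable ℂ (Q n) := fun n =>
    (Polynomial.differentiable_aeval (p n)).sub_const _
  have hp0 : ∀ n, (Polynomial.aeval (0 : ℂ) (p n)).im = 0 := fun n => by
    have := aeval_conj_real (p n) 0
    rw [map_zero] at this
    exact Complex.conj_eq_iff_im.1 this.symm
  have hQim : ∀ n s, (Q n s).im = (Polynomial.aeval s (p n)).im := fun n s => by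
    simp [hQ, hp0]
  have hQconj : ∀ n s, Q n (conj s) = conj (Q n s) := fun n s => by
    have := aeval_conj_real (p n) 0
    rw [map_zero] at this
    simp only [hQ, aeval_conj_real, map_sub, ← this]
  -- Only imaginary parts are controlled so far. Borel–Carathéodory controls the full difference on
  -- the disk of half the radius, where `‖s‖ / (ρ - ‖s‖) ≤ 1`.
  have hcau : ∀ n m : ℕ, ∀ s ∈ Metric.ball (0 : ℂ) (ρ / 2),
      ‖Q n s - Q m s‖ ≤ 2 * (1 / ((n : ℝ) + 1) + 1 / ((m : ℝ) + 1)) := by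
    intro n m s hs
    have hs' : ‖s‖ < ρ / 2 := by simpa using hs
    have hM : (0 : ℝ) < 1 / ((n : ℝ) + 1) + 1 / ((m : ℝ) + 1) := by positivity
    have hfd : DifferentiableOn ℂ (fun s => -Complex.I * (Q n s - Q m s)) (Metric.ball 0 ρ) :=
      ((differentiable_const _).mul ((hQd n).sub (hQd m))).differentiableOn
    have hmaps : MapsTo (fun s => -Complex.I * (Q n s - Q m s)) (Metric.ball 0 ρ)
        {z | z.re ≤ 1 / ((n : ℝ) + 1) + 1 / ((m : ℝ) + 1)} := by
      intro t ht
      have h1 := abs_le.1 (hp2 n t ht)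
      have h2 := abs_le.1 (hp2 m t ht)
      rw [← hQim] at h1 h2
      have : (-Complex.I * (Q n t - Q m t)).re = (Q n t).im - (Q m t).im := by simp
      show (-Complex.I * (Q n t - Q m t)).re ≤ _
      rw [this]; linarith
    have := Complex.borelCaratheodory_zero hM hfd hmaps hρ
      (Metric.ball_subset_ball (by linarith) hs) (by simp [hQ])
    rw [norm_mul, norm_neg, Complex.norm_I, one_mul] at this
    refine this.trans ?_
    rw [div_le_iff₀ (by linarith)]
    have h3 := norm_nonneg s
    nlinarith
  have hcs : ∀ s ∈ Metric.ball (0 : ℂ) (ρ / 2), CauchySeq fun n => Q n s := by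
    intro s hs
    refine cauchySeq_of_le_tendsto_0 (fun n : ℕ => 4 * (1 / ((n : ℝ) + 1))) ?_ ?_
    · intro n m N hn hm
      rw [dist_eq_norm]
      refine (hcau n m s hs).trans ?_
      have h1 := Nat.one_div_le_one_div (α := ℝ) hn
      have h2 := Nat.one_div_le_one_div (α := ℝ) hm
      linarith
    · simpa using tendsto_one_div_add_atTop_nhds_zero_nat.const_mul (4 : ℝ)
  choose! q hq using fun s hs => cauchySeq_tendsto_of_complete (hcs s hs)
  have hunif : TendstoUniformlyOn Q q atTop (Metric.ball 0 (ρ / 2)) := by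
    rw [Metric.tendstoUniformlyOn_iff]
    intro ε hε
    have h1 : Tendsto (fun n : ℕ => 2 * (1 / ((n : ℝ) + 1) + 0)) atTop (𝓝 0) := by
      simpa using (tendsto_one_div_add_atTop_nhds_zero_nat (𝕜 := ℝ)).const_mul 2
    filter_upwards [h1.eventually (gt_mem_nhds hε)] with n hn s hs
    refine lt_of_le_of_lt ?_ hn
    have h2 : Tendsto (fun m => dist (Q m s) (Q n s)) atTop (𝓝 (dist (q s) (Q n s))) :=
      (hq s hs).dist tendsto_const_nhds
    have h3 : Tendsto (fun m : ℕ => 2 * (1 / ((n : ℝ) + 1) + 1 / ((m : ℝ) + 1))) atTop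
        (𝓝 (2 * (1 / ((n : ℝ) + 1) + 0))) :=
      (tendsto_const_nhds.add tendsto_one_div_add_atTop_nhds_zero_nat).const_mul 2
    refine le_of_tendsto_of_tendsto' h2 h3 fun m => ?_
    rw [dist_comm, dist_eq_norm]
    exact hcau n m s hs
  have hqd : DifferentiableOn ℂ q (Metric.ball 0 (ρ / 2)) :=
    hunif.tendstoLocallyUniformlyOn.differentiableOn
      (Eventually.of_forall fun n => (hQd n).differentiableOn) Metric.isOpen_ball
  have hqim : ∀ s ∈ Metric.ball (0 : ℂ) (ρ / 2), (q s).im = oddLogNorm h s := by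
    intro s hs
    have h1 : Tendsto (fun n => (Q n s).im) atTop (𝓝 (q s).im) :=
      (Complex.continuous_im.tendsto _).comp (hq s hs)
    have h2 : Tendsto (fun n => (Q n s).im) atTop (𝓝 (oddLogNorm h s)) := by
      rw [tendsto_iff_dist_tendsto_zero]
      refine squeeze_zero (fun _ => dist_nonneg) (fun n => ?_)
        (tendsto_one_div_add_atTop_nhds_zero_nat (𝕜 := ℝ))
      rw [Real.dist_eq, hQim]
      exact hp2 n s (Metric.ball_subset_ball (by linarith) hs)
    exact tendsto_nhds_unique h1 h2
  have hqconj : ∀ s ∈ Metric.ball (0 : ℂ) (ρ / 2), q (conj s) = conj (q s) := by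
    intro s hs
    refine tendsto_nhds_unique (hq _ (by simpa using hs)) ?_
    simp_rw [hQconj]
    exact (Complex.continuous_conj.tendsto _).comp (hq s hs)
  obtain ⟨s₀, hs₀⟩ := halfDisk_nonempty (half_pos hρ)
  have hsub : halfDisk (ρ / 2) ⊆ halfDisk R := fun s hs =>
    ⟨Metric.ball_subset_ball (by linarith) hs.1, hs.2⟩
  -- The imaginary part of q is `-log ‖h‖` here, so k is unimodular and hence constant.
  set k : ℂ → ℂ := fun s => h s * Complex.exp (-Complex.I * q s) with hk
  have hkd : DifferentiableOn ℂ k (halfDisk (ρ / 2)) :=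
    (hd.mono hsub).mul (((hqd.mono inter_subset_left).const_mul _).cexp)
  have hkn : ∀ s ∈ halfDisk (ρ / 2), ‖k s‖ = 1 := by
    intro s hs
    have : 0 < s.im := hs.2
    rw [hk, norm_mul_exp_neg_I (h0 s (hsub hs)), hqim s hs.1]
    simp [oddLogNorm, this]
  have hconst : EqOn k (Function.const ℂ (k s₀)) (halfDisk (ρ / 2)) :=
    Complex.eqOn_of_isPreconnected_of_isMaxOn_norm (isPreconnected_halfDisk _)
      (isOpen_halfDisk _) hkd hs₀ fun s hs => by
        simp only [mem_ofPred_eq, Function.comp]; rw [hkn s hs, hkn s₀ hs₀]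
  refine ⟨q, k s₀, hqd, hkn s₀ hs₀, hqconj, fun s hs => ?_⟩
  have h1 : k s = k s₀ := hconst hs
  rw [← h1]
  simp only [hk]
  rw [mul_assoc, ← Complex.exp_add]
  simp

/-! ### Boundary values at a point of the unit circle. -/

/-- The Cayley transform from the upper half plane to the unit disk with `0 ↦ p`. -/
noncomputable def cayleyAt (p s : ℂ) : ℂ := p * (1 + Complex.I * s) / (1 - Complex.I * s)

/-- The inverse of `cayleyAt p`. -/
noncomputable def cayleyAtInv (p z : ℂ) : ℂ := -Complex.I * (z - p) / (z + p)

theorem cayleyAt_zero (p : ℂ) : cayleyAt p 0 = p := by simp [cayleyAt]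

theorem one_sub_I_mul_ne_zero {s : ℂ} (hs : ‖s‖ < 1) : 1 - Complex.I * s ≠ 0 := by
  intro h
  have : ‖Complex.I * s‖ = 1 := by rw [← sub_eq_zero.1 h]; simp
  simp at this
  linarith

theorem differentiableAt_cayleyAt {p s : ℂ} (hs : ‖s‖ < 1) :
    DifferentiableAt ℂ (cayleyAt p) s := by
  unfold cayleyAt
  have := one_sub_I_mul_ne_zero hs
  fun_prop (disch := assumption)

theorem norm_cayleyAt_lt_one_iff {p s : ℂ} (hp : ‖p‖ = 1) (hs : ‖s‖ < 1) :
    ‖cayleyAt p s‖ < 1 ↔ 0 < s.im := by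
  have h1 := norm_pos_iff.2 (one_sub_I_mul_ne_zero hs)
  rw [cayleyAt, norm_div, norm_mul, hp, one_mul, div_lt_one h1,
    ← sq_lt_sq₀ (norm_nonneg _) (norm_nonneg _), Complex.sq_norm, Complex.sq_norm,
    Complex.normSq_apply, Complex.normSq_apply]
  simp
  constructor <;> intro h <;> nlinarith

theorem norm_cayleyAt_eq_one {p s : ℂ} (hp : ‖p‖ = 1) (hs : ‖s‖ < 1) (hi : s.im = 0) :
    ‖cayleyAt p s‖ = 1 := by
  have h1 := norm_pos_iff.2 (one_sub_I_mul_ne_zero hs)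
  rw [cayleyAt, norm_div, norm_mul, hp, one_mul, div_eq_one_iff_eq h1.ne',
    ← sq_eq_sq₀ (norm_nonneg _) (norm_nonneg _), Complex.sq_norm, Complex.sq_norm,
    Complex.normSq_apply, Complex.normSq_apply]
  simp [hi]

theorem cayleyAt_cayleyAtInv {p z : ℂ} (hp : p ≠ 0) (hz : z + p ≠ 0) :
    cayleyAt p (cayleyAtInv p z) = z := by
  unfold cayleyAt cayleyAtInv
  have h1 : Complex.I * (-Complex.I * (z - p) / (z + p)) = (z - p) / (z + p) := by
    rw [← mul_div_assoc, ← mul_assoc]; simp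
  rw [h1]
  have h2 : 1 - (z - p) / (z + p) = 2 * p / (z + p) := by field_simp; ring
  have h3 : 1 + (z - p) / (z + p) = 2 * z / (z + p) := by field_simp; ring
  rw [h2, h3]
  field_simp

/-- Boundary behaviour at `p` of a holomorphic function near a boundary point `p` of the disk,
with values in the disk, whose modulus tends to `1` along the circle: it has a boundary value `a`,
and the images of neighborhoods of `p` in the disk contain neighborhoods of `a` in the disk. -/
theorem exists_boundary_value {f : ℂ → ℂ} {p : ℂ} {r : ℝ} (hp : ‖p‖ = 1) (hr : 0 < r)
    (hd : DifferentiableOn ℂ f (unitDisk ∩ Metric.ball p r))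
    (hlt : ∀ z ∈ unitDisk ∩ Metric.ball p r, ‖f z‖ < 1)
    (hb : ∀ ζ ∈ Metric.ball p r, ‖ζ‖ = 1 → Tendsto (fun z => ‖f z‖) (𝓝[unitDisk] ζ) (𝓝 1)) :
    ∃ a : ℂ, ‖a‖ = 1 ∧ Tendsto f (𝓝[unitDisk] p) (𝓝 a) ∧
      ∀ r' > 0, ∃ s > 0, unitDisk ∩ Metric.ball a s ⊆ f '' (unitDisk ∩ Metric.ball p r') := by
  have hp0 : p ≠ 0 := norm_pos_iff.1 (by rw [hp]; exact one_pos)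
  have hc0 : ContinuousAt (cayleyAt p) 0 :=
    (differentiableAt_cayleyAt (by simp)).continuousAt
  obtain ⟨R, hR, hRsub⟩ : ∃ R > 0, ∀ s ∈ Metric.ball (0 : ℂ) R,
      ‖s‖ < 1 ∧ cayleyAt p s ∈ Metric.ball p r := by
    refine Metric.eventually_nhds_iff_ball.1 (Filter.Eventually.and ?_ ?_)
    · filter_upwards [Metric.ball_mem_nhds (0 : ℂ) one_pos] with s hs using by simpa using hs
    · have := hc0.eventually (Metric.ball_mem_nhds (cayleyAt p 0) hr)
      rwa [cayleyAt_zero] at this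
  have hmap : ∀ s ∈ halfDisk R, cayleyAt p s ∈ unitDisk ∩ Metric.ball p r := fun s hs =>
    ⟨by simpa using (norm_cayleyAt_lt_one_iff hp (hRsub s hs.1).1).2 hs.2, (hRsub s hs.1).2⟩
  set h : ℂ → ℂ := f ∘ cayleyAt p with hh
  have hhd : DifferentiableOn ℂ h (halfDisk R) := hd.comp
    (fun s hs => (differentiableAt_cayleyAt (hRsub s hs.1).1).differentiableWithinAt) hmap
  have hhb : ∀ x : ℂ, ‖x‖ < R → x.im = 0 →
      Tendsto (fun s => ‖h s‖) (𝓝[{s | 0 < s.im}] x) (𝓝 1) := by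
    intro x hx hi
    have hx' : x ∈ Metric.ball (0 : ℂ) R := by simpa using hx
    refine (hb (cayleyAt p x) (hRsub x hx').2
      (norm_cayleyAt_eq_one hp (hRsub x hx').1 hi)).comp ?_
    refine tendsto_nhdsWithin_iff.2 ⟨?_, ?_⟩
    · exact (differentiableAt_cayleyAt (hRsub x hx').1).continuousAt.tendsto.mono_left
        nhdsWithin_le_nhds
    · filter_upwards [self_mem_nhdsWithin,
        nhdsWithin_le_nhds (Metric.isOpen_ball.mem_nhds hx')] with s hs hsR
      exact (hmap s ⟨hsR, hs⟩).1
  obtain ⟨R₁, hR₁, hR₁R, hne⟩ : ∃ R₁ > 0, R₁ ≤ R ∧ ∀ s ∈ halfDisk R₁, h s ≠ 0 := by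
    have h1 := (hhb 0 (by simpa using hR) (by simp)).eventually (lt_mem_nhds one_half_lt_one)
    obtain ⟨R₁, hR₁, hsub⟩ := Metric.eventually_nhds_iff_ball.1 (eventually_nhdsWithin_iff.1 h1)
    refine ⟨min R₁ R, lt_min hR₁ hR, min_le_right _ _, fun s hs h0 => ?_⟩
    have := hsub s (Metric.ball_subset_ball (min_le_left _ _) hs.1) hs.2
    rw [h0, norm_zero] at this
    linarith
  have hsubR : halfDisk R₁ ⊆ halfDisk R := fun s hs =>
    ⟨Metric.ball_subset_ball hR₁R hs.1, hs.2⟩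
  obtain ⟨q, c, hqd, hc, hqconj, hq⟩ := exists_eq_exp_of_norm_tendsto_one (half_pos hR₁)
    (half_lt_self hR₁) (hhd.mono hsubR) hne fun x hx hi => hhb x (hx.trans_le hR₁R) hi
  -- One halving keeps the reflection circle strictly inside, the other is the loss in the
  -- reflection lemma.
  set ρ := R₁ / 2 / 2 with hρdef
  have hρ : 0 < ρ := by positivity
  have hρR : ρ < R₁ := by rw [hρdef]; linarith
  have hsubρ : halfDisk ρ ⊆ halfDisk R := fun s hs =>
    hsubR ⟨Metric.ball_subset_ball hρR.le hs.1, hs.2⟩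
  set G : ℂ → ℂ := fun s => c * Complex.exp (Complex.I * q s) with hG
  have hGn : ∀ s, ‖G s‖ = Real.exp (-(q s).im) := fun s => by
    simp [hG, hc, Complex.norm_exp]
  have hGd : DifferentiableOn ℂ G (Metric.ball 0 ρ) := (hqd.const_mul _).cexp.const_mul _
  have h0mem : (0 : ℂ) ∈ Metric.ball (0 : ℂ) ρ := Metric.mem_ball_self hρ
  -- The extension G maps the closed lower side outside the open disk. Hence preimages of disk
  -- points near G 0 lie in the upper half disk, where G is f in Cayley coordinates.
  have hGout : ∀ s ∈ Metric.ball (0 : ℂ) ρ, s.im ≤ 0 → 1 ≤ ‖G s‖ := by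
    intro s hs hi
    have h1 := hqconj s hs
    rw [hGn, Real.one_le_exp_iff]
    rcases hi.lt_or_eq with hi | hi
    · have hmem : (starRingEnd ℂ) s ∈ halfDisk ρ := ⟨by simpa using hs, by simpa using hi⟩
      have h2 := hlt _ (hmap _ (hsubρ hmem))
      have h3 : ‖G ((starRingEnd ℂ) s)‖ < 1 := by
        have : G ((starRingEnd ℂ) s) = h ((starRingEnd ℂ) s) := (hq _ hmem).symm
        rw [this]; exact h2
      rw [hGn, Real.exp_lt_one_iff, h1, Complex.conj_im] at h3
      linarith
    · rw [Complex.conj_eq_iff_im.2 hi] at h1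
      rw [Complex.conj_eq_iff_im.1 h1.symm]; simp
  have hG0 : ‖G 0‖ = 1 := by
    have h1 := hqconj 0 h0mem
    rw [map_zero] at h1
    rw [hGn, Complex.conj_eq_iff_im.1 h1.symm]; simp
  have hGin : ∀ s ∈ halfDisk ρ, G s = f (cayleyAt p s) := fun s hs => (hq s hs).symm
  have hGat : DifferentiableAt ℂ G 0 := hGd.differentiableAt (Metric.isOpen_ball.mem_nhds h0mem)
  refine ⟨G 0, hG0, ?_, fun r' hr' => ?_⟩
  · have hσ : ContinuousAt (cayleyAtInv p) p := by
      unfold cayleyAtInv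
      refine ContinuousAt.div (by fun_prop) (by fun_prop) ?_
      rw [← two_mul]; exact mul_ne_zero two_ne_zero hp0
    have hσp : cayleyAtInv p p = 0 := by simp [cayleyAtInv]
    have h1 : Tendsto (G ∘ cayleyAtInv p) (𝓝 p) (𝓝 (G 0)) := by
      refine (hGat.continuousAt.tendsto).comp ?_
      have := hσ.tendsto
      rwa [hσp] at this
    refine (h1.mono_left nhdsWithin_le_nhds).congr' ?_
    have h2 : ∀ᶠ z in 𝓝 p, cayleyAtInv p z ∈ Metric.ball (0 : ℂ) ρ := by
      have := hσ.tendsto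
      rw [hσp] at this
      exact this.eventually (Metric.ball_mem_nhds _ hρ)
    have h3 : ∀ᶠ z in 𝓝 p, z + p ≠ 0 := by
      have : ContinuousAt (fun z => z + p) p := by fun_prop
      refine this.eventually_ne ?_
      rw [← two_mul]; exact mul_ne_zero two_ne_zero hp0
    filter_upwards [nhdsWithin_le_nhds h2, nhdsWithin_le_nhds h3, self_mem_nhdsWithin]
      with z hz2 hz3 hz
    have hinv := cayleyAt_cayleyAtInv hp0 hz3
    have hn : ‖cayleyAtInv p z‖ < 1 :=
      (hRsub _ (Metric.ball_subset_ball (hρR.le.trans hR₁R) hz2)).1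
    have hi : 0 < (cayleyAtInv p z).im := by
      rw [← norm_cayleyAt_lt_one_iff hp hn, hinv]; simpa using hz
    simp only [Function.comp]
    rw [hGin _ ⟨hz2, hi⟩, hinv]
  · have hGan : AnalyticAt ℂ G 0 := hGd.analyticAt (Metric.isOpen_ball.mem_nhds h0mem)
    -- G is not locally constant, since its modulus is 1 at 0 and less than 1 in the upper half
    -- disk.
    have hopen : 𝓝 (G 0) ≤ map G (𝓝 0) := by
      refine hGan.eventually_constant_or_nhds_le_map_nhds.resolve_left fun hcon => ?_
      obtain ⟨δ, hδ, hball⟩ := Metric.eventually_nhds_iff_ball.1 hcon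
      obtain ⟨s, hs⟩ := halfDisk_nonempty (lt_min hδ hρ)
      have hsρ : s ∈ halfDisk ρ := ⟨Metric.ball_subset_ball (min_le_right _ _) hs.1, hs.2⟩
      have h1 := hball s (Metric.ball_subset_ball (min_le_left _ _) hs.1)
      have h2 := hlt _ (hmap _ (hsubρ hsρ))
      rw [← hGin s hsρ, h1, hG0] at h2
      exact lt_irrefl _ h2
    have hN : Metric.ball 0 ρ ∩ cayleyAt p ⁻¹' Metric.ball p r' ∈ 𝓝 (0 : ℂ) := by
      refine inter_mem (Metric.ball_mem_nhds _ hρ) (hc0.preimage_mem_nhds ?_)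
      rw [cayleyAt_zero]
      exact Metric.ball_mem_nhds _ hr'
    obtain ⟨s, hs, hsub⟩ := Metric.mem_nhds_iff.1 (hopen (image_mem_map hN))
    refine ⟨s, hs, ?_⟩
    rintro w ⟨hw1, hw2⟩
    obtain ⟨t, ⟨ht1, ht2⟩, rfl⟩ := hsub hw2
    have hi : 0 < t.im := by
      by_contra! hi
      have := hGout t ht1 hi
      have h4 : ‖G t‖ < 1 := by simpa using hw1
      linarith
    have htH : t ∈ halfDisk ρ := ⟨ht1, hi⟩
    exact ⟨cayleyAt p t, ⟨(hmap t (hsubρ htH)).1, ht2⟩, (hGin t htH).symm⟩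

/-! ### An arc does not separate the plane. -/

theorem isSimplyConnected_univ_of_contractible (X : Type*) [TopologicalSpace X]
    [ContractibleSpace X] : IsSimplyConnected (univ : Set X) :=
  (Homeomorph.Set.univ X).toHomotopyEquiv.simplyConnectedSpace

theorem exists_continuous_log {X : Type*} [TopologicalSpace X] [ContractibleSpace X]
    [LocallyPathConnectedSpace X] {g : X → ℂ} (hg : Continuous g) (h0 : ∀ x, g x ≠ 0) :
    ∃ l : X → ℂ, Continuous l ∧ ∀ x, Complex.exp (l x) = g x := by
  obtain ⟨l, hl, he⟩ := Complex.exists_continuousOn_eqOn_exp_comp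
    (isSimplyConnected_univ_of_contractible X) isOpen_univ hg.continuousOn
    (by rintro ⟨x, -, hx⟩; exact h0 x hx)
  exact ⟨l, continuousOn_univ.1 hl, fun x => he (mem_univ x)⟩

/-- The identity on a circle around `p` has no continuous logarithm centred at `p`. -/
theorem not_exists_log_on_circle {p : ℂ} {R : ℝ} (hR : 0 < R) {l : ℂ → ℂ} (hl : Continuous l)
    (he : ∀ z ∈ Metric.sphere p R, Complex.exp (l z) = z - p) : False := by
  let k : ℝ → ℂ := fun θ => l (circleMap p R θ)
  have hk : Continuous k := hl.comp (continuous_circleMap p R)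
  have hke : ∀ θ, Complex.exp (k θ) = R * Complex.exp (θ * Complex.I) := fun θ => by
    rw [he _ (circleMap_mem_sphere p hR.le θ), circleMap]; ring
  have hk0 : Complex.exp (k 0) = R := by simpa using hke 0
  -- Both sides lift the same path through the covering `exp` and agree at 0. The right-hand side is
  -- not periodic, while k is.
  have heq : k = fun θ : ℝ => k 0 + θ * Complex.I := by
    refine Complex.isCoveringMap_exp.eq_of_comp_eq hk (by fun_prop) ?_ 0 (by simp)
    ext θ
    simp only [Function.comp]
    rw [hke, Complex.exp_add, hk0]
  have h1 : k (2 * Real.pi) = k 0 := by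
    simp [k, circleMap, Complex.exp_two_pi_mul_I]
  have h2 := congrFun heq (2 * Real.pi)
  rw [h1] at h2
  simp at h2

theorem frontier_connectedComponentIn_subset {U : Set ℂ} (hU : IsOpen U) (p : ℂ) :
    frontier (connectedComponentIn U p) ⊆ Uᶜ := by
  intro z hz hzU
  rw [hU.connectedComponentIn.frontier_eq] at hz
  obtain ⟨x, hx1, hx2⟩ := mem_closure_iff.1 hz.1 _ hU.connectedComponentIn
    (mem_connectedComponentIn hzU)
  have h3 : connectedComponentIn U z = connectedComponentIn U p :=
    (connectedComponentIn_eq hx1).trans (connectedComponentIn_eq hx2).symm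
  exact hz.2 (h3 ▸ mem_connectedComponentIn hzU)

/-- Along the arc `z - p` has a continuous logarithm, which Tietze extends to a function ℓ on the
plane. If the component G of p were bounded, replacing `z - p` by `exp (ℓ z)` inside G would give a
continuous zero-free function on the plane. Its logarithm would be a logarithm of `z - p` on a large
circle, which is impossible. -/
theorem not_isBounded_connectedComponentIn_compl_arc {c : ℝ → ℂ} (hc : ContinuousOn c (Icc 0 1))
    (hi : InjOn c (Icc 0 1)) {p : ℂ} (hp : p ∈ (c '' Icc 0 1)ᶜ) :
    ¬ Bornology.IsBounded (connectedComponentIn (c '' Icc 0 1)ᶜ p) := by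
  intro hbd
  set γ := c '' Icc 0 1 with hγ
  have hγc : IsCompact γ := isCompact_Icc.image_of_continuousOn hc
  set G := connectedComponentIn γᶜ p with hG
  have hpG : p ∈ G := mem_connectedComponentIn hp
  let c' : Icc (0 : ℝ) 1 → ℂ := fun t => c t
  have hc' : Continuous c' := continuousOn_iff_continuous_domRestrict.1 hc
  have hinj : Function.Injective c' := fun s t h => Subtype.ext (hi s.2 t.2 h)
  have hemb : IsClosedEmbedding c' := hc'.isClosedEmbedding hinj
  obtain ⟨L, hL, hLe⟩ := exists_continuous_log
    (g := fun t : ℝ => c' (projIcc 0 1 zero_le_one t) - p)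
    ((hc'.comp continuous_projIcc).sub continuous_const) (fun t h => by
      refine hp ?_
      rw [← sub_eq_zero.1 h]
      exact mem_image_of_mem c (projIcc 0 1 zero_le_one t).2)
  let L' : C(Icc (0 : ℝ) 1, ℂ) := ⟨fun t => L t, hL.comp continuous_subtype_val⟩
  obtain ⟨ℓ, hℓ⟩ := ContinuousMap.exists_extension hemb L'
  have hℓγ : ∀ z ∈ γ, Complex.exp (ℓ z) = z - p := by
    rintro _ ⟨t, ht, rfl⟩
    have h1 : ℓ (c t) = L t := DFunLike.congr_fun hℓ ⟨t, ht⟩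
    rw [h1, hLe, projIcc_of_mem zero_le_one ht]
  classical
  let F : ℂ → ℂ := fun z => if z ∈ G then Complex.exp (ℓ z) else z - p
  have hF : Continuous F := by
    -- The two formulas need to agree only on the frontier of G, which is contained in the arc.
    refine Continuous.if (fun z hz => ?_) (Complex.continuous_exp.comp ℓ.continuous) (by fun_prop)
    have h1 := frontier_connectedComponentIn_subset hγc.isClosed.isOpen_compl p hz
    exact hℓγ z (not_not.1 h1)
  have hF0 : ∀ z, F z ≠ 0 := by
    intro z
    by_cases hz : z ∈ G
    · simp only [F, hz, if_true]; exact Complex.exp_ne_zero _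
    · simp only [F, hz, if_false]
      intro h
      rw [sub_eq_zero.1 h] at hz
      exact hz hpG
  obtain ⟨l, hl, hle⟩ := exists_continuous_log hF hF0
  obtain ⟨R, hR⟩ := hbd.subset_ball p
  have hR0 : 0 < R := by simpa using hR hpG
  refine not_exists_log_on_circle (p := p) hR0 hl fun z hz => ?_
  have : z ∉ G := fun h => by
    have h1 : dist z p < R := hR h
    rw [Metric.mem_sphere.1 hz] at h1
    exact lt_irrefl _ h1
  rw [hle]
  simp [F, this]

theorem isPreconnected_setOf_norm_mem {S : Set ℝ} (hS : IsPreconnected S) (h0 : S ⊆ Ici 0) :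
    IsPreconnected {z : ℂ | ‖z‖ ∈ S} := by
  have h1 : {z : ℂ | ‖z‖ ∈ S} =
      (fun x : ℝ × ℝ => (x.1 : ℂ) * Complex.exp (x.2 * Complex.I)) '' (S ×ˢ univ) := by
    ext z
    constructor
    · intro hz
      exact ⟨(‖z‖, z.arg), ⟨hz, mem_univ _⟩, Complex.norm_mul_exp_arg_mul_I z⟩
    · rintro ⟨⟨r, θ⟩, ⟨hr, -⟩, rfl⟩
      have hr0 : 0 ≤ r := h0 hr
      show ‖_‖ ∈ S
      rw [norm_mul, Complex.norm_exp_ofReal_mul_I, mul_one, Complex.norm_real, Real.norm_eq_abs,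
        abs_of_nonneg hr0]
      exact hr
  rw [h1]
  exact (hS.prod isPreconnected_univ).image _ (by fun_prop)

theorem isPreconnected_compl_closedBall {R : ℝ} (hR : 0 ≤ R) :
    IsPreconnected (Metric.closedBall (0 : ℂ) R)ᶜ := by
  have := isPreconnected_setOf_norm_mem (S := Ioi R) isPreconnected_Ioi
    fun x hx => hR.trans (le_of_lt hx)
  convert this using 1
  ext z; simp

theorem isPreconnected_compl_unitDisk : IsPreconnected unitDiskᶜ := by
  have := isPreconnected_setOf_norm_mem (S := Ici 1) isPreconnected_Ici
    fun x (hx : 1 ≤ x) => (zero_le_one.trans hx : (0 : ℝ) ≤ x)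
  convert this using 1
  ext z; simp

/-- An arc does not separate the plane. -/
theorem isPreconnected_compl_arc {c : ℝ → ℂ} (hc : ContinuousOn c (Icc 0 1))
    (hi : InjOn c (Icc 0 1)) : IsPreconnected (c '' Icc 0 1)ᶜ := by
  set γ := c '' Icc 0 1 with hγ
  have hγc : IsCompact γ := isCompact_Icc.image_of_continuousOn hc
  obtain ⟨R, hR0, hR⟩ : ∃ R, 0 ≤ R ∧ γ ⊆ Metric.closedBall 0 R := by
    obtain ⟨R, hR⟩ := hγc.isBounded.subset_closedBall 0
    exact ⟨max 0 R, le_max_left _ _, hR.trans (Metric.closedBall_subset_closedBall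
      (le_max_right _ _))⟩
  have hsub : (Metric.closedBall (0 : ℂ) R)ᶜ ⊆ γᶜ := compl_subset_compl.2 hR
  -- An unbounded component meets the connected exterior of the ball and so contains it; thus there
  -- is only one component.
  have key : ∀ p ∈ γᶜ, ∀ x ∈ (Metric.closedBall (0 : ℂ) R)ᶜ, x ∈ connectedComponentIn γᶜ p := by
    intro p hp x hx
    have h1 := not_isBounded_connectedComponentIn_compl_arc hc hi hp
    obtain ⟨y, hy, hyR⟩ : ∃ y ∈ connectedComponentIn γᶜ p, y ∉ Metric.closedBall (0 : ℂ) R := by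
      by_contra! h
      exact h1 (Metric.isBounded_closedBall.subset h)
    have h2 := (isPreconnected_compl_closedBall hR0).subset_connectedComponentIn hyR hsub hx
    rwa [← connectedComponentIn_eq hy] at h2
  obtain ⟨x, hx⟩ : ((Metric.closedBall (0 : ℂ) R)ᶜ).Nonempty := by
    by_contra! h
    rw [compl_empty_iff] at h
    exact NormedSpace.unbounded_univ ℝ ℂ (h ▸ Metric.isBounded_closedBall)
  refine isPreconnected_of_forall x fun p hp => ?_
  exact ⟨_, connectedComponentIn_subset _ p, key p hp x hx, mem_connectedComponentIn hp,
    isPreconnected_connectedComponentIn⟩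

/-! ### Cauchy's theorem for cycles of segments. -/

/-- The integral of `k` along the segment from `a` to `b`. -/
noncomputable def segInt (a b : ℂ) (k : ℂ → ℂ) : ℂ :=
  ∫ t in (0 : ℝ)..1, k (a + t * (b - a)) * (b - a)

theorem add_mul_sub_mem_segment {a b : ℂ} {t : ℝ} (ht : t ∈ Icc (0 : ℝ) 1) :
    a + t * (b - a) ∈ segment ℝ a b := by
  rw [segment_eq_image']
  exact ⟨t, ht, by simp⟩

theorem continuousOn_segInt_integrand {a b : ℂ} {k : ℂ → ℂ} (hk : ContinuousOn k (segment ℝ a b)) :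
    ContinuousOn (fun t : ℝ => k (a + t * (b - a)) * (b - a)) (Icc 0 1) := by
  refine ContinuousOn.mul (hk.comp (by fun_prop) fun t ht => add_mul_sub_mem_segment ht)
    continuousOn_const

theorem segInt_add {a b : ℂ} {k l : ℂ → ℂ} (hk : ContinuousOn k (segment ℝ a b))
    (hl : ContinuousOn l (segment ℝ a b)) :
    segInt a b (fun w => k w + l w) = segInt a b k + segInt a b l := by
  unfold segInt
  rw [← intervalIntegral.integral_add]
  · congr 1; ext t; ring
  · exact (continuousOn_segInt_integrand hk).intervalIntegrable_of_Icc zero_le_one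
  · exact (continuousOn_segInt_integrand hl).intervalIntegrable_of_Icc zero_le_one

theorem segInt_const_mul (a b c : ℂ) (k : ℂ → ℂ) :
    segInt a b (fun w => c * k w) = c * segInt a b k := by
  unfold segInt
  rw [← intervalIntegral.integral_const_mul]
  congr 1; ext t; ring

theorem segInt_congr {a b : ℂ} {k l : ℂ → ℂ} (h : EqOn k l (segment ℝ a b)) :
    segInt a b k = segInt a b l := by
  unfold segInt
  refine intervalIntegral.integral_congr fun t ht => ?_
  rw [uIcc_of_le zero_le_one] at ht
  simp only [h (add_mul_sub_mem_segment ht)]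

theorem segInt_eq_sub {a b : ℂ} {k F : ℂ → ℂ} (hk : ContinuousOn k (segment ℝ a b))
    (hF : ∀ w ∈ segment ℝ a b, HasDerivAt F (k w) w) : segInt a b k = F b - F a := by
  have := intervalIntegral.integral_eq_sub_of_hasDerivAt
    (f := fun t : ℝ => F (a + t * (b - a))) (f' := fun t : ℝ => k (a + t * (b - a)) * (b - a))
    (a := 0) (b := 1) (fun t ht => ?_)
    ((continuousOn_segInt_integrand hk).intervalIntegrable_of_Icc zero_le_one)
  · simpa [segInt] using this
  · rw [uIcc_of_le zero_le_one] at ht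
    have h1 := hF _ (add_mul_sub_mem_segment (a := a) (b := b) ht)
    have h2 : HasDerivAt (fun t : ℝ => a + (t : ℂ) * (b - a)) (b - a) t := by
      have := (Complex.ofRealCLM.hasDerivAt (x := t)).mul_const (b - a)
      simpa using this.const_add a
    exact h1.comp_of_eq t h2 rfl

theorem norm_segInt_le {a b : ℂ} {k : ℂ → ℂ} {C : ℝ} (hk : ∀ w ∈ segment ℝ a b, ‖k w‖ ≤ C) :
    ‖segInt a b k‖ ≤ C * ‖b - a‖ := by
  have := intervalIntegral.norm_integral_le_of_norm_le_const (a := (0 : ℝ)) (b := 1)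
    (f := fun t : ℝ => k (a + t * (b - a)) * (b - a)) (C := C * ‖b - a‖) fun t ht => by
      rw [uIoc_of_le zero_le_one] at ht
      rw [norm_mul]
      exact mul_le_mul_of_nonneg_right (hk _ (add_mul_sub_mem_segment ⟨ht.1.le, ht.2⟩))
        (norm_nonneg _)
  simpa [segInt] using this

theorem segInt_swap (a b : ℂ) (k : ℂ → ℂ) : segInt b a k = -segInt a b k := by
  unfold segInt
  have h := intervalIntegral.integral_comp_sub_left (a := (0 : ℝ)) (b := 1)
    (fun t : ℝ => k (a + t * (b - a)) * (b - a)) 1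
  simp only [sub_self, sub_zero] at h
  rw [← h, ← intervalIntegral.integral_neg]
  congr 1; ext t
  have : a + ((1 - t : ℝ) : ℂ) * (b - a) = b + t * (a - b) := by push_cast; ring
  rw [this]; ring

theorem isCompact_segment (a b : ℂ) : IsCompact (segment ℝ a b) := by
  rw [segment_eq_image']
  exact isCompact_Icc.image (by fun_prop)

/-- Integrals over a segment depend holomorphically on a holomorphic parameter. -/
theorem differentiableOn_segInt {a b : ℂ} {K : ℂ → ℂ → ℂ} {O : Set ℂ} (hO : IsOpen O)
    (hK : ContinuousOn (Function.uncurry K) (O ×ˢ segment ℝ a b))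
    (hd : ∀ w ∈ segment ℝ a b, DifferentiableOn ℂ (fun z => K z w) O) :
    DifferentiableOn ℂ (fun z => segInt a b (K z)) O := by
  intro z₀ hz₀
  refine DifferentiableAt.differentiableWithinAt ?_
  obtain ⟨r', hr', hball⟩ := Metric.isOpen_iff.1 hO z₀ hz₀
  -- Circles of radius r about points of the r-ball stay in a closed ball of radius 2r inside O, so
  -- Cauchy's estimate gives a derivative bound uniform in the parameter.
  set r := r' / 3 with hrdef
  have hr : 0 < r := by positivity
  have hsub : Metric.closedBall z₀ (2 * r) ⊆ O := fun z hz => hball (by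
    have := Metric.mem_closedBall.1 hz
    rw [Metric.mem_ball]; linarith)
  have hKz : ∀ z ∈ O, ContinuousOn (K z) (segment ℝ a b) := fun z hz =>
    hK.comp (Continuous.prodMk_right z).continuousOn fun w hw => ⟨hz, hw⟩
  obtain ⟨C, hC⟩ := ((isCompact_closedBall z₀ (2 * r)).prod
    (isCompact_segment a b)).exists_bound_of_continuousOn (hK.mono (prod_mono_left hsub))
  have hbound : ∀ w ∈ segment ℝ a b, ∀ z ∈ Metric.ball z₀ r,
      ‖deriv (fun z => K z w) z‖ ≤ C / r := by
    intro w hw z hz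
    refine Complex.norm_deriv_le_of_forall_mem_sphere_norm_le hr ?_ fun y hy => ?_
    · refine DifferentiableOn.diffContOnCl ((hd w hw).mono ?_)
      refine Metric.closure_ball_subset_closedBall.trans
        ((Metric.closedBall_subset_closedBall' ?_).trans hsub)
      have := Metric.mem_ball.1 hz
      linarith
    · refine hC (y, w) ⟨?_, hw⟩
      have h1 := Metric.mem_ball.1 hz
      have h2 := Metric.mem_sphere.1 hy
      rw [Metric.mem_closedBall]
      linarith [dist_triangle y z z₀]
  have hIcc : ∀ t ∈ Set.uIoc (0 : ℝ) 1, a + t * (b - a) ∈ segment ℝ a b := fun t ht => by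
    rw [uIoc_of_le zero_le_one] at ht
    exact add_mul_sub_mem_segment ⟨ht.1.le, ht.2⟩
  have hderiv : ∀ t ∈ Set.uIoc (0 : ℝ) 1, ∀ z ∈ Metric.ball z₀ r,
      HasDerivAt (fun z => K z (a + t * (b - a)) * (b - a))
        (deriv (fun z => K z (a + t * (b - a))) z * (b - a)) z := by
    intro t ht z hz
    have hzO : z ∈ O := hsub (Metric.ball_subset_closedBall
      (Metric.ball_subset_ball (by linarith) hz))
    exact (((hd _ (hIcc t ht)).differentiableAt (hO.mem_nhds hzO)).hasDerivAt).mul_const _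
  have hint : ∀ z ∈ O, ContinuousOn (fun t : ℝ => K z (a + t * (b - a)) * (b - a)) (Icc 0 1) :=
    fun z hz => continuousOn_segInt_integrand (hKz z hz)
  have hmeas : ∀ z ∈ O, MeasureTheory.AEStronglyMeasurable
      (fun t : ℝ => K z (a + t * (b - a)) * (b - a))
      (MeasureTheory.volume.restrict (Set.uIoc (0 : ℝ) 1)) := fun z hz => by
    rw [uIoc_of_le zero_le_one]
    exact ((hint z hz).mono Ioc_subset_Icc_self).aestronglyMeasurable measurableSet_Ioc
  have hballO : Metric.ball z₀ r ⊆ O := fun z hz => hsub (Metric.ball_subset_closedBall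
    (Metric.ball_subset_ball (by linarith) hz))
  refine (intervalIntegral.hasDerivAt_integral_of_dominated_loc_of_deriv_le
    (F := fun z t => K z (a + t * (b - a)) * (b - a))
    (F' := fun z t => deriv (fun z => K z (a + t * (b - a))) z * (b - a))
    (bound := fun _ => C / r * ‖b - a‖) (Metric.ball_mem_nhds z₀ hr) ?_ ?_ ?_ ?_ ?_
    ?_).2.differentiableAt
  · filter_upwards [Metric.ball_mem_nhds z₀ hr] with z hz using hmeas z (hballO hz)
  · exact (hint z₀ hz₀).intervalIntegrable_of_Icc zero_le_one
  · -- the derivative is a limit of difference quotients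
    let h : ℕ → ℂ := fun n => ((r / 2 * (1 / ((n : ℝ) + 1)) : ℝ) : ℂ)
    have hn0 : ∀ n, h n ≠ 0 := fun n => by
      simp only [h, ne_eq, Complex.ofReal_eq_zero]; positivity
    have hlim : Tendsto h atTop (𝓝[≠] 0) := by
      refine tendsto_nhdsWithin_iff.2 ⟨?_, Eventually.of_forall fun n => hn0 n⟩
      have := (tendsto_one_div_add_atTop_nhds_zero_nat (𝕜 := ℝ)).const_mul (r / 2)
      rw [mul_zero] at this
      exact (Complex.continuous_ofReal.tendsto _).comp this
    have hmem : ∀ n, z₀ + h n ∈ Metric.ball z₀ r := fun n => by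
      have h1 : 1 / ((n : ℝ) + 1) ≤ 1 := by
        rw [div_le_one (by positivity)]; linarith [(Nat.cast_nonneg n : (0 : ℝ) ≤ n)]
      have h2 : (0 : ℝ) < 1 / ((n : ℝ) + 1) := by positivity
      rw [Metric.mem_ball, dist_eq_norm, add_sub_cancel_left, Complex.norm_real, Real.norm_eq_abs,
        abs_of_pos (by positivity)]
      nlinarith
    refine aestronglyMeasurable_of_tendsto_ae atTop
      (f := fun n (t : ℝ) => (h n)⁻¹ * (K (z₀ + h n) (a + t * (b - a)) * (b - a)
        - K z₀ (a + t * (b - a)) * (b - a)))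
      (fun n => ((hmeas _ (hballO (hmem n))).sub (hmeas _ hz₀)).const_mul _) ?_
    refine (MeasureTheory.ae_restrict_iff' measurableSet_uIoc).2 (Eventually.of_forall fun t ht => ?_)
    have := (hasDerivAt_iff_tendsto_slope_zero.1
      (hderiv t ht z₀ (Metric.mem_ball_self hr))).comp hlim
    simpa [Function.comp_def] using this
  · refine Eventually.of_forall fun t ht z hz => ?_
    rw [norm_mul]
    exact mul_le_mul_of_nonneg_right (hbound _ (hIcc t ht) z hz) (norm_nonneg _)
  · exact intervalIntegrable_const
  · exact Eventually.of_forall fun t ht z hz => hderiv t ht z hz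

/-- The sum of the integrals of `k` over a list of oriented segments. -/
noncomputable def chainInt (L : List (ℂ × ℂ)) (k : ℂ → ℂ) : ℂ :=
  (L.map fun e => segInt e.1 e.2 k).sum

/-- The value of the boundary of a chain of segments on a function. -/
def chainBoundary (L : List (ℂ × ℂ)) (F : ℂ → ℂ) : ℂ := (L.map fun e => F e.2 - F e.1).sum

/-- The union of the segments of a chain. -/
def chainSupport (L : List (ℂ × ℂ)) : Set ℂ := {z | ∃ e ∈ L, z ∈ segment ℝ e.1 e.2}

theorem chainSupport_cons (e : ℂ × ℂ) (L : List (ℂ × ℂ)) :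
    chainSupport (e :: L) = segment ℝ e.1 e.2 ∪ chainSupport L := by
  ext z; simp [chainSupport]

theorem chainSupport_append (L M : List (ℂ × ℂ)) :
    chainSupport (L ++ M) = chainSupport L ∪ chainSupport M := by
  ext z; simp [chainSupport, or_and_right, exists_or]

theorem chainSupport_swap (L : List (ℂ × ℂ)) :
    chainSupport (L.map Prod.swap) = chainSupport L := by
  induction L with
  | nil => rfl
  | cons e L ih =>
    rw [List.map_cons, chainSupport_cons, chainSupport_cons, ih, Prod.fst_swap, Prod.snd_swap,
      segment_symm]

theorem isCompact_chainSupport (L : List (ℂ × ℂ)) : IsCompact (chainSupport L) := by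
  induction L with
  | nil => simp [chainSupport]
  | cons e L ih => rw [chainSupport_cons]; exact (isCompact_segment _ _).union ih

theorem chainInt_cons (e : ℂ × ℂ) (L : List (ℂ × ℂ)) (k : ℂ → ℂ) :
    chainInt (e :: L) k = segInt e.1 e.2 k + chainInt L k := by simp [chainInt]

theorem chainInt_append (L M : List (ℂ × ℂ)) (k : ℂ → ℂ) :
    chainInt (L ++ M) k = chainInt L k + chainInt M k := by simp [chainInt]

theorem chainInt_swap (L : List (ℂ × ℂ)) (k : ℂ → ℂ) :
    chainInt (L.map Prod.swap) k = -chainInt L k := by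
  induction L with
  | nil => simp [chainInt]
  | cons e L ih =>
    rw [List.map_cons, chainInt_cons, chainInt_cons, ih, Prod.fst_swap, Prod.snd_swap,
      segInt_swap]; ring

theorem chainBoundary_append (L M : List (ℂ × ℂ)) (k : ℂ → ℂ) :
    chainBoundary (L ++ M) k = chainBoundary L k + chainBoundary M k := by simp [chainBoundary]

theorem chainBoundary_swap (L : List (ℂ × ℂ)) (k : ℂ → ℂ) :
    chainBoundary (L.map Prod.swap) k = -chainBoundary L k := by
  induction L with
  | nil => simp [chainBoundary]
  | cons e L ih =>
    simp only [chainBoundary, List.map_cons, List.sum_cons, Prod.fst_swap, Prod.snd_swap] at ih ⊢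
    rw [ih]; ring

theorem chainInt_add {L : List (ℂ × ℂ)} {k l : ℂ → ℂ} (hk : ContinuousOn k (chainSupport L))
    (hl : ContinuousOn l (chainSupport L)) :
    chainInt L (fun w => k w + l w) = chainInt L k + chainInt L l := by
  induction L with
  | nil => simp [chainInt]
  | cons e L ih =>
    rw [chainSupport_cons] at hk hl
    rw [chainInt_cons, chainInt_cons, chainInt_cons,
      ih (hk.mono subset_union_right) (hl.mono subset_union_right),
      segInt_add (hk.mono subset_union_left) (hl.mono subset_union_left)]
    ring

theorem chainInt_const_mul (L : List (ℂ × ℂ)) (c : ℂ) (k : ℂ → ℂ) :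
    chainInt L (fun w => c * k w) = c * chainInt L k := by
  induction L with
  | nil => simp [chainInt]
  | cons e L ih => rw [chainInt_cons, chainInt_cons, ih, segInt_const_mul]; ring

theorem chainInt_congr {L : List (ℂ × ℂ)} {k l : ℂ → ℂ} (h : EqOn k l (chainSupport L)) :
    chainInt L k = chainInt L l := by
  induction L with
  | nil => simp [chainInt]
  | cons e L ih =>
    rw [chainSupport_cons] at h
    rw [chainInt_cons, chainInt_cons, ih (h.mono subset_union_right),
      segInt_congr (h.mono subset_union_left)]

theorem chainInt_eq_chainBoundary {L : List (ℂ × ℂ)} {k F : ℂ → ℂ}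
    (hk : ContinuousOn k (chainSupport L)) (hF : ∀ w ∈ chainSupport L, HasDerivAt F (k w) w) :
    chainInt L k = chainBoundary L F := by
  induction L with
  | nil => simp [chainInt, chainBoundary]
  | cons e L ih =>
    rw [chainSupport_cons] at hk hF
    rw [chainInt_cons, ih (hk.mono subset_union_right) (fun w hw => hF w (Or.inr hw)),
      segInt_eq_sub (hk.mono subset_union_left) (fun w hw => hF w (Or.inl hw))]
    simp [chainBoundary]

theorem exists_norm_chainInt_le (L : List (ℂ × ℂ)) : ∃ B : ℝ, 0 ≤ B ∧ ∀ (k : ℂ → ℂ) (C : ℝ),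
    (∀ w ∈ chainSupport L, ‖k w‖ ≤ C) → ‖chainInt L k‖ ≤ C * B := by
  induction L with
  | nil => exact ⟨0, le_rfl, by simp [chainInt]⟩
  | cons e L ih =>
    obtain ⟨B, hB, h⟩ := ih
    refine ⟨‖e.2 - e.1‖ + B, by positivity, fun k C hk => ?_⟩
    rw [chainSupport_cons] at hk
    rw [chainInt_cons, mul_add]
    exact (norm_add_le _ _).trans (add_le_add (norm_segInt_le fun w hw => hk w (Or.inl hw))
      (h k C fun w hw => hk w (Or.inr hw)))

theorem differentiableOn_chainInt {L : List (ℂ × ℂ)} {K : ℂ → ℂ → ℂ} {O : Set ℂ} (hO : IsOpen O)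
    (hK : ContinuousOn (Function.uncurry K) (O ×ˢ chainSupport L))
    (hd : ∀ w ∈ chainSupport L, DifferentiableOn ℂ (fun z => K z w) O) :
    DifferentiableOn ℂ (fun z => chainInt L (K z)) O := by
  induction L with
  | nil => simp [chainInt]
  | cons e L ih =>
    rw [chainSupport_cons] at hK hd
    simp_rw [chainInt_cons]
    exact (differentiableOn_segInt hO (hK.mono (prod_mono_right subset_union_left))
      fun w hw => hd w (Or.inl hw)).add (ih (hK.mono (prod_mono_right subset_union_right))
      fun w hw => hd w (Or.inr hw))

/-- The winding number of a cycle, up to the factor `2πi`. -/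
noncomputable def chainIndex (L : List (ℂ × ℂ)) (z : ℂ) : ℂ := chainInt L fun w => (w - z)⁻¹

theorem continuousOn_sub_inv {S : Set ℂ} {z : ℂ} (hz : z ∉ S) :
    ContinuousOn (fun w => (w - z)⁻¹) S :=
  ContinuousOn.inv₀ (by fun_prop) fun w hw h => hz (sub_eq_zero.1 h ▸ hw)

/-- The difference of the two kernels has the primitive `log ((w - z) / (w - z₀))`: for z near z₀
the quotient stays within distance 1 of 1, in the slit plane. A cycle integrates it to 0. -/
theorem eventually_chainIndex_eq {L : List (ℂ × ℂ)} (hL : ∀ F, chainBoundary L F = 0) {z₀ : ℂ}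
    (hz₀ : z₀ ∉ chainSupport L) : ∀ᶠ z in 𝓝 z₀, chainIndex L z = chainIndex L z₀ := by
  obtain ⟨r, hr, hball⟩ := Metric.isOpen_iff.1 (isCompact_chainSupport L).isClosed.isOpen_compl
    z₀ hz₀
  filter_upwards [Metric.ball_mem_nhds z₀ hr] with z hz
  have hzS : z ∉ chainSupport L := hball hz
  have hc : ContinuousOn (fun w => (w - z)⁻¹ - (w - z₀)⁻¹) (chainSupport L) :=
    (continuousOn_sub_inv hzS).sub (continuousOn_sub_inv hz₀)
  have h1 : chainIndex L z = chainInt L (fun w => (w - z)⁻¹ - (w - z₀)⁻¹) + chainIndex L z₀ := by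
    unfold chainIndex
    rw [← chainInt_add hc (continuousOn_sub_inv hz₀)]
    simp
  rw [h1, add_eq_right, chainInt_eq_chainBoundary (F := fun w => Complex.log ((w - z) / (w - z₀)))
    hc, hL]
  intro w hw
  have hw0 : w - z₀ ≠ 0 := fun h => hz₀ (sub_eq_zero.1 h ▸ hw)
  have hwz : w - z ≠ 0 := fun h => hzS (sub_eq_zero.1 h ▸ hw)
  have hslit : (w - z) / (w - z₀) ∈ Complex.slitPlane := by
    have h2 : (w - z) / (w - z₀) = 1 + (z₀ - z) / (w - z₀) := by field_simp; ring
    rw [h2]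
    refine Complex.mem_slitPlane_of_norm_lt_one ?_
    rw [norm_div, div_lt_one (norm_pos_iff.2 hw0)]
    have h3 : ‖z - z₀‖ < r := by simpa [dist_eq_norm] using hz
    have h4 : r ≤ ‖w - z₀‖ := by
      by_contra! h
      exact hball (by simpa [dist_eq_norm] using h) hw
    rw [norm_sub_rev]; linarith
  have h5 : HasDerivAt (fun w => (w - z) / (w - z₀)) ((1 * (w - z₀) - (w - z) * 1) / (w - z₀) ^ 2)
      w := ((hasDerivAt_id w).sub_const z).div ((hasDerivAt_id w).sub_const z₀) hw0
  refine (h5.clog hslit).congr_deriv ?_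
  field_simp

/-- The index is locally constant off the cycle, so it is constant on the connected complement of V,
and it tends to 0 far away. -/
theorem chainIndex_eq_zero {L : List (ℂ × ℂ)} (hL : ∀ F, chainBoundary L F = 0) {V : Set ℂ}
    (hb : Bornology.IsBounded V) (hT : IsPreconnected Vᶜ) (hLV : chainSupport L ⊆ V) {z₀ : ℂ}
    (hz₀ : z₀ ∉ V) : chainIndex L z₀ = 0 := by
  set S := chainSupport L with hS
  have hopen : ∀ P : ℂ → Prop, IsOpen {z | z ∉ S ∧ P (chainIndex L z)} := by
    intro P
    rw [isOpen_iff_mem_nhds]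
    rintro z ⟨hz, hP⟩
    filter_upwards [eventually_chainIndex_eq hL hz,
      (isCompact_chainSupport L).isClosed.isOpen_compl.mem_nhds hz] with y hy1 hy2
    exact ⟨hy2, hy1 ▸ hP⟩
  have hconst : ∀ z ∉ V, chainIndex L z = chainIndex L z₀ := by
    have := hT.subset_left_of_subset_union (hopen fun x => x = chainIndex L z₀)
      (hopen fun x => x ≠ chainIndex L z₀) ?_ ?_ ?_
    · exact fun z hz => (this hz).2
    · rw [Set.disjoint_left]; exact fun z h1 h2 => h2.2 h1.2
    · intro z hz
      have hzS : z ∉ S := fun h => hz (hLV h)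
      by_cases h : chainIndex L z = chainIndex L z₀
      · exact Or.inl ⟨hzS, h⟩
      · exact Or.inr ⟨hzS, h⟩
    · exact ⟨z₀, hz₀, fun h => hz₀ (hLV h), rfl⟩
  obtain ⟨R, hR0, hR⟩ := hb.subset_ball_lt 0 0
  obtain ⟨B, hB, hbound⟩ := exists_norm_chainInt_le L
  have hle : ∀ n : ℕ, ‖chainIndex L z₀‖ ≤ 1 / ((n : ℝ) + 1) * B := by
    intro n
    have hz : ((R + (n + 1) : ℝ) : ℂ) ∉ V := fun h => by
      have h1 := hR h
      rw [mem_ball_zero_iff, Complex.norm_real, Real.norm_eq_abs, abs_of_pos (by positivity)] at h1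
      have : (0 : ℝ) < n + 1 := by positivity
      linarith
    rw [← hconst _ hz]
    refine hbound _ _ fun w hw => ?_
    have h1 : ‖w‖ < R := by simpa using hR (hLV hw)
    rw [norm_inv, inv_eq_one_div]
    refine one_div_le_one_div_of_le (by positivity) ?_
    have h2 := norm_sub_norm_le ((R + (n + 1) : ℝ) : ℂ) w
    rw [Complex.norm_real, Real.norm_eq_abs, abs_of_pos (by positivity), norm_sub_rev] at h2
    linarith
  have hlim : Tendsto (fun n : ℕ => 1 / ((n : ℝ) + 1) * B) atTop (𝓝 0) := by
    simpa using (tendsto_one_div_add_atTop_nhds_zero_nat (𝕜 := ℝ)).mul_const B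
  exact norm_le_zero_iff.1 (ge_of_tendsto' hlim hle)

/-- Off the diagonal this is a quotient of continuous functions; at the diagonal it follows from
strict differentiability and continuity of the derivative. -/
theorem continuousOn_dslope_prod {h : ℂ → ℂ} {V : Set ℂ} (hV : IsOpen V)
    (hh : DifferentiableOn ℂ h V) :
    ContinuousOn (Function.uncurry fun z w => dslope h z w) (V ×ˢ V) := by
  rintro ⟨z₀, w₀⟩ ⟨hz, hw⟩
  refine ContinuousAt.continuousWithinAt ?_
  by_cases hne : z₀ = w₀
  · subst hne
    have han := hh.analyticAt (hV.mem_nhds hz)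
    have hval : Function.uncurry (fun z w => dslope h z w) (z₀, z₀) = deriv h z₀ := by
      simp [Function.uncurry]
    rw [ContinuousAt, hval, Metric.tendsto_nhds]
    intro ε hε
    have h1 := (han.hasStrictDerivAt.hasStrictFDerivAt.isLittleO).def (half_pos hε)
    have h2 : ∀ᶠ p : ℂ × ℂ in 𝓝 (z₀, z₀), dist (deriv h p.1) (deriv h z₀) < ε := by
      have : ContinuousAt (fun p : ℂ × ℂ => deriv h p.1) (z₀, z₀) :=
        ContinuousAt.comp (f := Prod.fst) (x := (z₀, z₀)) han.deriv.continuousAt continuousAt_fst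
      exact Metric.tendsto_nhds.1 this ε hε
    filter_upwards [h1, h2] with p hp1 hp2
    obtain ⟨z, w⟩ := p
    simp only [Function.uncurry] at *
    by_cases hzw : w = z
    · subst hzw; simpa using hp2
    · rw [dslope_of_ne _ hzw, slope_def_field, dist_eq_norm]
      have hn : z - w ≠ 0 := sub_ne_zero.2 (Ne.symm hzw)
      have hn' : w - z ≠ 0 := sub_ne_zero.2 hzw
      have h3 : (h w - h z) / (w - z) - deriv h z₀
          = (h z - h w - (z - w) * deriv h z₀) / (z - w) := by
        field_simp; ring
      rw [h3, norm_div]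
      simp at hp1
      refine lt_of_le_of_lt ?_ (half_lt_self hε)
      rw [div_le_iff₀ (norm_pos_iff.2 hn)]
      exact hp1
  · have hcz : ContinuousAt (fun p : ℂ × ℂ => h p.1) (z₀, w₀) :=
      ContinuousAt.comp (f := Prod.fst) (x := (z₀, w₀))
        (hh.differentiableAt (hV.mem_nhds hz)).continuousAt continuousAt_fst
    have hcw : ContinuousAt (fun p : ℂ × ℂ => h p.2) (z₀, w₀) :=
      ContinuousAt.comp (f := Prod.snd) (x := (z₀, w₀))
        (hh.differentiableAt (hV.mem_nhds hw)).continuousAt continuousAt_snd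
    have h1 : ContinuousAt (fun p : ℂ × ℂ => (h p.2 - h p.1) / (p.2 - p.1)) (z₀, w₀) :=
      (hcw.sub hcz).div (continuousAt_snd.sub continuousAt_fst) (sub_ne_zero.2 (Ne.symm hne))
    refine h1.congr ?_
    have hne' : ∀ᶠ p : ℂ × ℂ in 𝓝 (z₀, w₀), p.1 ≠ p.2 :=
      (isOpen_ne_fun continuous_fst continuous_snd).mem_nhds hne
    filter_upwards [hne'] with p hp
    simp only [Function.uncurry]
    rw [dslope_of_ne _ hp.symm, slope_def_field]

theorem dslope_symm (h : ℂ → ℂ) (z w : ℂ) : dslope h z w = dslope h w z := by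
  by_cases hzw : z = w
  · rw [hzw]
  · rw [dslope_of_ne _ (Ne.symm hzw), dslope_of_ne _ hzw, slope_comm]

/-- Dixon's argument for the homology version of Cauchy's theorem. -/
theorem chainInt_div_sub_eq_zero {L : List (ℂ × ℂ)} (hL : ∀ F, chainBoundary L F = 0) {V : Set ℂ}
    (hV : IsOpen V) (hb : Bornology.IsBounded V) (hT : IsPreconnected Vᶜ)
    (hLV : chainSupport L ⊆ V) {h : ℂ → ℂ} (hh : DifferentiableOn ℂ h V) {z : ℂ} (hz : z ∉ V) :
    chainInt L (fun w => h w / (w - z)) = 0 := by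
  classical
  set S := chainSupport L with hS
  have hSc : IsCompact S := isCompact_chainSupport L
  have hhS : ContinuousOn h S := hh.continuousOn.mono hLV
  set O : Set ℂ := {z | z ∉ S ∧ chainIndex L z = 0} with hOdef
  have hO : IsOpen O := by
    rw [isOpen_iff_mem_nhds]
    rintro z ⟨hz, hP⟩
    filter_upwards [eventually_chainIndex_eq hL hz, hSc.isClosed.isOpen_compl.mem_nhds hz]
      with y hy1 hy2
    exact ⟨hy2, hy1.trans hP⟩
  have hVO : ∀ z ∉ V, z ∈ O := fun z hz =>
    ⟨fun h => hz (hLV h), chainIndex_eq_zero hL hb hT hLV hz⟩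
  set G1 : ℂ → ℂ := fun z => chainInt L (fun w => dslope h z w) with hG1
  set G2 : ℂ → ℂ := fun z => chainInt L (fun w => h w / (w - z)) with hG2
  have hcont2 : ∀ z ∉ S, ContinuousOn (fun w => h w / (w - z)) S := fun z hz => by
    simp_rw [div_eq_mul_inv]
    exact hhS.mul (continuousOn_sub_inv hz)
  have hG1d : DifferentiableOn ℂ G1 V := by
    refine differentiableOn_chainInt hV
      ((continuousOn_dslope_prod hV hh).mono (prod_mono_right hLV)) fun w hw => ?_
    simp_rw [dslope_symm h _ w]
    exact (Complex.differentiableOn_dslope (hV.mem_nhds (hLV hw))).2 hh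
  have hG2d : DifferentiableOn ℂ G2 O := by
    refine differentiableOn_chainInt hO ?_ fun w hw => ?_
    · refine ContinuousOn.div (hhS.comp continuousOn_snd fun p hp => hp.2) (by fun_prop) ?_
      rintro ⟨z, w⟩ ⟨hz, hw⟩ h
      exact hz.1 (sub_eq_zero.1 h ▸ hw)
    · intro z hz
      refine DifferentiableAt.differentiableWithinAt ?_
      have : w - z ≠ 0 := fun h => hz.1 (sub_eq_zero.1 h ▸ hw)
      fun_prop (disch := assumption)
  have hEq : ∀ z ∈ V ∩ O, G1 z = G2 z := by
    rintro z ⟨hzV, hzS, hz0⟩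
    have h1 : G1 z = chainInt L (fun w => h w / (w - z) + -h z * (w - z)⁻¹) := by
      refine chainInt_congr fun w hw => ?_
      have hne : w ≠ z := fun h => hzS (h ▸ hw)
      rw [dslope_of_ne _ hne, slope_def_field]
      ring
    have hc : ContinuousOn (fun w => -h z * (w - z)⁻¹) S :=
      continuousOn_const.mul (continuousOn_sub_inv hzS)
    rw [h1, chainInt_add (hcont2 z hzS) hc, chainInt_const_mul]
    change _ + -h z * chainIndex L z = _
    rw [hz0, mul_zero, add_zero]
  -- Index 0 makes G1 and G2 agree on the overlap of V and O, which cover the plane. The glued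
  -- function is entire and tends to 0 at infinity, hence vanishes.
  set G : ℂ → ℂ := fun z => if z ∈ V then G1 z else G2 z with hG
  have hGV : ∀ z ∈ V, G z = G1 z := fun z hz => if_pos hz
  have hGO : ∀ z ∈ O, G z = G2 z := fun z hz => by
    by_cases h : z ∈ V
    · rw [hGV z h, hEq z ⟨h, hz⟩]
    · exact if_neg h
  have hGd : Differentiable ℂ G := by
    intro z
    by_cases h : z ∈ V
    · refine (hG1d.differentiableAt (hV.mem_nhds h)).congr_of_eventuallyEq ?_
      filter_upwards [hV.mem_nhds h] with y hy using hGV y hy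
    · refine (hG2d.differentiableAt (hO.mem_nhds (hVO z h))).congr_of_eventuallyEq ?_
      filter_upwards [hO.mem_nhds (hVO z h)] with y hy using hGO y hy
  obtain ⟨R, hR0, hR⟩ := hb.subset_ball_lt 0 0
  obtain ⟨B, hB, hbound⟩ := exists_norm_chainInt_le L
  obtain ⟨C, hC⟩ := hSc.exists_bound_of_continuousOn hhS
  have hlim : Tendsto G (cocompact ℂ) (𝓝 0) := by
    have hn : Tendsto (fun z : ℂ => ‖z‖ - R) (cocompact ℂ) atTop :=
      by
      simpa [sub_eq_add_neg] using
        tendsto_atTop_add_const_right (cocompact ℂ) (-R) tendsto_norm_cocompact_atTop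
    have h0 : Tendsto (fun z : ℂ => max C 0 * (‖z‖ - R)⁻¹ * B) (cocompact ℂ) (𝓝 0) := by
      simpa using ((tendsto_inv_atTop_zero.comp hn).const_mul (max C 0)).mul_const B
    refine squeeze_zero_norm' ?_ h0
    filter_upwards [hn.eventually_gt_atTop 0] with z hz
    have hzV : z ∉ V := fun h => by
      have := hR h
      rw [mem_ball_zero_iff] at this
      linarith
    rw [hGO z (hVO z hzV)]
    refine hbound _ _ fun w hw => ?_
    have h1 : ‖w‖ < R := by simpa using hR (hLV hw)
    have h2 := norm_sub_norm_le z w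
    rw [norm_sub_rev] at h2
    rw [div_eq_mul_inv, norm_mul, norm_inv]
    refine mul_le_mul ((hC w hw).trans (le_max_left _ _)) ?_ (by positivity) (by positivity)
    exact inv_anti₀ hz (by linarith)
  have := hGd.apply_eq_of_tendsto_cocompact z hlim
  rw [hGO z (hVO z hz)] at this
  exact this

/-- Cauchy's theorem for cycles in a bounded open set with connected complement. -/
theorem chainInt_eq_zero {L : List (ℂ × ℂ)} (hL : ∀ F, chainBoundary L F = 0) {V : Set ℂ}
    (hV : IsOpen V) (hb : Bornology.IsBounded V) (hT : IsPreconnected Vᶜ)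
    (hLV : chainSupport L ⊆ V) {h : ℂ → ℂ} (hh : DifferentiableOn ℂ h V) : chainInt L h = 0 := by
  obtain ⟨z, hz⟩ : ∃ z, z ∉ V := by
    by_contra! h
    exact NormedSpace.unbounded_univ ℝ ℂ (eq_univ_of_forall h ▸ hb)
  have hzS : z ∉ chainSupport L := fun h => hz (hLV h)
  have hhS := hh.continuousOn.mono hLV
  have h1 := chainInt_div_sub_eq_zero hL hV hb hT hLV hh hz
  have h2 := chainInt_div_sub_eq_zero hL hV hb hT hLV
    (show DifferentiableOn ℂ (fun w => w * h w) V from differentiableOn_id.mul hh) hz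
  -- Write `h w` as `(w * h w - z * h w) / (w - z)`: both resulting Cauchy integrals vanish at the
  -- exterior point z.
  have h3 : chainInt L h = chainInt L (fun w => w * h w / (w - z) + -z * (h w / (w - z))) := by
    refine chainInt_congr fun w hw => ?_
    have hne : w - z ≠ 0 := fun h => hzS (sub_eq_zero.1 h ▸ hw)
    field_simp
    ring
  have hc : ContinuousOn (fun w => h w / (w - z)) (chainSupport L) := by
    simp_rw [div_eq_mul_inv]
    exact hhS.mul (continuousOn_sub_inv hzS)
  rw [h3, chainInt_add, chainInt_const_mul, h1, h2]
  · simp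
  · simp_rw [mul_div_assoc]
    exact continuousOn_id.mul hc
  · exact continuousOn_const.mul hc

/-! ### Existence of primitives and square roots. -/

/-- `V` is a set on which every holomorphic function has a primitive. -/
def HasPrimitives (V : Set ℂ) : Prop :=
  ∀ h : ℂ → ℂ, DifferentiableOn ℂ h V → ∃ H : ℂ → ℂ, ∀ z ∈ V, HasDerivAt H (h z) z

/-- Reachability from z₀ by segments is locally constant because balls are convex, so connectedness
makes it constant. -/
theorem exists_chain_of_isPreconnected {V : Set ℂ} (hV : IsOpen V) (hc : IsPreconnected V)
    {z₀ : ℂ} (hz₀ : z₀ ∈ V) {z : ℂ} (hz : z ∈ V) :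
    ∃ L : List (ℂ × ℂ), chainSupport L ⊆ V ∧ ∀ F, chainBoundary L F = F z - F z₀ := by
  set P : ℂ → Prop := fun z => ∃ L : List (ℂ × ℂ), chainSupport L ⊆ V ∧
    ∀ F, chainBoundary L F = F z - F z₀ with hP
  have hstep : ∀ a b, segment ℝ a b ⊆ V → P a → P b := by
    rintro a b hab ⟨L, hL, hF⟩
    refine ⟨(a, b) :: L, ?_, fun F => ?_⟩
    · rw [chainSupport_cons]; exact union_subset hab hL
    · have := hF F
      simp only [chainBoundary, List.map_cons, List.sum_cons] at this ⊢
      rw [this]; ring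
  have hball : ∀ a ∈ V, ∃ r > 0, Metric.ball a r ⊆ V ∧ ∀ b ∈ Metric.ball a r, (P a ↔ P b) := by
    intro a ha
    obtain ⟨r, hr, hsub⟩ := Metric.isOpen_iff.1 hV a ha
    refine ⟨r, hr, hsub, fun b hb => ?_⟩
    have hab : segment ℝ a b ⊆ V :=
      ((convex_ball a r).segment_subset (Metric.mem_ball_self hr) hb).trans hsub
    exact ⟨hstep a b hab, hstep b a (segment_symm ℝ a b ▸ hab)⟩
  have hopen : ∀ Q : Prop → Prop, IsOpen {z | z ∈ V ∧ Q (P z)} := by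
    intro Q
    rw [Metric.isOpen_iff]
    rintro a ⟨ha, hQ⟩
    obtain ⟨r, hr, hsub, hiff⟩ := hball a ha
    exact ⟨r, hr, fun b hb => ⟨hsub hb, (propext (hiff b hb)) ▸ hQ⟩⟩
  have := hc.subset_left_of_subset_union (hopen fun p => p) (hopen fun p => ¬p) ?_ ?_ ?_
  · exact (this hz).2
  · rw [Set.disjoint_left]; exact fun z h1 h2 => h2.2 h1.2
  · intro z hz
    by_cases h : P z
    · exact Or.inl ⟨hz, h⟩
    · exact Or.inr ⟨hz, h⟩
  · exact ⟨z₀, hz₀, hz₀, [], by simp [chainSupport], by simp [chainBoundary]⟩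

/-- Integrate along any chosen chain from z₀. For w near z, the chain to z, the segment to w and the
reversed chain to w form a cycle, so increments agree with those of a primitive on a ball. -/
theorem exists_primitive_of_chainInt_eq_zero {V : Set ℂ} (hV : IsOpen V) (hc : IsPreconnected V)
    {h : ℂ → ℂ} (hh : DifferentiableOn ℂ h V)
    (h0 : ∀ L, (∀ F, chainBoundary L F = 0) → chainSupport L ⊆ V → chainInt L h = 0) :
    ∃ H : ℂ → ℂ, ∀ z ∈ V, HasDerivAt H (h z) z := by
  rcases V.eq_empty_or_nonempty with rfl | ⟨z₀, hz₀⟩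
  · exact ⟨0, by simp⟩
  choose! P hPV hPF using fun z (hz : z ∈ V) => exists_chain_of_isPreconnected hV hc hz₀ hz
  refine ⟨fun z => chainInt (P z) h, fun z hz => ?_⟩
  obtain ⟨r, hr, hsub⟩ := Metric.isOpen_iff.1 hV z hz
  obtain ⟨g, hg⟩ := (hh.mono hsub).isExactOn_ball
  have hd : HasDerivAt (fun w => chainInt (P z) h + (g w - g z)) (h z) z :=
    ((hg z (Metric.mem_ball_self hr)).sub_const _).const_add _
  refine hd.congr_of_eventuallyEq ?_
  filter_upwards [Metric.ball_mem_nhds z hr] with w hw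
  have hwV := hsub hw
  have hseg : segment ℝ z w ⊆ Metric.ball z r :=
    (convex_ball z r).segment_subset (Metric.mem_ball_self hr) hw
  have h1 := h0 (P z ++ ((z, w) :: (P w).map Prod.swap)) (fun F => ?_) ?_
  · rw [chainInt_append, chainInt_cons, chainInt_swap,
      segInt_eq_sub (hh.continuousOn.mono (hseg.trans hsub)) fun w hw => hg w (hseg hw)] at h1
    linear_combination -h1
  · have h2 := chainBoundary_append [(z, w)] ((P w).map Prod.swap) F
    rw [List.singleton_append] at h2
    rw [chainBoundary_append, h2, chainBoundary_swap, hPF z hz, hPF w hwV]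
    simp [chainBoundary]
  · rw [chainSupport_append, chainSupport_cons, chainSupport_swap]
    exact union_subset (hPV z hz) (union_subset (hseg.trans hsub) (hPV w hwV))

/-- On a component of a bounded open set with connected complement, holomorphic functions have
primitives. -/
theorem hasPrimitives_connectedComponentIn {V : Set ℂ} (hV : IsOpen V)
    (hb : Bornology.IsBounded V) (hT : IsPreconnected Vᶜ) (z₀ : ℂ) :
    HasPrimitives (connectedComponentIn V z₀) := by
  classical
  intro h hh
  set C := connectedComponentIn V z₀
  have hC : IsOpen C := hV.connectedComponentIn
  refine exists_primitive_of_chainInt_eq_zero hC isPreconnected_connectedComponentIn hh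
    fun L hL hLC => ?_
  -- Extension by zero to the other components is holomorphic on V, so connectedness of the
  -- complement of V suffices.
  let h' : ℂ → ℂ := fun z => if z ∈ C then h z else 0
  have hEq : EqOn h h' (chainSupport L) := fun z hz => (if_pos (hLC hz)).symm
  rw [chainInt_congr hEq]
  refine chainInt_eq_zero hL hV hb hT (hLC.trans (connectedComponentIn_subset _ _))
    fun z hz => DifferentiableAt.differentiableWithinAt ?_
  by_cases hzC : z ∈ C
  · refine (hh.differentiableAt (hC.mem_nhds hzC)).congr_of_eventuallyEq ?_
    filter_upwards [hC.mem_nhds hzC] with w hw using if_pos hw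
  · refine (differentiableAt_const (0 : ℂ)).congr_of_eventuallyEq ?_
    filter_upwards [hV.connectedComponentIn.mem_nhds (mem_connectedComponentIn hz)] with w hw
    refine if_neg fun hwC => hzC ?_
    have h3 : connectedComponentIn V z = C :=
      (connectedComponentIn_eq hw).trans (connectedComponentIn_eq hwC).symm
    exact h3 ▸ mem_connectedComponentIn hz

/-- A primitive H of the logarithmic derivative makes `h * exp (-H)` constant, so h has a logarithm,
which can be halved. -/
theorem HasPrimitives.exists_sq_eq {V : Set ℂ} (hP : HasPrimitives V) (hV : IsOpen V)
    (hc : IsPreconnected V) {h : ℂ → ℂ} (hh : DifferentiableOn ℂ h V) (h0 : ∀ z ∈ V, h z ≠ 0) :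
    ∃ s : ℂ → ℂ, DifferentiableOn ℂ s V ∧ ∀ z ∈ V, s z ^ 2 = h z := by
  rcases V.eq_empty_or_nonempty with rfl | ⟨z₀, hz₀⟩
  · exact ⟨0, by simp⟩
  obtain ⟨H, hH⟩ := hP (fun z => deriv h z / h z) ((hh.deriv hV).div hh h0)
  have hHd : DifferentiableOn ℂ H V := fun z hz => (hH z hz).differentiableAt.differentiableWithinAt
  have hk : ∀ z ∈ V, HasDerivAt (fun z => h z * Complex.exp (-H z)) 0 z := by
    intro z hz
    have h1 := (hh.differentiableAt (hV.mem_nhds hz)).hasDerivAt.mul (hH z hz).neg.cexp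
    refine h1.congr_deriv ?_
    have := h0 z hz
    simp only [Pi.neg_apply]
    field_simp
    ring
  have hconst : ∀ z ∈ V, h z * Complex.exp (-H z) = h z₀ * Complex.exp (-H z₀) := fun z hz =>
    hV.is_const_of_deriv_eq_zero hc
      (fun z hz => (hk z hz).differentiableAt.differentiableWithinAt)
      (fun z hz => (hk z hz).deriv) hz hz₀
  set c := h z₀ * Complex.exp (-H z₀) with hcdef
  have hc0 : c ≠ 0 := mul_ne_zero (h0 z₀ hz₀) (Complex.exp_ne_zero _)
  refine ⟨fun z => Complex.exp ((H z + Complex.log c) / 2),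
    ((hHd.add_const _).div_const 2).cexp, fun z hz => ?_⟩
  rw [← Complex.exp_nat_mul]
  have h1 : ((2 : ℕ) : ℂ) * ((H z + Complex.log c) / 2) = H z + Complex.log c := by
    push_cast; ring
  rw [h1, Complex.exp_add, Complex.exp_log hc0, ← hconst z hz, mul_comm, mul_assoc,
    ← Complex.exp_add]
  simp

/-! ### The Riemann mapping theorem. -/

open ComplexConjugate in
/-- The automorphism of the unit disk sending `a` to `0`. -/
noncomputable def diskMob (a z : ℂ) : ℂ := (z - a) / (1 - conj a * z)

-- The squares of the two sides differ by (1 - |a|²)(1 - |z|²).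
open ComplexConjugate in
theorem norm_sub_lt_norm_one_sub {a z : ℂ} (ha : ‖a‖ < 1) (hz : ‖z‖ < 1) :
    ‖z - a‖ < ‖1 - conj a * z‖ := by
  rw [← sq_lt_sq₀ (norm_nonneg _) (norm_nonneg _), Complex.sq_norm, Complex.sq_norm]
  have h1 : ‖a‖ ^ 2 < 1 := by nlinarith [norm_nonneg a]
  have h2 : ‖z‖ ^ 2 < 1 := by nlinarith [norm_nonneg z]
  rw [Complex.sq_norm, Complex.normSq_apply] at h1 h2
  rw [Complex.normSq_apply, Complex.normSq_apply]
  simp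
  nlinarith [mul_pos (sub_pos.2 h1) (sub_pos.2 h2)]

open ComplexConjugate in
theorem one_sub_conj_mul_ne_zero {a z : ℂ} (ha : ‖a‖ < 1) (hz : ‖z‖ < 1) :
    1 - conj a * z ≠ 0 :=
  norm_pos_iff.1 ((norm_nonneg _).trans_lt (norm_sub_lt_norm_one_sub ha hz))

theorem norm_diskMob_lt_one {a z : ℂ} (ha : ‖a‖ < 1) (hz : ‖z‖ < 1) : ‖diskMob a z‖ < 1 := by
  have h := norm_sub_lt_norm_one_sub ha hz
  rw [diskMob, norm_div, div_lt_one ((norm_nonneg _).trans_lt h)]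
  exact h

theorem diskMob_neg_diskMob {a z : ℂ} (ha : ‖a‖ < 1) (hz : ‖z‖ < 1) :
    diskMob (-a) (diskMob a z) = z := by
  have h1 := one_sub_conj_mul_ne_zero ha hz
  have h2 := one_sub_conj_mul_ne_zero ha ha
  unfold diskMob
  rw [map_neg]
  generalize (starRingEnd ℂ) a = b at h1 h2
  have h3 : (z - a) / (1 - b * z) - -a = z * (1 - b * a) / (1 - b * z) := by
    rw [sub_neg_eq_add, div_add' _ _ _ h1]; congr 1; ring
  have h4 : 1 - -b * ((z - a) / (1 - b * z)) = (1 - b * a) / (1 - b * z) := by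
    rw [eq_div_iff h1, sub_mul, mul_assoc, div_mul_cancel₀ _ h1]; ring
  rw [h3, h4, div_div_div_cancel_right₀ h1, mul_div_assoc, div_self h2, mul_one]

theorem injOn_diskMob {a : ℂ} (ha : ‖a‖ < 1) : InjOn (diskMob a) (Metric.ball 0 1) := by
  intro z hz w hw h
  rw [← diskMob_neg_diskMob ha (z := z) (by simpa using hz), h,
    diskMob_neg_diskMob ha (by simpa using hw)]

theorem differentiableOn_diskMob {a : ℂ} (ha : ‖a‖ < 1) :
    DifferentiableOn ℂ (diskMob a) (Metric.ball 0 1) := by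
  unfold diskMob
  refine DifferentiableOn.div (by fun_prop) (by fun_prop) fun z hz => ?_
  exact one_sub_conj_mul_ne_zero ha (by simpa using hz)

/-- The pseudo-hyperbolic distance decreases under squaring. -/
theorem norm_diskMob_sq_lt {s t : ℂ} (hs : ‖s‖ < 1) (ht : ‖t‖ < 1) (hne : t ≠ s) :
    ‖diskMob (s ^ 2) (t ^ 2)‖ < ‖diskMob s t‖ := by
  have h1 := one_sub_conj_mul_ne_zero hs ht
  have hs' : ‖-s‖ < 1 := by rwa [norm_neg]
  have h2 := one_sub_conj_mul_ne_zero hs' ht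
  have h3 := norm_diskMob_lt_one hs' ht
  -- The second factor has modulus less than 1, which gives the strict decrease.
  have h4 : diskMob (s ^ 2) (t ^ 2) = diskMob s t * diskMob (-s) t := by
    unfold diskMob
    rw [div_mul_div_comm]
    congr 1
    · ring
    · simp only [map_pow, map_neg]; ring
  rw [h4, norm_mul]
  refine mul_lt_of_lt_one_right (norm_pos_iff.2 ?_) h3
  exact div_ne_zero (sub_ne_zero.2 hne) h1

/-- Hurwitz's theorem: a nonconstant limit of injective holomorphic functions is injective. -/
theorem injOn_of_tendstoLocallyUniformlyOn {ι : Type*} {p : Filter ι} [p.NeBot]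
    {F : ι → ℂ → ℂ} {g : ℂ → ℂ} {V : Set ℂ} (hV : IsOpen V) (hc : IsPreconnected V)
    (hF : ∀ n, DifferentiableOn ℂ (F n) V) (hi : ∀ n, InjOn (F n) V)
    (hlim : TendstoLocallyUniformlyOn F g p V) {x y : ℂ} (hx : x ∈ V) (hy : y ∈ V)
    (hxy : g x ≠ g y) : InjOn g V := by
  have hg : DifferentiableOn ℂ g V := hlim.differentiableOn (Eventually.of_forall hF) hV
  intro a ha b hb hab
  by_contra hne
  have han : AnalyticAt ℂ (fun z => g z - g a) b :=
    (hg.analyticAt (hV.mem_nhds hb)).sub analyticAt_const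
  rcases han.eventually_eq_zero_or_eventually_ne_zero with h | h
  · have h1 : EqOn g (fun _ => g a) V :=
      (hg.analyticOnNhd hV).eqOn_of_preconnected_of_eventuallyEq analyticOnNhd_const hc hb
        (h.mono fun z hz => sub_eq_zero.1 hz)
    exact hxy ((h1 hx).trans (h1 hy).symm)
  obtain ⟨r', hr', hball⟩ := Metric.eventually_nhds_iff_ball.1
    (((hV.eventually_mem hb).and (eventually_nhdsWithin_iff.1 h)).and
      (isOpen_ne.eventually_mem (Ne.symm hne) : ∀ᶠ z in 𝓝 b, z ≠ a))
  set r := r' / 2 with hr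
  have hr0 : 0 < r := half_pos hr'
  have hcl : Metric.closedBall b r ⊆ Metric.ball b r' :=
    Metric.closedBall_subset_ball (half_lt_self hr')
  have hclV : Metric.closedBall b r ⊆ V := fun z hz => (hball z (hcl hz)).1.1
  have hsne : ∀ z ∈ Metric.sphere b r, g z - g a ≠ 0 := fun z hz =>
    (hball z (hcl (Metric.sphere_subset_closedBall hz))).1.2
      (Metric.ne_of_mem_sphere hz hr0.ne')
  obtain ⟨z₁, hz₁, hmin⟩ := (isCompact_sphere b r).exists_isMinOn
    (NormedSpace.sphere_nonempty.2 hr0.le)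
    ((hg.continuousOn.mono (Metric.sphere_subset_closedBall.trans hclV)).sub
      (continuousOn_const (c := g a))).norm
  set m := ‖g z₁ - g a‖ with hm
  have hm0 : 0 < m := norm_pos_iff.2 (hsne z₁ hz₁)
  have hunif := (tendstoLocallyUniformlyOn_iff_forall_isCompact hV).1 hlim _ hclV
    (isCompact_closedBall b r)
  have hu := Metric.tendstoUniformlyOn_iff.1 hunif (m / 4) (by positivity)
  have hua := Metric.tendsto_nhds.1 (hlim.tendsto_at ha) (m / 4) (by positivity)
  obtain ⟨n, hn1, hn2⟩ := (hu.and hua).exists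
  have hdist : ∀ z ∈ Metric.closedBall b r, ‖(F n z - F n a) - (g z - g a)‖ < m / 2 := by
    intro z hz
    have h1 := hn1 z hz
    rw [dist_eq_norm, norm_sub_rev] at h1
    rw [dist_eq_norm] at hn2
    have : (F n z - F n a) - (g z - g a) = (F n z - g z) - (F n a - g a) := by ring
    rw [this]
    linarith [norm_sub_le (F n z - g z) (F n a - g a)]
  -- The ball about b avoids a, so injectivity makes `F n - F n a` zero-free there. Its modulus
  -- exceeds m/2 on the sphere but is smaller at b, against the maximum principle for the
  -- reciprocal.
  have hk0 : ∀ z ∈ Metric.closedBall b r, F n z - F n a ≠ 0 := fun z hz h =>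
    (hball z (hcl hz)).2 (hi n (hclV hz) ha (sub_eq_zero.1 h))
  have hkd : DiffContOnCl ℂ (fun z => (F n z - F n a)⁻¹) (Metric.ball b r) := by
    refine DifferentiableOn.diffContOnCl ?_
    rw [closure_ball b hr0.ne']
    exact (((hF n).mono hclV).sub_const _).inv hk0
  have hle : ‖(F n b - F n a)⁻¹‖ ≤ (m / 2)⁻¹ := by
    refine Complex.norm_le_of_forall_mem_frontier_norm_le Metric.isBounded_ball hkd
      (fun z hz => ?_) (subset_closure (Metric.mem_ball_self hr0))
    rw [frontier_ball b hr0.ne'] at hz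
    have h1 : m ≤ ‖g z - g a‖ := hmin hz
    have h2 := hdist z (Metric.sphere_subset_closedBall hz)
    rw [norm_inv]
    refine inv_anti₀ (by positivity) ?_
    have h3 := norm_sub_norm_le (g z - g a) (F n z - F n a)
    rw [norm_sub_rev (g z - g a) (F n z - F n a)] at h3
    linarith
  have h1 := hdist b (Metric.mem_closedBall_self hr0.le)
  rw [← hab, sub_self, sub_zero] at h1
  rw [norm_inv] at hle
  have h2 := norm_pos_iff.2 (hk0 b (Metric.mem_closedBall_self hr0.le))
  have h3 := (inv_le_inv₀ h2 (by positivity)).1 hle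
  linarith

/-- Montel's theorem for functions with values in the unit disk. -/
theorem exists_tendstoLocallyUniformlyOn_hyperfilter {F : ℕ → ℂ → ℂ} {V : Set ℂ} (hV : IsOpen V)
    (hF : ∀ n, DifferentiableOn ℂ (F n) V) (hb : ∀ n, MapsTo (F n) V (Metric.ball 0 1)) :
    ∃ g : ℂ → ℂ, TendstoLocallyUniformlyOn F g (hyperfilter ℕ : Filter ℕ) V := by
  -- Along an ultrafilter pointwise limits exist by compactness alone, so no diagonal subsequence is
  -- needed.
  have hex : ∀ z ∈ V, ∃ l, Tendsto (fun n => F n z) (hyperfilter ℕ : Filter ℕ) (𝓝 l) := by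
    intro z hz
    obtain ⟨l, -, hl⟩ := (isCompact_closedBall (0 : ℂ) 1).ultrafilter_le_nhds
      ((hyperfilter ℕ).map fun n => F n z) (le_principal_iff.2
        (Filter.eventually_map.2
          (Eventually.of_forall fun n => Metric.ball_subset_closedBall (hb n hz))))
    exact ⟨l, hl⟩
  choose! g hg using hex
  refine ⟨g, Metric.tendstoLocallyUniformlyOn_iff.2 fun ε hε a ha => ?_⟩
  obtain ⟨R, hR, hsub⟩ := Metric.isOpen_iff.1 hV a ha
  -- Values in the unit disk are less than 2 apart, so the Schwarz lemma gives a Lipschitz bound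
  -- independent of n, which upgrades pointwise to locally uniform convergence.
  have hlip : ∀ n, ∀ y ∈ Metric.ball a R, dist (F n y) (F n a) ≤ 2 / R * dist y a := by
    intro n y hy
    refine Complex.dist_le_div_mul_dist_of_mapsTo_ball ((hF n).mono hsub) (fun w hw => ?_) hy
    have h1 := hb n (hsub hw)
    have h2 := hb n ha
    rw [mem_ball_zero_iff] at h1 h2
    rw [Metric.mem_closedBall, dist_eq_norm]
    linarith [norm_sub_le (F n w) (F n a)]
  set δ := min R (ε / 4 * R / 2) with hδ
  have hδ0 : 0 < δ := lt_min hR (by positivity)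
  have hlip' : ∀ n, ∀ y ∈ Metric.ball a δ, dist (F n y) (F n a) ≤ ε / 4 := by
    intro n y hy
    have hy' := Metric.mem_ball.1 hy
    refine (hlip n y (Metric.ball_subset_ball (min_le_left _ _) hy)).trans ?_
    have h1 : dist y a ≤ ε / 4 * R / 2 := (hy'.trans_le (min_le_right _ _)).le
    calc 2 / R * dist y a ≤ 2 / R * (ε / 4 * R / 2) := by gcongr
      _ = ε / 4 := by field_simp
  refine ⟨Metric.ball a δ, nhdsWithin_le_nhds (Metric.ball_mem_nhds a hδ0), ?_⟩
  filter_upwards [Metric.tendsto_nhds.1 (hg a ha) (ε / 4) (by positivity)] with n hn y hy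
  have hyV : y ∈ V := hsub (Metric.ball_subset_ball (min_le_left _ _) hy)
  have h1 : dist (g y) (g a) ≤ ε / 4 :=
    le_of_tendsto ((hg y hyV).dist (hg a ha)) (Eventually.of_forall fun n => hlip' n y hy)
  have h2 := hlip' n y hy
  have h3 := dist_triangle4 (g y) (g a) (F n a) (F n y)
  rw [dist_comm (g a) (F n a), dist_comm (F n a) (F n y)] at h3
  linarith

/-- The Riemann mapping theorem for bounded domains on which holomorphic functions have
primitives. -/
theorem HasPrimitives.exists_riemann_map {V : Set ℂ} (hP : HasPrimitives V) (hV : IsOpen V)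
    (hc : IsPreconnected V) (hb : Bornology.IsBounded V) (hne : V.Nonempty) :
    ∃ φ : ℂ → ℂ, DifferentiableOn ℂ φ V ∧ InjOn φ V ∧ φ '' V = Metric.ball 0 1 := by
  obtain ⟨z₀, hz₀⟩ := hne
  obtain ⟨z₁, hz₁, hz₁₀⟩ : ∃ z₁ ∈ V, z₁ ≠ z₀ := by
    obtain ⟨w, hw1, hw2⟩ := (((hV.eventually_mem hz₀).filter_mono nhdsWithin_le_nhds).and
      (self_mem_nhdsWithin : ∀ᶠ w in 𝓝[≠] z₀, w ∈ ({z₀}ᶜ : Set ℂ))).exists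
    exact ⟨w, hw1, hw2⟩
  -- The extremal quantity is the modulus at a second point z₁ instead of the derivative at z₀, so
  -- no derivatives of limits enter.
  let 𝓕 : Set (ℂ → ℂ) := {φ | DifferentiableOn ℂ φ V ∧ InjOn φ V ∧
    MapsTo φ V (Metric.ball 0 1) ∧ φ z₀ = 0}
  set A : Set ℝ := (fun φ : ℂ → ℂ => ‖φ z₁‖) '' 𝓕 with hA
  have hAbdd : BddAbove A := by
    refine ⟨1, ?_⟩
    rintro _ ⟨φ, hφ, rfl⟩
    have := hφ.2.2.1 hz₁
    rw [mem_ball_zero_iff] at this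
    exact this.le
  obtain ⟨φ₀, hφ₀⟩ : 𝓕.Nonempty := by
    obtain ⟨R, hR0, hR⟩ := hb.subset_ball_lt 0 z₀
    have hRC : (R : ℂ) ≠ 0 := by exact_mod_cast hR0.ne'
    refine ⟨fun z => (z - z₀) / R, by fun_prop, fun z _ w _ h => ?_, fun z hz => ?_, by simp⟩
    · simpa [hRC] using h
    · have h1 : ‖z - z₀‖ < R := by simpa [dist_eq_norm] using hR hz
      rw [mem_ball_zero_iff, norm_div, Complex.norm_real, Real.norm_eq_abs, abs_of_pos hR0,
        div_lt_one hR0]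
      exact h1
  have hSpos : 0 < sSup A := by
    refine lt_of_lt_of_le (norm_pos_iff.2 fun h => ?_) (le_csSup hAbdd ⟨φ₀, hφ₀, rfl⟩)
    exact hz₁₀ (hφ₀.2.1 hz₁ hz₀ (h.trans hφ₀.2.2.2.symm))
  obtain ⟨u, -, hu, huA⟩ := exists_seq_tendsto_sSup (S := A) ⟨_, φ₀, hφ₀, rfl⟩ hAbdd
  choose F hF hFu using huA
  obtain ⟨g, hg⟩ := exists_tendstoLocallyUniformlyOn_hyperfilter hV (fun n => (hF n).1)
    (fun n => (hF n).2.2.1)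
  have hgd : DifferentiableOn ℂ g V :=
    hg.differentiableOn (Eventually.of_forall fun n => (hF n).1) hV
  have hg0 : g z₀ = 0 := by
    refine tendsto_nhds_unique (hg.tendsto_at hz₀) ?_
    simp_rw [(hF _).2.2.2]
    exact tendsto_const_nhds
  have hg1 : ‖g z₁‖ = sSup A := by
    refine tendsto_nhds_unique (hg.tendsto_at hz₁).norm ?_
    simp only at hFu
    simp_rw [hFu]
    exact hu.mono_left Nat.hyperfilter_le_atTop
  have hgi : InjOn g V := by
    refine injOn_of_tendstoLocallyUniformlyOn hV hc (fun n => (hF n).1) (fun n => (hF n).2.1) hg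
      hz₁ hz₀ fun h => ?_
    rw [hg0] at h
    rw [h, norm_zero] at hg1
    exact hSpos.ne hg1
  have hgle : ∀ z ∈ V, ‖g z‖ ≤ 1 := fun z hz =>
    le_of_tendsto (hg.tendsto_at hz).norm (Eventually.of_forall fun n => by
      have := (hF n).2.2.1 hz
      rw [mem_ball_zero_iff] at this
      exact this.le)
  have hgm : MapsTo g V (Metric.ball 0 1) := by
    intro z hz
    rw [mem_ball_zero_iff]
    refine (hgle z hz).lt_of_ne fun h => ?_
    have h1 : EqOn (norm ∘ g) (Function.const ℂ ‖g z‖) V :=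
      Complex.norm_eqOn_of_isPreconnected_of_isMaxOn hc hV hgd hz fun w hw => by
        simp only [mem_ofPred_eq, Function.comp]; rw [h]; exact hgle w hw
    have h2 : ‖g z₀‖ = ‖g z‖ := h1 hz₀
    rw [hg0, norm_zero, h] at h2
    exact zero_ne_one h2
  refine ⟨g, hgd, hgi, Subset.antisymm hgm.image_subset fun a ha => ?_⟩
  by_contra hna
  have ha' : ‖a‖ < 1 := by simpa using ha
  have hgm' : ∀ z ∈ V, ‖g z‖ < 1 := fun z hz => by simpa using hgm hz
  have hτ0 : ∀ z ∈ V, diskMob a (g z) ≠ 0 := fun z hz =>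
    div_ne_zero (sub_ne_zero.2 fun h => hna ⟨z, hz, h⟩) (one_sub_conj_mul_ne_zero ha' (hgm' z hz))
  have hτd : DifferentiableOn ℂ (fun z => diskMob a (g z)) V :=
    (differentiableOn_diskMob ha').comp hgd hgm
  obtain ⟨s, hsd, hs2⟩ := hP.exists_sq_eq hV hc hτd hτ0
  have hsn : ∀ z ∈ V, ‖s z‖ < 1 := fun z hz => by
    have h1 := norm_diskMob_lt_one ha' (hgm' z hz)
    rw [← hs2 z hz, norm_pow] at h1
    exact (pow_lt_one_iff_of_nonneg (norm_nonneg _) two_ne_zero).1 h1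
  have hsi : InjOn s V := fun z hz w hw h => by
    refine hgi hz hw (injOn_diskMob ha' (hgm hz) (hgm hw) ?_)
    rw [← hs2 z hz, ← hs2 w hw, h]
  have hsm : MapsTo s V (Metric.ball 0 1) := fun z hz => by simpa using hsn z hz
  -- If g omitted a, the square root of `diskMob a ∘ g`, renormalized at z₀, would be a competitor.
  -- Squaring strictly contracts the pseudo-hyperbolic distance, so its value at z₁ would be larger.
  have hψ : (fun z => diskMob (s z₀) (s z)) ∈ 𝓕 := by
    refine ⟨(differentiableOn_diskMob (hsn z₀ hz₀)).comp hsd hsm,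
      (injOn_diskMob (hsn z₀ hz₀)).comp hsi hsm, fun z hz => ?_, by simp [diskMob]⟩
    simpa using norm_diskMob_lt_one (hsn z₀ hz₀) (hsn z hz)
  have h1 := norm_diskMob_sq_lt (hsn z₀ hz₀) (hsn z₁ hz₁) fun h => hz₁₀ (hsi hz₁ hz₀ h)
  have h2 : diskMob a (g z₀) = -a := by simp [hg0, diskMob]
  rw [hs2 z₀ hz₀, hs2 z₁ hz₁, h2, diskMob_neg_diskMob ha' (hgm' z₁ hz₁), hg1] at h1
  exact absurd (le_csSup hAbdd ⟨_, hψ, rfl⟩) (not_le.2 h1)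

/-! ### The domains A_ε. -/

/-- Expanding the squared distance to ±i / sin ε and using sin² + cos² = 1 turns each disk condition
into an inequality linear in `sin ε`, which shows how the domain varies with ε. -/
theorem mem_standardNhd {ε : ℝ} (h0 : 0 < ε) (h1 : ε < Real.pi / 2) {z : ℂ} :
    z ∈ standardNhd ε ↔ ‖z‖ < 1 ∧ 2 * |z.im| < Real.sin ε * (‖z‖ ^ 2 + 1) := by
  have hs : 0 < Real.sin ε := Real.sin_pos_of_pos_of_lt_pi h0 (by linarith [Real.pi_pos])
  have hc : 0 < Real.cos ε := Real.cos_pos_of_mem_Ioo ⟨by linarith, h1⟩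
  have hsc := Real.sin_sq_add_cos_sq ε
  set s := Real.sin ε
  set k := Real.cos ε
  have key : ∀ σ : ℝ, σ ^ 2 = 1 →
      (k / s < ‖z - σ * Complex.I / (s : ℂ)‖ ↔ 2 * (σ * z.im) < s * (‖z‖ ^ 2 + 1)) := by
    intro σ hσ
    rw [← sq_lt_sq₀ (by positivity) (norm_nonneg _), Complex.sq_norm, Complex.sq_norm,
      Complex.normSq_apply, Complex.normSq_apply]
    have h2 : (z - σ * Complex.I / (s : ℂ)).re = z.re := by
      rw [Complex.sub_re, Complex.div_ofReal_re]; simp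
    have h3 : (z - σ * Complex.I / (s : ℂ)).im = z.im - σ / s := by
      rw [Complex.sub_im, Complex.div_ofReal_im]; simp
    rw [h2, h3]
    have h4 : s * (z.re * z.re + (z.im - σ / s) * (z.im - σ / s) - (k / s) ^ 2)
        = s * (z.re * z.re + z.im * z.im + 1) - 2 * (σ * z.im) := by
      field_simp
      linear_combination hσ - hsc
    rw [← sub_pos, ← sub_pos (b := 2 * (σ * z.im)), ← h4]
    exact (mul_pos_iff_of_pos_left hs).symm
  have k1 := key 1 (by norm_num)
  have k2 := key (-1) (by norm_num)
  have e1 : ((1 : ℝ) : ℂ) * Complex.I / (s : ℂ) = Complex.I / (s : ℂ) := by simp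
  have e2 : ((-1 : ℝ) : ℂ) * Complex.I / (s : ℂ) = -Complex.I / (s : ℂ) := by simp
  rw [e1] at k1
  rw [e2] at k2
  simp only [standardNhd, Set.mem_sdiff, mem_union, Metric.mem_closedBall, not_or, not_le,
    mem_ball_zero_iff, dist_eq_norm]
  rw [k1, k2]
  refine and_congr_right fun _ => ?_
  constructor
  · rintro ⟨ha, hb⟩
    rcases abs_cases z.im with ⟨h, -⟩ | ⟨h, -⟩ <;> rw [h] <;> linarith
  · intro h
    have := le_abs_self z.im
    have := neg_abs_le z.im
    constructor <;> linarith

theorem isOpen_standardNhd (ε : ℝ) : IsOpen (standardNhd ε) :=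
  Metric.isOpen_ball.sdiff (Metric.isClosed_closedBall.union Metric.isClosed_closedBall)

theorem standardNhd_subset_unitDisk (ε : ℝ) : standardNhd ε ⊆ unitDisk := sdiff_subset

theorem standardNhd_mono {ε ε' : ℝ} (h0 : 0 < ε) (h : ε ≤ ε') (h1 : ε' < Real.pi / 2) :
    standardNhd ε ⊆ standardNhd ε' := by
  intro z hz
  rw [mem_standardNhd h0 (h.trans_lt h1)] at hz
  rw [mem_standardNhd (h0.trans_le h) h1]
  refine ⟨hz.1, hz.2.trans_le ?_⟩
  have := Real.sin_le_sin_of_le_of_le_pi_div_two (by linarith) h1.le h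
  gcongr

theorem referenceChord_subset_standardNhd {ε : ℝ} (h0 : 0 < ε) (h1 : ε < Real.pi / 2) :
    referenceChord ⊆ standardNhd ε := by
  rintro _ ⟨t, ht, rfl⟩
  have hs : 0 < Real.sin ε := Real.sin_pos_of_pos_of_lt_pi h0 (by linarith [Real.pi_pos])
  rw [mem_standardNhd h0 h1]
  refine ⟨?_, ?_⟩
  · rw [Complex.norm_real, Real.norm_eq_abs, abs_lt]; exact ht
  · simp only [Complex.ofReal_im, abs_zero, mul_zero]; positivity

theorem exists_ball_subset_standardNhd {ε : ℝ} (h0 : 0 < ε) (h1 : ε < Real.pi / 2) {p : ℂ}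
    (hp : p.im = 0) : ∃ r > 0, unitDisk ∩ Metric.ball p r ⊆ standardNhd ε := by
  have hs : 0 < Real.sin ε := Real.sin_pos_of_pos_of_lt_pi h0 (by linarith [Real.pi_pos])
  refine ⟨Real.sin ε / 2, by positivity, ?_⟩
  rintro z ⟨hz, hzp⟩
  rw [mem_standardNhd h0 h1]
  refine ⟨by simpa using hz, ?_⟩
  rw [Metric.mem_ball, dist_eq_norm] at hzp
  have h2 := Complex.abs_im_le_norm (z - p)
  rw [Complex.sub_im, hp, sub_zero] at h2
  nlinarith [sq_nonneg ‖z‖]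

/-- For ε = π/2 the defining inequality follows from (1 - ‖z‖)² > 0; by continuity it survives for
slightly smaller ε. So the A_ε exhaust the disk. -/
theorem exists_mem_standardNhd {z : ℂ} (hz : ‖z‖ < 1) :
    ∃ ε, 0 < ε ∧ ε < Real.pi / 2 ∧ z ∈ standardNhd ε := by
  have h1 : 2 * |z.im| < Real.sin (Real.pi / 2) * (‖z‖ ^ 2 + 1) := by
    rw [Real.sin_pi_div_two]
    have := Complex.abs_im_le_norm z
    nlinarith [sq_pos_of_pos (sub_pos.2 hz)]
  have hc : ContinuousAt (fun ε => Real.sin ε * (‖z‖ ^ 2 + 1)) (Real.pi / 2) := by fun_prop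
  have h2 : ∀ᶠ ε in 𝓝[<] (Real.pi / 2), 2 * |z.im| < Real.sin ε * (‖z‖ ^ 2 + 1) :=
    (hc.eventually (lt_mem_nhds h1)).filter_mono nhdsWithin_le_nhds
  obtain ⟨ε, hε, hε'⟩ := (h2.and (Ioo_mem_nhdsLT Real.pi_div_two_pos)).exists
  exact ⟨ε, hε'.1, hε'.2, (mem_standardNhd hε'.1 hε'.2).2 ⟨hz, hε⟩⟩

/-! ### Simple chords and the Hausdorff distance. -/

namespace SimpleChord

variable (γ : SimpleChord)

theorem isCompact : IsCompact (γ.1 : Set ℂ) := γ.1.isCompact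

theorem neg_one_mem : (-1 : ℂ) ∈ (γ.1 : Set ℂ) := by
  obtain ⟨c, -, -, h0, -, -, hK⟩ := γ.2
  rw [hK, ← h0]
  exact mem_image_of_mem c ⟨le_rfl, zero_le_one⟩

theorem one_mem : (1 : ℂ) ∈ (γ.1 : Set ℂ) := by
  obtain ⟨c, -, -, -, h1, -, hK⟩ := γ.2
  rw [hK]
  exact ⟨1, ⟨zero_le_one, le_rfl⟩, h1⟩

theorem isPreconnected : IsPreconnected (γ.1 : Set ℂ) := by
  obtain ⟨c, hc, -, -, -, -, hK⟩ := γ.2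
  rw [hK]
  exact isPreconnected_Icc.image c hc

theorem mem_cases {z : ℂ} (hz : z ∈ (γ.1 : Set ℂ)) :
    z = -1 ∨ z = 1 ∨ z ∈ γ.openPart := by
  by_cases h1 : z = -1
  · exact Or.inl h1
  · by_cases h2 : z = 1
    · exact Or.inr (Or.inl h2)
    · exact Or.inr (Or.inr ⟨hz, by simp [h1, h2]⟩)

end SimpleChord

theorem image_Icc_diff_eq_image_Ioo {c : ℝ → ℂ} (hi : InjOn c (Icc 0 1)) (h0 : c 0 = -1)
    (h1 : c 1 = 1) : (c '' Icc 0 1) \ {-1, 1} = c '' Ioo 0 1 := by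
  ext z
  constructor
  · rintro ⟨⟨t, ht, rfl⟩, hne⟩
    refine ⟨t, ⟨ht.1.lt_of_ne ?_, ht.2.lt_of_ne ?_⟩, rfl⟩
    · rintro rfl; exact hne (by simp [h0])
    · rintro rfl; exact hne (by simp [h1])
  · rintro ⟨t, ht, rfl⟩
    refine ⟨mem_image_of_mem c (Ioo_subset_Icc_self ht), ?_⟩
    rintro (h | h)
    · exact ht.1.ne' (hi (Ioo_subset_Icc_self ht) ⟨le_rfl, zero_le_one⟩ (h.trans h0.symm))
    · exact ht.2.ne (hi (Ioo_subset_Icc_self ht) ⟨zero_le_one, le_rfl⟩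
        ((mem_singleton_iff.1 h).trans h1.symm))

namespace SimpleChord

variable (γ : SimpleChord)

theorem openPart_subset_unitDisk : γ.openPart ⊆ unitDisk := by
  obtain ⟨c, -, hi, h0, h1, hD, hK⟩ := γ.2
  rw [openPart, hK, image_Icc_diff_eq_image_Ioo hi h0 h1]
  rintro _ ⟨t, ht, rfl⟩
  exact hD t ht

theorem isPreconnected_openPart : IsPreconnected γ.openPart := by
  obtain ⟨c, hc, hi, h0, h1, -, hK⟩ := γ.2
  rw [openPart, hK, image_Icc_diff_eq_image_Ioo hi h0 h1]
  exact isPreconnected_Ioo.image c (hc.mono Ioo_subset_Icc_self)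

theorem openPart_inter_ball_nonempty {p : ℂ} (hp : p = -1 ∨ p = 1) {r : ℝ} (hr : 0 < r) :
    (γ.openPart ∩ Metric.ball p r).Nonempty := by
  obtain ⟨c, hc, hi, h0, h1, -, hK⟩ := γ.2
  rw [openPart, hK, image_Icc_diff_eq_image_Ioo hi h0 h1]
  have key : ∀ u ∈ Icc (0 : ℝ) 1, c u = p → (c '' Ioo 0 1 ∩ Metric.ball p r).Nonempty := by
    intro u hu hup
    have hcu : Tendsto c (𝓝[Ioo 0 1] u) (𝓝 p) :=
      hup ▸ (hc u hu).mono_left (nhdsWithin_mono _ Ioo_subset_Icc_self)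
    have : (𝓝[Ioo (0 : ℝ) 1] u).NeBot := by
      rw [← mem_closure_iff_nhdsWithin_neBot, closure_Ioo zero_ne_one]; exact hu
    obtain ⟨t, ht1, ht2⟩ := ((hcu.eventually (Metric.ball_mem_nhds p hr)).and
      self_mem_nhdsWithin).exists
    exact ⟨c t, mem_image_of_mem c ht2, ht1⟩
  rcases hp with rfl | rfl
  · exact key 0 ⟨le_rfl, zero_le_one⟩ h0
  · exact key 1 ⟨zero_le_one, le_rfl⟩ h1

end SimpleChord

/-- A connected set joining the endpoints of an arc close to the arc passes near each of its
points. -/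
theorem exists_thickening_meets_ball {c : ℝ → ℂ} (hc : ContinuousOn c (Icc 0 1))
    (hi : InjOn c (Icc 0 1)) {t : ℝ} (ht : t ∈ Icc (0 : ℝ) 1) {r : ℝ} (hr : 0 < r) :
    ∃ δ > 0, ∀ K : Set ℂ, IsPreconnected K → c 0 ∈ K → c 1 ∈ K →
      K ⊆ Metric.thickening δ (c '' Icc 0 1) → ∃ z ∈ K, dist z (c t) < r := by
  -- Without a ball about c t the two subarcs are disjoint compact sets with disjoint thickenings. A
  -- connected K avoiding the larger ball would be split between them; the radius r / 2 leaves room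
  -- for the distance from K to the arc.
  set A := c '' Icc 0 t \ Metric.ball (c t) (r / 2) with hA
  set B := c '' Icc t 1 \ Metric.ball (c t) (r / 2) with hB
  have hsub0 : Icc 0 t ⊆ Icc (0 : ℝ) 1 := Icc_subset_Icc_right ht.2
  have hsub1 : Icc t 1 ⊆ Icc (0 : ℝ) 1 := Icc_subset_Icc_left ht.1
  have hAc : IsCompact A := (isCompact_Icc.image_of_continuousOn (hc.mono hsub0)).diff
    Metric.isOpen_ball
  have hBc : IsCompact B := (isCompact_Icc.image_of_continuousOn (hc.mono hsub1)).diff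
    Metric.isOpen_ball
  have hdisj : Disjoint A B := by
    rw [Set.disjoint_left]
    rintro _ ⟨⟨u, hu, rfl⟩, hu2⟩ ⟨⟨v, hv, huv⟩, -⟩
    have h1 : v = u := hi (hsub1 hv) (hsub0 hu) huv
    have h2 : u = t := le_antisymm hu.2 (h1 ▸ hv.1)
    exact hu2 (h2 ▸ Metric.mem_ball_self (half_pos hr))
  obtain ⟨δ, hδ, hth⟩ := hdisj.exists_thickenings hAc hBc.isClosed
  refine ⟨min δ (r / 2), lt_min hδ (half_pos hr), fun K hK h0 h1 hsub => ?_⟩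
  by_contra! hfar
  have hcov : K ⊆ Metric.thickening δ A ∪ Metric.thickening δ B := by
    intro z hz
    obtain ⟨y, ⟨u, hu, rfl⟩, hy⟩ := Metric.mem_thickening_iff.1 (hsub hz)
    have hy1 : c u ∉ Metric.ball (c t) (r / 2) := by
      intro h
      have h2 := hfar z hz
      have h3 := dist_triangle z (c u) (c t)
      have h4 := Metric.mem_ball.1 h
      have h5 := hy.trans_le (min_le_right _ _)
      linarith
    rcases le_total u t with hut | hut
    · exact Or.inl (Metric.mem_thickening_iff.2
        ⟨c u, ⟨mem_image_of_mem c ⟨hu.1, hut⟩, hy1⟩, hy.trans_le (min_le_left _ _)⟩)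
    · exact Or.inr (Metric.mem_thickening_iff.2
        ⟨c u, ⟨mem_image_of_mem c ⟨hut, hu.2⟩, hy1⟩, hy.trans_le (min_le_left _ _)⟩)
  have hout : ∀ z ∈ K, z ∉ Metric.ball (c t) (r / 2) := fun z hz h => by
    have := hfar z hz
    have := Metric.mem_ball.1 h
    linarith
  have hA0 : c 0 ∈ Metric.thickening δ A := Metric.self_subset_thickening hδ _
    ⟨mem_image_of_mem c ⟨le_rfl, ht.1⟩, hout _ h0⟩
  have hB1 : c 1 ∈ Metric.thickening δ B := Metric.self_subset_thickening hδ _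
    ⟨mem_image_of_mem c ⟨ht.2, le_rfl⟩, hout _ h1⟩
  have := hK.subset_left_of_subset_union Metric.isOpen_thickening Metric.isOpen_thickening hth
    hcov ⟨c 0, h0, hA0⟩
  exact Set.disjoint_left.1 hth (this h1) hB1

/-- Simple chords in a thin neighborhood of a simple chord are close to it in the Hausdorff
metric. -/
theorem SimpleChord.exists_dist_lt_of_subset_thickening (γ : SimpleChord) {δ : ℝ} (hδ : 0 < δ) :
    ∃ δ' > 0, ∀ η : SimpleChord, (η.1 : Set ℂ) ⊆ Metric.thickening δ' (γ.1 : Set ℂ) →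
      dist η γ < δ := by
  -- This is the nontrivial half of the Hausdorff distance, made uniform over γ by compactness.
  have key : ∃ δ' > 0, ∀ η : SimpleChord, (η.1 : Set ℂ) ⊆ Metric.thickening δ' (γ.1 : Set ℂ) →
      ∀ x ∈ (γ.1 : Set ℂ), ∃ z ∈ (η.1 : Set ℂ), dist x z ≤ δ / 2 := by
    refine γ.isCompact.induction_on (p := fun s => ∃ δ' > 0, ∀ η : SimpleChord,
      (η.1 : Set ℂ) ⊆ Metric.thickening δ' (γ.1 : Set ℂ) →
      ∀ x ∈ s, ∃ z ∈ (η.1 : Set ℂ), dist x z ≤ δ / 2) ?_ ?_ ?_ ?_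
    · exact ⟨1, one_pos, by simp⟩
    · rintro s t hst ⟨δ', h0, h⟩
      exact ⟨δ', h0, fun η hη x hx => h η hη x (hst hx)⟩
    · rintro s t ⟨δ1, h1, hs⟩ ⟨δ2, h2, ht⟩
      refine ⟨min δ1 δ2, lt_min h1 h2, fun η hη x hx => ?_⟩
      rcases hx with hx | hx
      · exact hs η (hη.trans (Metric.thickening_mono (min_le_left _ _) _)) x hx
      · exact ht η (hη.trans (Metric.thickening_mono (min_le_right _ _) _)) x hx
    · intro x hx
      obtain ⟨c, hc, hi, h0, h1, -, hK⟩ := γ.2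
      rw [hK] at hx
      obtain ⟨t, ht, rfl⟩ := hx
      obtain ⟨δ', hδ', h⟩ := exists_thickening_meets_ball hc hi ht (r := δ / 4) (by positivity)
      refine ⟨Metric.ball (c t) (δ / 4),
        mem_nhdsWithin_of_mem_nhds (Metric.ball_mem_nhds _ (by positivity)), δ', hδ',
        fun η hη x hx => ?_⟩
      obtain ⟨z, hz, hzt⟩ := h η.1 η.isPreconnected (h0 ▸ η.neg_one_mem) (h1 ▸ η.one_mem)
        (hK ▸ hη)
      refine ⟨z, hz, ?_⟩
      have := Metric.mem_ball.1 hx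
      have := dist_triangle_right x z (c t)
      linarith
  obtain ⟨δ', hδ', h⟩ := key
  refine ⟨min δ' (δ / 2), lt_min hδ' (by positivity), fun η hη => ?_⟩
  refine lt_of_le_of_lt ?_ (half_lt_self hδ)
  change Metric.hausdorffDist (η.1 : Set ℂ) (γ.1 : Set ℂ) ≤ δ / 2
  refine Metric.hausdorffDist_le_of_mem_dist (by positivity) (fun x hx => ?_) fun x hx => ?_
  · obtain ⟨y, hy, hxy⟩ := Metric.mem_thickening_iff.1 (hη hx)
    exact ⟨y, hy, (hxy.trans_le (min_le_right _ _)).le⟩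
  · exact h η (hη.trans (Metric.thickening_mono (min_le_left _ _) _)) x hx

theorem SimpleChord.subset_thickening_of_dist_lt {η γ : SimpleChord} {δ : ℝ} (h : dist η γ < δ) :
    (η.1 : Set ℂ) ⊆ Metric.thickening δ (γ.1 : Set ℂ) := by
  intro x hx
  have h' : Metric.hausdorffDist (η.1 : Set ℂ) (γ.1 : Set ℂ) < δ := h
  obtain ⟨y, hy, hxy⟩ := Metric.exists_dist_lt_of_hausdorffDist_lt hx h'
    (Metric.hausdorffEDist_ne_top_of_nonempty_of_bounded η.1.nonempty γ.1.nonempty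
      η.isCompact.isBounded γ.isCompact.isBounded)
  exact Metric.mem_thickening_iff.2 ⟨y, hy, hxy⟩

/-! ### Thin domains around a chord. -/

/-- The component of `10` in the set of points at distance greater than `ρ` from `K`. -/
def farComponent (K : Set ℂ) (ρ : ℝ) : Set ℂ :=
  connectedComponentIn {z | ρ < Metric.infDist z K} 10

theorem isOpen_lt_infDist (K : Set ℂ) (ρ : ℝ) : IsOpen {z | ρ < Metric.infDist z K} :=
  isOpen_lt continuous_const (Metric.continuous_infDist_pt K)

theorem farComponent_anti (K : Set ℂ) {ρ ρ' : ℝ} (h : ρ ≤ ρ') :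
    farComponent K ρ' ⊆ farComponent K ρ :=
  connectedComponentIn_mono _ fun _ hz => lt_of_le_of_lt h hz

theorem closure_farComponent_subset (K : Set ℂ) (ρ : ℝ) :
    closure (farComponent K ρ) ⊆ {z | ρ ≤ Metric.infDist z K} :=
  closure_minimal
    ((connectedComponentIn_subset _ _).trans (ofPred_subset_ofPred.2 fun _ h => le_of_lt h))
    (isClosed_le continuous_const (Metric.continuous_infDist_pt K))

/-- A path from 10 to z in the complement of the arc keeps a positive distance from it, so for some
ρ the component contains a neighborhood of z. Compactness gives one ρ for points of norm at most 5;
the others are joined to 10 outside that ball, at distance greater than 1 from the arc. -/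
theorem exists_far_subset_farComponent {c : ℝ → ℂ} (hc : ContinuousOn c (Icc 0 1))
    (hi : InjOn c (Icc 0 1)) (hb : c '' Icc 0 1 ⊆ Metric.closedBall 0 1) {δ : ℝ} (hδ : 0 < δ) :
    ∃ ρ > 0, ∀ z, δ ≤ Metric.infDist z (c '' Icc 0 1) → z ∈ farComponent (c '' Icc 0 1) ρ := by
  set γ := c '' Icc 0 1 with hγ
  have hγc : IsCompact γ := isCompact_Icc.image_of_continuousOn hc
  have hγne : γ.Nonempty := ⟨c 0, mem_image_of_mem c ⟨le_rfl, zero_le_one⟩⟩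
  have h10 : ‖(10 : ℂ)‖ = 10 := by simp
  have hfar : ∀ z : ℂ, 5 < ‖z‖ → 1 < Metric.infDist z γ := by
    intro z hz
    refine lt_of_lt_of_le (by norm_num : (1 : ℝ) < 4) ((Metric.le_infDist hγne).2 fun y hy => ?_)
    have h1 : ‖y‖ ≤ 1 := by simpa using hb hy
    rw [dist_eq_norm]
    linarith [norm_sub_norm_le z y]
  have hout : ∀ z : ℂ, 5 < ‖z‖ → z ∈ farComponent γ 1 := by
    intro z hz
    refine (isPreconnected_compl_closedBall (R := 5) (by norm_num)).subset_connectedComponentIn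
      (by simp; norm_num) (fun y hy => hfar y (by simpa using hy)) (by simpa using hz)
  have hE : IsCompact ({z | δ ≤ Metric.infDist z γ} ∩ Metric.closedBall (0 : ℂ) 5) :=
    (isCompact_closedBall (0 : ℂ) 5).inter_left
      (isClosed_le continuous_const (Metric.continuous_infDist_pt γ))
  have hopen : IsOpen γᶜ := hγc.isClosed.isOpen_compl
  have h10γ : (10 : ℂ) ∈ γᶜ := fun h => by
    have : ‖(10 : ℂ)‖ ≤ 1 := by simpa using hb h
    linarith
  have hpath : IsPathConnected γᶜ := hopen.isConnected_iff_isPathConnected.1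
    ⟨⟨10, h10γ⟩, isPreconnected_compl_arc hc hi⟩
  obtain ⟨ρ, hρ, hsub⟩ : ∃ ρ > 0,
      ({z | δ ≤ Metric.infDist z γ} ∩ Metric.closedBall (0 : ℂ) 5) ⊆ farComponent γ ρ := by
    refine hE.induction_on (p := fun s => ∃ ρ > 0, s ⊆ farComponent γ ρ) ⟨1, one_pos, by simp⟩
      ?_ ?_ ?_
    · rintro s t hst ⟨ρ, h0, h⟩
      exact ⟨ρ, h0, hst.trans h⟩
    · rintro s t ⟨ρ1, h1, hs⟩ ⟨ρ2, h2, ht⟩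
      exact ⟨min ρ1 ρ2, lt_min h1 h2, union_subset
        (hs.trans (farComponent_anti γ (min_le_left _ _)))
        (ht.trans (farComponent_anti γ (min_le_right _ _)))⟩
    · intro z hz
      have hzγ : z ∈ γᶜ := fun h => by
        have := hz.1
        rw [mem_ofPred_eq, Metric.infDist_zero_of_mem h] at this
        linarith
      obtain ⟨P, hP⟩ := hpath.joinedIn 10 h10γ z hzγ
      have hRc : IsCompact (range P) := isCompact_range P.continuous
      obtain ⟨y, hy, hmin⟩ := hRc.exists_isMinOn (range_nonempty P)
        (Metric.continuous_infDist_pt γ).continuousOn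
      have hpos : 0 < Metric.infDist y γ := by
        obtain ⟨t, rfl⟩ := hy
        exact (hγc.isClosed.notMem_iff_infDist_pos hγne).1 (hP t)
      have hsub : range P ⊆ {z | Metric.infDist y γ / 2 < Metric.infDist z γ} := fun x hx =>
        lt_of_lt_of_le (half_lt_self hpos) (hmin hx)
      refine ⟨farComponent γ (Metric.infDist y γ / 2), mem_nhdsWithin_of_mem_nhds
        ((isOpen_lt_infDist γ _).connectedComponentIn.mem_nhds ?_), _, half_pos hpos, Subset.rfl⟩
      exact (isPreconnected_range P.continuous).subset_connectedComponentIn ⟨0, P.source⟩ hsub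
        ⟨1, P.target⟩
  refine ⟨min ρ 1, lt_min hρ one_pos, fun z hz => ?_⟩
  rcases le_or_gt ‖z‖ 5 with h | h
  · exact farComponent_anti γ (min_le_left _ _) (hsub ⟨hz, by simpa using h⟩)
  · exact farComponent_anti γ (min_le_right _ _) (hout z h)

/-- A simple chord has arbitrarily thin neighborhoods in the disk that agree with the disk near
its endpoints and on which holomorphic functions have primitives. -/
theorem SimpleChord.exists_thin_domain (γ : SimpleChord) {δ : ℝ} (hδ : 0 < δ) :
    ∃ V : Set ℂ, IsOpen V ∧ IsPreconnected V ∧ V ⊆ unitDisk ∧ HasPrimitives V ∧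
      γ.openPart ⊆ V ∧ V ⊆ Metric.thickening δ (γ.1 : Set ℂ) ∧ AgreesWithDiskNear V (-1) ∧
      AgreesWithDiskNear V 1 := by
  have hb : (γ.1 : Set ℂ) ⊆ Metric.closedBall 0 1 := by
    intro z hz
    rcases γ.mem_cases hz with rfl | rfl | h
    · simp
    · simp
    · exact Metric.ball_subset_closedBall (γ.openPart_subset_unitDisk h)
  obtain ⟨ρ, hρ, hfar⟩ : ∃ ρ > 0, ∀ z, δ ≤ Metric.infDist z (γ.1 : Set ℂ) →
      z ∈ farComponent (γ.1 : Set ℂ) ρ := by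
    obtain ⟨c, hc, hi, -, -, -, hK⟩ := γ.2
    rw [hK] at hb ⊢
    exact exists_far_subset_farComponent hc hi hb hδ
  set K : Set ℂ := (γ.1 : Set ℂ) with hKdef
  set X := farComponent K ρ with hX
  -- X contains every point at distance at least δ from K, so V₁ is thin; the closure of X stays at
  -- distance at least ρ, so V₁ contains the disk points closer than ρ. The complement of V₁ is
  -- connected, being a union of two connected sets through 10.
  set V₁ : Set ℂ := unitDisk \ closure X with hV₁
  have hV₁o : IsOpen V₁ := Metric.isOpen_ball.sdiff isClosed_closure
  have h10 : (10 : ℂ) ∈ {z | ρ < Metric.infDist z K} := by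
    have hne : (farComponent K ρ).Nonempty := by
      have hK0 : K.Nonempty := ⟨_, γ.neg_one_mem⟩
      refine ⟨((2 + δ : ℝ) : ℂ), hfar _ ((Metric.le_infDist hK0).2 fun y hy => ?_)⟩
      have h1 : ‖y‖ ≤ 1 := by simpa using hb hy
      have h2 := norm_sub_norm_le ((2 + δ : ℝ) : ℂ) y
      rw [Complex.norm_real, Real.norm_eq_abs, abs_of_pos (by positivity)] at h2
      rw [dist_eq_norm]
      linarith
    exact connectedComponentIn_nonempty_iff.1 hne
  have h10X : (10 : ℂ) ∈ closure X := subset_closure (mem_connectedComponentIn h10)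
  have hT : IsPreconnected V₁ᶜ := by
    have h1 : V₁ᶜ = unitDiskᶜ ∪ closure X := by
      ext z
      simp only [hV₁, Set.mem_compl_iff, Set.mem_sdiff, Set.mem_union]
      tauto
    rw [h1]
    refine isPreconnected_compl_unitDisk.union 10 ?_ h10X
      isPreconnected_connectedComponentIn.closure
    simp
  have hnear : ∀ z ∈ unitDisk, Metric.infDist z K < ρ → z ∈ V₁ := fun z hz h =>
    ⟨hz, fun hcl => absurd (closure_farComponent_subset K ρ hcl) (not_le.2 h)⟩
  have hγV₁ : γ.openPart ⊆ V₁ := fun z hz => hnear z (γ.openPart_subset_unitDisk hz) (by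
    rw [Metric.infDist_zero_of_mem hz.1]; exact hρ)
  obtain ⟨z₀, hz₀, -⟩ := γ.openPart_inter_ball_nonempty (Or.inl rfl) one_pos
  set V := connectedComponentIn V₁ z₀ with hV
  have hVsub : V ⊆ V₁ := connectedComponentIn_subset _ _
  have hγV : γ.openPart ⊆ V :=
    γ.isPreconnected_openPart.subset_connectedComponentIn hz₀ hγV₁
  have hagree : ∀ p, p = -1 ∨ p = 1 → AgreesWithDiskNear V p := by
    intro p hp
    have hpK : p ∈ K := by
      rcases hp with rfl | rfl
      · exact γ.neg_one_mem
      · exact γ.one_mem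
    refine ⟨ρ, hρ, Subset.antisymm (fun z hz => ⟨(hVsub hz.1).1, hz.2⟩) fun z hz => ⟨?_, hz.2⟩⟩
    obtain ⟨w, hw, hwp⟩ := γ.openPart_inter_ball_nonempty hp hρ
    have h1 : unitDisk ∩ Metric.ball p ρ ⊆ V₁ := fun y hy => hnear y hy.1
      ((Metric.infDist_le_dist_of_mem hpK).trans_lt hy.2)
    have h2 : IsPreconnected (unitDisk ∩ Metric.ball p ρ) :=
      ((convex_ball (0 : ℂ) 1).inter (convex_ball p ρ)).isPreconnected
    have h3 := h2.subset_connectedComponentIn ⟨γ.openPart_subset_unitDisk hw, hwp⟩ h1 hz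
    rwa [← connectedComponentIn_eq (hγV hw)] at h3
  refine ⟨V, hV₁o.connectedComponentIn, isPreconnected_connectedComponentIn,
    fun z hz => (hVsub hz).1, hasPrimitives_connectedComponentIn hV₁o
      (Metric.isBounded_ball.subset sdiff_subset) hT z₀, hγV, fun z hz => ?_,
    hagree _ (Or.inl rfl), hagree _ (Or.inr rfl)⟩
  rw [Metric.mem_thickening_iff_infDist_lt ⟨_, γ.neg_one_mem⟩]
  by_contra! h
  exact (hVsub hz).2 (subset_closure (hfar z h))

/-! ### Boundary behavior and normalization of conformal maps. -/

theorem AgreesWithDiskNear.exists_subset {V : Set ℂ} {p : ℂ} (h : AgreesWithDiskNear V p) :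
    ∃ r > 0, unitDisk ∩ Metric.ball p r ⊆ V := by
  obtain ⟨r, hr, h⟩ := h
  exact ⟨r, hr, fun z hz => (h.symm.subset hz).1⟩

theorem agreesWithDiskNear_of_subset {V : Set ℂ} {p : ℂ} (hV : V ⊆ unitDisk) {r : ℝ} (hr : 0 < r)
    (h : unitDisk ∩ Metric.ball p r ⊆ V) : AgreesWithDiskNear V p :=
  ⟨r, hr, Subset.antisymm (inter_subset_inter_left _ hV) fun _ hz => ⟨h hz, hz.2⟩⟩

theorem unitDisk_inter_ball_nonempty {p : ℂ} (hp : ‖p‖ = 1) {r : ℝ} (hr : 0 < r) :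
    (unitDisk ∩ Metric.ball p r).Nonempty := by
  have : p ∈ closure unitDisk := by
    rw [closure_ball _ one_ne_zero]; simp [hp]
  obtain ⟨z, hz, hd⟩ := Metric.mem_closure_iff.1 this r hr
  exact ⟨z, hz, by rwa [Metric.mem_ball, dist_comm]⟩

theorem nhdsWithin_unitDisk_neBot {p : ℂ} (hp : ‖p‖ = 1) : (𝓝[unitDisk] p).NeBot := by
  rw [← mem_closure_iff_nhdsWithin_neBot, closure_ball _ one_ne_zero]; simp [hp]

/-- A conformal map into the disk, whose image contains the part of the disk in a closed set that
contains all its values near the boundary point `p`, extends continuously to `p`, and its image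
covers a neighborhood of the boundary value. -/
theorem exists_boundary_value_of_injOn {f : ℂ → ℂ} {A C : Set ℂ} {p : ℂ} (hA : IsOpen A)
    (hAD : A ⊆ unitDisk) (hAp : AgreesWithDiskNear A p) (hp : ‖p‖ = 1)
    (hd : DifferentiableOn ℂ f A) (hi : InjOn f A) (hfD : f '' A ⊆ unitDisk) (hC : IsClosed C)
    (hCA : unitDisk ∩ C ⊆ f '' A) (hfC : ∀ᶠ z in 𝓝[unitDisk] p, f z ∈ C) :
    ∃ a : ℂ, ‖a‖ = 1 ∧ Tendsto f (𝓝[unitDisk] p) (𝓝 a) ∧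
      ∀ r' > 0, ∃ s > 0, unitDisk ∩ Metric.ball a s ⊆ f '' (unitDisk ∩ Metric.ball p r') := by
  obtain ⟨r₁, hr₁, h₁⟩ := hAp.exists_subset
  obtain ⟨r₂, hr₂, h₂⟩ := Metric.mem_nhdsWithin_iff.1 hfC
  have hr : 0 < min r₁ r₂ := lt_min hr₁ hr₂
  have hsub : unitDisk ∩ Metric.ball p (min r₁ r₂) ⊆ A := fun z hz =>
    h₁ ⟨hz.1, Metric.ball_subset_ball (min_le_left _ _) hz.2⟩
  refine exists_boundary_value hp hr (hd.mono hsub)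
    (fun z hz => by simpa using hfD (mem_image_of_mem f (hsub hz))) ?_
  intro ζ hζ hζ1
  have hnear : ∀ᶠ z in 𝓝[unitDisk] ζ, z ∈ unitDisk ∩ Metric.ball p (min r₁ r₂) :=
    inter_mem self_mem_nhdsWithin (mem_nhdsWithin_of_mem_nhds (Metric.isOpen_ball.mem_nhds hζ))
  have hle : 𝓝[unitDisk] ζ ≤ 𝓝[A] ζ :=
    le_inf nhdsWithin_le_nhds (le_principal_iff.2 (hnear.mono hsub))
  rw [tendsto_order]
  constructor
  · intro M hM
    -- Near p all values lie in C, and the part of C in the closed ball of radius M is a compact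
    -- subset of the image. Properness keeps values out of it, forcing the modulus above M.
    have hK := eventually_notMem_of_isCompact hA hd hi
      ((isCompact_closedBall (0 : ℂ) M).inter_right hC)
      (fun z hz => hCA ⟨Metric.closedBall_subset_ball hM hz.1, hz.2⟩)
      (show ζ ∉ A from fun h => (Metric.mem_ball.1 (hAD h)).ne (by simp [hζ1]))
    filter_upwards [hle hK, hnear] with z hz hzn
    by_contra hcon
    exact hz ⟨by simpa using not_lt.1 hcon,
      h₂ ⟨Metric.ball_subset_ball (min_le_right _ _) hzn.2, hzn.1⟩⟩
  · intro M hM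
    filter_upwards [hnear] with z hz
    exact lt_trans (by simpa using hfD (mem_image_of_mem f (hsub hz))) hM

/-- The disk has an automorphism taking two given boundary points `a`, `b` to `-1`, `1`. -/
theorem exists_disk_automorphism {a b : ℂ} (ha : ‖a‖ = 1) (hb : ‖b‖ = 1) (hab : a ≠ b) :
    ∃ M : ℂ → ℂ, DifferentiableOn ℂ M unitDisk ∧ InjOn M unitDisk ∧ M '' unitDisk = unitDisk ∧
      ContinuousAt M a ∧ ContinuousAt M b ∧ M a = -1 ∧ M b = 1 := by
  have hba : b - a ≠ 0 := sub_ne_zero.2 hab.symm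
  -- The formula for M below sends b to 1 for every τ; this τ is the one for which a goes to -1. It
  -- is purely imaginary because a and b are unimodular, which makes M preserve the disk.
  set τ : ℂ := (b + a) / (b - a) with hτ
  have hb0 : b ≠ 0 := norm_pos_iff.1 (by rw [hb]; exact one_pos)
  have haa : a.re * a.re + a.im * a.im = 1 := by
    rw [← Complex.normSq_apply, Complex.normSq_eq_norm_sq, ha]; norm_num
  have hbb : b.re * b.re + b.im * b.im = 1 := by
    rw [← Complex.normSq_apply, Complex.normSq_eq_norm_sq, hb]; norm_num
  have hre : τ.re = 0 := by
    rw [hτ, Complex.div_re, ← add_div]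
    simp only [Complex.add_re, Complex.sub_re, Complex.add_im, Complex.sub_im]
    rw [div_eq_zero_iff]; left; linear_combination hbb - haa
  have hτa : τ * (b - a) = b + a := by rw [hτ, div_mul_cancel₀ _ hba]
  have key : ∀ z : ℂ, ‖τ * z + (2 - τ) * b‖ ^ 2 - ‖(2 + τ) * z - τ * b‖ ^ 2 =
      4 * (1 - ‖z‖ ^ 2) := by
    intro z
    simp only [← Complex.normSq_eq_norm_sq, Complex.normSq_apply, Complex.add_re, Complex.sub_re,
      Complex.mul_re, Complex.mul_im, Complex.add_im, Complex.sub_im, hre, Complex.re_ofNat,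
      Complex.im_ofNat]
    linear_combination 4 * hbb
  have hden : ∀ z : ℂ, ‖z‖ ≤ 1 → τ * z + (2 - τ) * b ≠ 0 := by
    intro z hz h0
    have h1 := key z
    rw [h0, norm_zero] at h1
    have hz1 : ‖z‖ ^ 2 ≤ 1 := by nlinarith [norm_nonneg z]
    have h2 : ‖(2 + τ) * z - τ * b‖ = 0 := by nlinarith [norm_nonneg ((2 + τ) * z - τ * b)]
    have h3 := norm_eq_zero.1 h2
    have h4 : z = b := by linear_combination (h3 - h0) / 2
    rw [h4] at h0
    exact hb0 (by linear_combination h0 / 2)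
  set M : ℂ → ℂ := fun z => ((2 + τ) * z - τ * b) / (τ * z + (2 - τ) * b) with hM
  have hdiff : ∀ z : ℂ, ‖z‖ ≤ 1 → DifferentiableAt ℂ M z := fun z hz =>
    DifferentiableAt.div (by fun_prop) (by fun_prop) (hden z hz)
  have hMa : M a = -1 := by
    rw [hM]; dsimp only
    rw [div_eq_iff (hden a ha.le)]; linear_combination -2 * hτa
  have hMb : M b = 1 := by
    rw [hM]; dsimp only
    rw [div_eq_one_iff_eq (hden b hb.le)]; ring
  refine ⟨M, fun z hz => (hdiff z (mem_ball_zero_iff.1 hz).le).differentiableWithinAt, ?_, ?_,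
    (hdiff a ha.le).continuousAt, (hdiff b hb.le).continuousAt, hMa, hMb⟩
  · intro z hz w hw h
    have h1 := (div_eq_div_iff (hden z (mem_ball_zero_iff.1 hz).le)
      (hden w (mem_ball_zero_iff.1 hw).le)).1 h
    have h2 : b * (z - w) = 0 := by linear_combination h1 / 4
    exact sub_eq_zero.1 ((mul_eq_zero.1 h2).resolve_left hb0)
  · have hlt : ∀ z w : ℂ, τ * z + (2 - τ) * b ≠ 0 →
        w * (τ * z + (2 - τ) * b) = (2 + τ) * z - τ * b → (‖z‖ < 1 ↔ ‖w‖ < 1) := by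
      intro z w h0 h
      have h1 := key z
      rw [← h, norm_mul, mul_pow] at h1
      have h2 := pow_pos (norm_pos_iff.2 h0) 2
      have h3 : ‖τ * z + (2 - τ) * b‖ ^ 2 * (1 - ‖w‖ ^ 2) = 4 * (1 - ‖z‖ ^ 2) := by linarith
      rw [← sq_lt_one_iff₀ (norm_nonneg z), ← sq_lt_one_iff₀ (norm_nonneg w),
        ← sub_pos, ← sub_pos (b := ‖w‖ ^ 2), ← mul_pos_iff_of_pos_left (b := 1 - ‖w‖ ^ 2) h2, h3]
      simp
    apply Subset.antisymm
    · rintro _ ⟨z, hz, rfl⟩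
      have h0 := hden z (mem_ball_zero_iff.1 hz).le
      exact mem_ball_zero_iff.2 ((hlt z (M z) h0 (div_mul_cancel₀ _ h0)).1 (mem_ball_zero_iff.1 hz))
    · intro w hw
      have hw1 : ‖w‖ < 1 := mem_ball_zero_iff.1 hw
      have hE : (2 + τ) - τ * w ≠ 0 := by
        intro h0
        have h1 : ‖2 + τ‖ ^ 2 = ‖τ‖ ^ 2 * ‖w‖ ^ 2 := by
          rw [sub_eq_zero.1 h0, norm_mul, mul_pow]
        have h2 : ‖2 + τ‖ ^ 2 = 4 + ‖τ‖ ^ 2 := by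
          simp only [← Complex.normSq_eq_norm_sq, Complex.normSq_apply, Complex.add_re,
            Complex.add_im, hre, Complex.re_ofNat, Complex.im_ofNat]
          ring
        have h3 : ‖w‖ ^ 2 ≤ 1 := by nlinarith [norm_nonneg w]
        nlinarith [sq_nonneg ‖τ‖]
      set z : ℂ := ((2 - τ) * b * w + τ * b) / ((2 + τ) - τ * w) with hz
      have hzE : z * ((2 + τ) - τ * w) = (2 - τ) * b * w + τ * b := by
        rw [hz, div_mul_cancel₀ _ hE]
      have hd0 : τ * z + (2 - τ) * b ≠ 0 := by
        intro h0
        have h1 : (2 + τ) * z - τ * b = 0 := by linear_combination hzE + w * h0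
        have h2 : z = b := by linear_combination (h1 - h0) / 2
        rw [h2] at h0
        exact hb0 (by linear_combination h0 / 2)
      have hwz : w * (τ * z + (2 - τ) * b) = (2 + τ) * z - τ * b := by
        linear_combination -hzE
      exact ⟨z, mem_ball_zero_iff.2 ((hlt z w hd0 hwz).2 hw1), ((eq_div_iff hd0).2 hwz).symm⟩

theorem AgreesWithDiskNear.nhdsWithin_eq {V : Set ℂ} {p : ℂ} (h : AgreesWithDiskNear V p) :
    𝓝[V] p = 𝓝[unitDisk] p := by
  obtain ⟨r, hr, h⟩ := h
  rw [nhdsWithin_restrict' V (Metric.ball_mem_nhds p hr), h,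
    ← nhdsWithin_restrict' unitDisk (Metric.ball_mem_nhds p hr)]

theorem agreesWithDiskNear_standardNhd {ε : ℝ} (h0 : 0 < ε) (h1 : ε < Real.pi / 2) {p : ℂ}
    (hp : p.im = 0) : AgreesWithDiskNear (standardNhd ε) p := by
  obtain ⟨r, hr, h⟩ := exists_ball_subset_standardNhd h0 h1 hp
  exact agreesWithDiskNear_of_subset (standardNhd_subset_unitDisk ε) hr h

theorem im_eq_zero_and_norm_eq_one {p : ℂ} (hp : p = -1 ∨ p = 1) : p.im = 0 ∧ ‖p‖ = 1 := by
  rcases hp with rfl | rfl <;> simp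

/-! ### Openness and shrinking of admissible neighborhoods. -/

namespace IsLocalConformalMap

variable {ε₀ : ℝ} {f : ℂ → ℂ} {γ : SimpleChord}

theorem tendsto_unitDisk (h : IsLocalConformalMap ε₀ f γ) {p : ℂ} (hp : p = -1 ∨ p = 1) :
    Tendsto f (𝓝[unitDisk] p) (𝓝 p) := by
  rw [← (agreesWithDiskNear_standardNhd h.pos h.lt_pi_div_two
    (im_eq_zero_and_norm_eq_one hp).1).nhdsWithin_eq]
  rcases hp with rfl | rfl
  exacts [h.tendsto_neg_one, h.tendsto_one]

theorem agrees (h : IsLocalConformalMap ε₀ f γ) {p : ℂ} (hp : p = -1 ∨ p = 1) :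
    AgreesWithDiskNear (f '' standardNhd ε₀) p := by
  rcases hp with rfl | rfl
  exacts [h.agrees_neg_one, h.agrees_one]

/-- The hypothesis gives this only for ε₀. Reflection at p shows that f carries small disk
neighborhoods of p, which lie in A_ε, onto sets containing smaller disk neighborhoods of p. -/
theorem exists_ball_subset_image (h : IsLocalConformalMap ε₀ f γ) {ε : ℝ} (h0 : 0 < ε)
    (hε : ε < ε₀) {p : ℂ} (hp : p = -1 ∨ p = 1) :
    ∃ s > 0, unitDisk ∩ Metric.ball p s ⊆ f '' standardNhd ε := by
  obtain ⟨him, hp1⟩ := im_eq_zero_and_norm_eq_one hp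
  obtain ⟨s, hs, hsub⟩ := (h.agrees hp).exists_subset
  obtain ⟨a, -, ha, hcov⟩ := exists_boundary_value_of_injOn (C := Metric.closedBall p (s / 2))
    (isOpen_standardNhd ε₀) (standardNhd_subset_unitDisk ε₀)
    (agreesWithDiskNear_standardNhd h.pos h.lt_pi_div_two him) hp1 h.differentiableOn h.injOn
    h.image_subset Metric.isClosed_closedBall
    (fun z hz => hsub ⟨hz.1, Metric.closedBall_subset_ball (half_lt_self hs) hz.2⟩)
    (h.tendsto_unitDisk hp (Metric.closedBall_mem_nhds p (half_pos hs)))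
  have := nhdsWithin_unitDisk_neBot hp1
  obtain rfl := tendsto_nhds_unique ha (h.tendsto_unitDisk hp)
  obtain ⟨r, hr, hrsub⟩ := exists_ball_subset_standardNhd h0 (hε.trans h.lt_pi_div_two) him
  obtain ⟨s', hs', hcov⟩ := hcov r hr
  exact ⟨s', hs', hcov.trans (image_mono hrsub)⟩

/-- The endpoints are not in f(A_ε), so small balls about ±1 are adjoined to get an open set
containing the whole compact chord. Nearby chords stay in it, and disk points of these balls already
lie in f(A_ε). -/
theorem isOpen_admissibleNhd (h : IsLocalConformalMap ε₀ f γ) {ε : ℝ} (h0 : 0 < ε)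
    (hε : ε < ε₀) : IsOpen (admissibleNhd f ε) := by
  obtain ⟨s₁, hs₁, h₁⟩ := h.exists_ball_subset_image h0 hε (Or.inl rfl)
  obtain ⟨s₂, hs₂, h₂⟩ := h.exists_ball_subset_image h0 hε (Or.inr rfl)
  have hsub := standardNhd_mono h0 hε.le h.lt_pi_div_two
  have hopen : IsOpen (f '' standardNhd ε ∪ (Metric.ball (-1) s₁ ∪ Metric.ball 1 s₂)) :=
    (isOpen_image_of_injOn (isOpen_standardNhd ε) (h.differentiableOn.mono hsub)
      (h.injOn.mono hsub)).union (Metric.isOpen_ball.union Metric.isOpen_ball)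
  rw [Metric.isOpen_iff]
  intro η hη
  have hηN : (η.1 : Set ℂ) ⊆ f '' standardNhd ε ∪ (Metric.ball (-1) s₁ ∪ Metric.ball 1 s₂) := by
    intro z hz
    rcases η.mem_cases hz with rfl | rfl | hz
    · exact Or.inr (Or.inl (Metric.mem_ball_self hs₁))
    · exact Or.inr (Or.inr (Metric.mem_ball_self hs₂))
    · exact Or.inl (hη hz)
  obtain ⟨δ, hδ, hδN⟩ := η.isCompact.exists_thickening_subset_open hopen hηN
  refine ⟨δ, hδ, fun η' hη' z hz => ?_⟩
  have hzD := η'.openPart_subset_unitDisk hz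
  rcases hδN (SimpleChord.subset_thickening_of_dist_lt hη' hz.1) with h | h | h
  · exact h
  · exact h₁ ⟨hzD, h⟩
  · exact h₂ ⟨hzD, h⟩

theorem self_mem_admissibleNhd (h : IsLocalConformalMap ε₀ f γ) {ε : ℝ} (h0 : 0 < ε)
    (hε : ε < ε₀) : γ ∈ admissibleNhd f ε := by
  change γ.openPart ⊆ _
  rw [h.image_reference]
  exact image_mono (referenceChord_subset_standardNhd h0 (hε.trans h.lt_pi_div_two))

/-- By compactness of the closed disk the question is local: near a nonreal point A_ε is empty for
small ε, and at a real point f has a limit on γ, including at ±1. -/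
theorem exists_image_subset_thickening (h : IsLocalConformalMap ε₀ f γ) {δ : ℝ} (hδ : 0 < δ) :
    ∃ ε, 0 < ε ∧ ε < ε₀ ∧ f '' standardNhd ε ⊆ Metric.thickening δ (γ.1 : Set ℂ) := by
  suffices H : ∃ ε, 0 < ε ∧ ε < ε₀ ∧
      ∀ z ∈ Metric.closedBall (0 : ℂ) 1, z ∈ standardNhd ε →
        f z ∈ Metric.thickening δ (γ.1 : Set ℂ) by
    obtain ⟨ε, h0, h1, H⟩ := H
    refine ⟨ε, h0, h1, ?_⟩
    rintro _ ⟨z, hz, rfl⟩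
    exact H z (Metric.ball_subset_closedBall (standardNhd_subset_unitDisk ε hz)) hz
  have hhalf : 0 < ε₀ / 2 ∧ ε₀ / 2 < ε₀ := ⟨half_pos h.pos, half_lt_self h.pos⟩
  refine (isCompact_closedBall (0 : ℂ) 1).induction_on (p := fun s => ∃ ε, 0 < ε ∧ ε < ε₀ ∧
      ∀ z ∈ s, z ∈ standardNhd ε → f z ∈ Metric.thickening δ (γ.1 : Set ℂ)) ?_ ?_ ?_ ?_
  · exact ⟨ε₀ / 2, hhalf.1, hhalf.2, by simp⟩
  · rintro s t hst ⟨ε, h0, h1, H⟩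
    exact ⟨ε, h0, h1, fun z hz => H z (hst hz)⟩
  · rintro s t ⟨ε₁, h01, h11, H1⟩ ⟨ε₂, h02, h12, H2⟩
    have hm : 0 < min ε₁ ε₂ := lt_min h01 h02
    refine ⟨min ε₁ ε₂, hm, (min_le_left _ _).trans_lt h11, ?_⟩
    rintro z (hz | hz) hzε
    · exact H1 z hz (standardNhd_mono hm (min_le_left _ _) (h11.trans h.lt_pi_div_two) hzε)
    · exact H2 z hz (standardNhd_mono hm (min_le_right _ _) (h12.trans h.lt_pi_div_two) hzε)
  · intro x hx
    have hx1 : ‖x‖ ≤ 1 := by simpa using hx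
    have hopen : IsOpen (Metric.thickening δ (γ.1 : Set ℂ)) := Metric.isOpen_thickening
    have hself : (γ.1 : Set ℂ) ⊆ Metric.thickening δ (γ.1 : Set ℂ) :=
      Metric.self_subset_thickening hδ _
    have hlim : ∀ y ∈ (γ.1 : Set ℂ), Tendsto f (𝓝[unitDisk] x) (𝓝 y) →
        ∃ t ∈ 𝓝[Metric.closedBall 0 1] x, ∃ ε, 0 < ε ∧ ε < ε₀ ∧
          ∀ z ∈ t, z ∈ standardNhd ε → f z ∈ Metric.thickening δ (γ.1 : Set ℂ) := by
      intro y hy hf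
      have := hf (hopen.mem_nhds (hself hy))
      rw [Filter.mem_map, mem_nhdsWithin_iff_exists_mem_nhds_inter] at this
      obtain ⟨u, hu, hsub⟩ := this
      exact ⟨u, mem_nhdsWithin_of_mem_nhds hu, ε₀ / 2, hhalf.1, hhalf.2, fun z hz hzε =>
        hsub ⟨hz, standardNhd_subset_unitDisk _ hzε⟩⟩
    by_cases him : x.im = 0
    · have hxr : x = (x.re : ℂ) := Complex.ext rfl (by simpa using him)
      have hle : |x.re| ≤ 1 := (Complex.abs_re_le_norm x).trans hx1
      rw [abs_le] at hle
      rcases hle.1.eq_or_lt with he | hgt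
      · have hx' : x = -1 := by rw [hxr, ← he]; simp
        exact hlim (-1) γ.neg_one_mem (by rw [hx']; exact h.tendsto_unitDisk (Or.inl rfl))
      rcases hle.2.eq_or_lt with he | hlt
      · have hx' : x = 1 := by rw [hxr, he]; simp
        exact hlim 1 γ.one_mem (by rw [hx']; exact h.tendsto_unitDisk (Or.inr rfl))
      have hxref : x ∈ referenceChord := ⟨x.re, ⟨hgt, hlt⟩, hxr.symm⟩
      have hxA := referenceChord_subset_standardNhd h.pos h.lt_pi_div_two hxref
      have hfx : f x ∈ γ.openPart := h.image_reference ▸ mem_image_of_mem f hxref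
      exact hlim (f x) hfx.1 ((h.differentiableOn.differentiableAt
        ((isOpen_standardNhd ε₀).mem_nhds hxA)).continuousAt.tendsto.mono_left nhdsWithin_le_nhds)
    · have hpos : 0 < |x.im| := abs_pos.2 him
      have hsin : ∀ᶠ ε in 𝓝[>] (0 : ℝ), Real.sin ε < |x.im| / 2 :=
        (Real.continuous_sin.tendsto' 0 0 Real.sin_zero).mono_left nhdsWithin_le_nhds
          |>.eventually (gt_mem_nhds (half_pos hpos))
      obtain ⟨ε, hε, h0, h1⟩ := (hsin.and (Ioo_mem_nhdsGT h.pos)).exists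
      refine ⟨{z | |x.im| / 2 < |z.im|}, mem_nhdsWithin_of_mem_nhds
        ((isOpen_lt continuous_const (by fun_prop)).mem_nhds (half_lt_self hpos)), ε, h0, h1, ?_⟩
      intro z hz hzε
      rw [mem_standardNhd h0 (h1.trans h.lt_pi_div_two)] at hzε
      have hz' : |x.im| / 2 < |z.im| := hz
      have : 0 < Real.sin ε := Real.sin_pos_of_pos_of_lt_pi h0
        (by linarith [h1, h.lt_pi_div_two, Real.pi_pos])
      have hz2 : ‖z‖ ^ 2 < 1 := by nlinarith [norm_nonneg z, hzε.1]
      nlinarith [hzε.2]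

end IsLocalConformalMap

/-! ### Admissible neighborhoods inside a given thickening. -/

/-- A Riemann map of a domain that coincides with the disk near `-1` and `1`, normalized to fix
these two boundary points. -/
theorem HasPrimitives.exists_normalized_riemann_map {V : Set ℂ} (hP : HasPrimitives V)
    (hV : IsOpen V) (hc : IsPreconnected V) (hVD : V ⊆ unitDisk)
    (hm : AgreesWithDiskNear V (-1)) (hp : AgreesWithDiskNear V 1) :
    ∃ g : ℂ → ℂ, DifferentiableOn ℂ g V ∧ InjOn g V ∧ g '' V = unitDisk ∧
      ∀ p, p = -1 ∨ p = 1 → Tendsto g (𝓝[unitDisk] p) (𝓝 p) ∧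
        ∀ r' > 0, ∃ s > 0, unitDisk ∩ Metric.ball p s ⊆ g '' (unitDisk ∩ Metric.ball p r') := by
  have hag : ∀ p, p = -1 ∨ p = 1 → AgreesWithDiskNear V p := by
    rintro p (rfl | rfl)
    exacts [hm, hp]
  have hbdry : ∀ g : ℂ → ℂ, DifferentiableOn ℂ g V → InjOn g V → g '' V = unitDisk →
      ∀ p, p = -1 ∨ p = 1 → ∃ a : ℂ, ‖a‖ = 1 ∧ Tendsto g (𝓝[unitDisk] p) (𝓝 a) ∧
      ∀ r' > 0, ∃ s > 0, unitDisk ∩ Metric.ball a s ⊆ g '' (unitDisk ∩ Metric.ball p r') := by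
    intro g hd hi him p hp
    exact exists_boundary_value_of_injOn hV hVD (hag p hp) (im_eq_zero_and_norm_eq_one hp).2 hd hi
      him.subset isClosed_univ (by rw [inter_univ]; exact him.symm.subset) (by simp)
  have hne : V.Nonempty := by
    obtain ⟨r, hr, h⟩ := hm.exists_subset
    exact (unitDisk_inter_ball_nonempty (by simp) hr).mono h
  obtain ⟨φ, hφd, hφi, hφ⟩ := hP.exists_riemann_map hV hc (Metric.isBounded_ball.subset hVD) hne
  obtain ⟨a, ha, hta, hca⟩ := hbdry φ hφd hφi hφ (-1) (Or.inl rfl)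
  obtain ⟨b, hb, htb, hcb⟩ := hbdry φ hφd hφi hφ 1 (Or.inr rfl)
  -- If the two boundary values coincided, disjoint neighborhoods of -1 and 1 would have overlapping
  -- images, against injectivity.
  have hab : a ≠ b := by
    rintro rfl
    obtain ⟨r₁, hr₁, h₁⟩ := hm.exists_subset
    obtain ⟨r₂, hr₂, h₂⟩ := hp.exists_subset
    obtain ⟨s₁, hs₁, hc₁⟩ := hca (min r₁ 1) (lt_min hr₁ one_pos)
    obtain ⟨s₂, hs₂, hc₂⟩ := hcb (min r₂ 1) (lt_min hr₂ one_pos)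
    obtain ⟨w, hwD, hw⟩ := unitDisk_inter_ball_nonempty ha (lt_min hs₁ hs₂)
    obtain ⟨z₁, ⟨hz₁D, hz₁⟩, rfl⟩ := hc₁ ⟨hwD, Metric.ball_subset_ball (min_le_left _ _) hw⟩
    obtain ⟨z₂, ⟨hz₂D, hz₂⟩, he⟩ := hc₂ ⟨hwD, Metric.ball_subset_ball (min_le_right _ _) hw⟩
    have hz : z₂ = z₁ := hφi (h₂ ⟨hz₂D, Metric.ball_subset_ball (min_le_left _ _) hz₂⟩)
      (h₁ ⟨hz₁D, Metric.ball_subset_ball (min_le_left _ _) hz₁⟩) he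
    rw [hz] at hz₂
    have h3 := Metric.ball_subset_ball (min_le_right _ _) hz₁
    have h4 := Metric.ball_subset_ball (min_le_right _ _) hz₂
    rw [Metric.mem_ball, dist_comm] at h3
    rw [Metric.mem_ball] at h4
    have h5 := dist_triangle (-1 : ℂ) z₁ 1
    have h6 : dist (-1 : ℂ) 1 = 2 := by rw [dist_eq_norm]; norm_num
    linarith
  obtain ⟨M, hMd, hMi, hM, hMa, hMb, ha1, hb1⟩ := exists_disk_automorphism ha hb hab
  have hmaps : MapsTo φ V unitDisk := fun z hz => hφ.subset (mem_image_of_mem φ hz)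
  have hd : DifferentiableOn ℂ (M ∘ φ) V := hMd.comp hφd hmaps
  have hi : InjOn (M ∘ φ) V := hMi.comp hφi hmaps
  have him : (M ∘ φ) '' V = unitDisk := by rw [image_comp, hφ]; exact hM
  have htend : ∀ p, p = -1 ∨ p = 1 → Tendsto (M ∘ φ) (𝓝[unitDisk] p) (𝓝 p) := by
    rintro p (rfl | rfl)
    · have := hMa.tendsto.comp hta
      rwa [ha1] at this
    · have := hMb.tendsto.comp htb
      rwa [hb1] at this
  refine ⟨M ∘ φ, hd, hi, him, fun p hp => ⟨htend p hp, ?_⟩⟩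
  obtain ⟨a', -, ha', hcov⟩ := hbdry _ hd hi him p hp
  have := nhdsWithin_unitDisk_neBot (im_eq_zero_and_norm_eq_one hp).2
  obtain rfl := tendsto_nhds_unique ha' (htend p hp)
  exact hcov

/-- A map that is continuous and injective on the open diameter, with values in the disk and the
limits `-1` and `1`, parametrizes a simple chord. -/
theorem exists_simpleChord_openPart_eq {f : ℂ → ℂ} (hf : ContinuousOn f referenceChord)
    (hi : InjOn f referenceChord) (hD : f '' referenceChord ⊆ unitDisk)
    (hm : Tendsto f (𝓝[unitDisk] (-1)) (𝓝 (-1))) (hp : Tendsto f (𝓝[unitDisk] 1) (𝓝 1)) :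
    ∃ γ : SimpleChord, γ.openPart = f '' referenceChord := by
  set l : ℝ → ℂ := fun t => ((2 * t - 1 : ℝ) : ℂ) with hl
  have hlc : Continuous l := by fun_prop
  have hl0 : l 0 = -1 := by simp [hl]
  have hl1 : l 1 = 1 := by simp [hl]; norm_num
  have hlref : l '' Ioo 0 1 = referenceChord := by
    apply Subset.antisymm
    · rintro _ ⟨t, ht, rfl⟩
      exact ⟨2 * t - 1, ⟨by linarith [ht.1], by linarith [ht.2]⟩, rfl⟩
    · rintro _ ⟨x, hx, rfl⟩
      refine ⟨(x + 1) / 2, ⟨by linarith [hx.1], by linarith [hx.2]⟩, ?_⟩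
      simp only [hl]; congr 1; ring
  have hlm : ∀ t ∈ Ioo (0 : ℝ) 1, l t ∈ referenceChord := fun t ht =>
    hlref.subset (mem_image_of_mem l ht)
  have hlinj : Function.Injective l := by
    intro s t h
    have : 2 * s - 1 = 2 * t - 1 := Complex.ofReal_injective h
    linarith
  have hrefD : referenceChord ⊆ unitDisk := by
    rintro _ ⟨t, ht, rfl⟩
    rw [mem_ball_zero_iff, Complex.norm_real, Real.norm_eq_abs]
    exact abs_lt.2 ht
  set c : ℝ → ℂ := fun t => if t = 0 then -1 else if t = 1 then 1 else f (l t) with hc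
  have hc0 : c 0 = -1 := by simp [hc]
  have hc1 : c 1 = 1 := by simp [hc]
  have hcI : ∀ t ∈ Ioo (0 : ℝ) 1, c t = f (l t) := fun t ht => by
    simp [hc, ht.1.ne', ht.2.ne]
  have hcD : ∀ t ∈ Ioo (0 : ℝ) 1, c t ∈ unitDisk := fun t ht => by
    rw [hcI t ht]; exact hD (mem_image_of_mem f (hlm t ht))
  have hends : ∀ t ∈ Icc (0 : ℝ) 1, t = 0 ∨ t = 1 ∨ t ∈ Ioo (0 : ℝ) 1 := by
    intro t ht
    rcases ht.1.eq_or_lt with h | h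
    · exact Or.inl h.symm
    rcases ht.2.eq_or_lt with h' | h'
    · exact Or.inr (Or.inl h')
    · exact Or.inr (Or.inr ⟨h, h'⟩)
  have hnot : ∀ t ∈ Ioo (0 : ℝ) 1, c t ≠ -1 ∧ c t ≠ 1 := by
    intro t ht
    have := hcD t ht
    constructor <;> intro h <;> rw [h] at this <;> simp at this
  have hinj : InjOn c (Icc 0 1) := by
    intro s hs t ht h
    rcases hends s hs with rfl | rfl | hs <;> rcases hends t ht with rfl | rfl | ht
    · rfl
    · rw [hc0, hc1] at h; norm_num at h
    · exact absurd (h.symm.trans hc0) (hnot t ht).1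
    · rw [hc0, hc1] at h; norm_num at h
    · rfl
    · exact absurd (h.symm.trans hc1) (hnot t ht).2
    · exact absurd (h.trans hc0) (hnot s hs).1
    · exact absurd (h.trans hc1) (hnot s hs).2
    · rw [hcI s hs, hcI t ht] at h
      exact hlinj (hi (hlm s hs) (hlm t ht) h)
  have hcont : ContinuousOn c (Icc 0 1) := by
    have hIoo : ContinuousOn c (Ioo 0 1) :=
      (hf.comp hlc.continuousOn hlm).congr hcI
    have hlim : ∀ t, Tendsto f (𝓝[unitDisk] (l t)) (𝓝 (l t)) →
        Tendsto c (𝓝[Ioo 0 1] t) (𝓝 (l t)) := by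
      intro t h
      refine Tendsto.congr' (f₁ := f ∘ l)
        (eventually_mem_nhdsWithin.mono fun s hs => (hcI s hs).symm) (h.comp ?_)
      exact tendsto_nhdsWithin_iff.2 ⟨hlc.continuousAt.tendsto.mono_left nhdsWithin_le_nhds,
        eventually_mem_nhdsWithin.mono fun s hs => hrefD (hlm s hs)⟩
    have h0 : Tendsto c (𝓝[Ioo 0 1] 0) (𝓝 (c 0)) := by
      rw [hc0, ← hl0]; exact hlim 0 (by rw [hl0]; exact hm)
    have h1 : Tendsto c (𝓝[Ioo 0 1] 1) (𝓝 (c 1)) := by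
      rw [hc1, ← hl1]; exact hlim 1 (by rw [hl1]; exact hp)
    have hIcc : Icc (0 : ℝ) 1 = insert 0 (insert 1 (Ioo 0 1)) := by
      ext t
      constructor
      · exact fun ht => hends t ht
      · rintro (rfl | rfl | ht)
        exacts [⟨le_rfl, zero_le_one⟩, ⟨zero_le_one, le_rfl⟩, Ioo_subset_Icc_self ht]
    intro t ht
    rw [hIcc, continuousWithinAt_insert, continuousWithinAt_insert]
    rcases hends t ht with rfl | rfl | ht
    exacts [h0, h1, hIoo t ht]
  refine ⟨⟨⟨⟨c '' Icc 0 1, isCompact_Icc.image_of_continuousOn hcont⟩,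
    ⟨c 0, mem_image_of_mem c ⟨le_rfl, zero_le_one⟩⟩⟩,
    c, hcont, hinj, hc0, hc1, hcD, rfl⟩, ?_⟩
  change (c '' Icc 0 1) \ {-1, 1} = _
  rw [image_Icc_diff_eq_image_Ioo hinj hc0 hc1, image_congr hcI, ← hlref, image_image]

/-- The A_ε increase to the disk and each contains the disk points near ±1, so compactness of the
chord yields one ε. -/
theorem SimpleChord.exists_image_subset_standardNhd (γ : SimpleChord) {g : ℂ → ℂ}
    (hg : ∀ z ∈ γ.openPart, ContinuousAt g z) (hD : g '' γ.openPart ⊆ unitDisk)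
    (hp : ∀ p, p = -1 ∨ p = 1 → Tendsto g (𝓝[γ.openPart] p) (𝓝 p)) :
    ∃ ε, 0 < ε ∧ ε < Real.pi / 2 ∧ g '' γ.openPart ⊆ standardNhd ε := by
  have hpi := Real.pi_pos
  suffices H : ∃ ε, 0 < ε ∧ ε < Real.pi / 2 ∧
      ∀ z ∈ (γ.1 : Set ℂ), z ∈ γ.openPart → g z ∈ standardNhd ε by
    obtain ⟨ε, h0, h1, H⟩ := H
    exact ⟨ε, h0, h1, image_subset_iff.2 fun z hz => H z hz.1 hz⟩
  refine γ.isCompact.induction_on (p := fun s => ∃ ε, 0 < ε ∧ ε < Real.pi / 2 ∧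
      ∀ z ∈ s, z ∈ γ.openPart → g z ∈ standardNhd ε) ?_ ?_ ?_ ?_
  · exact ⟨Real.pi / 4, by linarith, by linarith, by simp⟩
  · rintro s t hst ⟨ε, h0, h1, H⟩
    exact ⟨ε, h0, h1, fun z hz => H z (hst hz)⟩
  · rintro s t ⟨ε₁, h01, h11, H1⟩ ⟨ε₂, h02, h12, H2⟩
    refine ⟨max ε₁ ε₂, lt_max_of_lt_left h01, max_lt h11 h12, ?_⟩
    rintro z (hz | hz) hzγ
    · exact standardNhd_mono h01 (le_max_left _ _) (max_lt h11 h12) (H1 z hz hzγ)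
    · exact standardNhd_mono h02 (le_max_right _ _) (max_lt h11 h12) (H2 z hz hzγ)
  · intro x hx
    suffices H : ∃ ε, 0 < ε ∧ ε < Real.pi / 2 ∧ ∀ᶠ z in 𝓝[γ.openPart] x, g z ∈ standardNhd ε by
      obtain ⟨ε, h0, h1, H⟩ := H
      obtain ⟨r, hr, hsub⟩ := Metric.mem_nhdsWithin_iff.1 H
      exact ⟨Metric.ball x r, mem_nhdsWithin_of_mem_nhds (Metric.ball_mem_nhds x hr), ε, h0, h1,
        fun z hz hzγ => hsub ⟨hz, hzγ⟩⟩
    have hend : ∀ p, p = -1 ∨ p = 1 → ∃ ε, 0 < ε ∧ ε < Real.pi / 2 ∧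
        ∀ᶠ z in 𝓝[γ.openPart] p, g z ∈ standardNhd ε := by
      intro p hpe
      refine ⟨Real.pi / 4, by linarith, by linarith, ?_⟩
      obtain ⟨r, hr, hsub⟩ := exists_ball_subset_standardNhd (ε := Real.pi / 4) (by linarith)
        (by linarith) (im_eq_zero_and_norm_eq_one hpe).1
      filter_upwards [hp p hpe (Metric.ball_mem_nhds p hr), self_mem_nhdsWithin] with z hz hzγ
      exact hsub ⟨hD (mem_image_of_mem g hzγ), hz⟩
    rcases γ.mem_cases hx with rfl | rfl | hxγ
    · exact hend _ (Or.inl rfl)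
    · exact hend _ (Or.inr rfl)
    · obtain ⟨ε, h0, h1, hε⟩ := exists_mem_standardNhd
        (mem_ball_zero_iff.1 (hD (mem_image_of_mem g hxγ)))
      exact ⟨ε, h0, h1, nhdsWithin_le_nhds
        ((hg x hxγ) ((isOpen_standardNhd ε).mem_nhds hε))⟩

/-- Here f is the inverse of a normalized Riemann map g of a thin domain around γ. The chord γ' is
the f-image of the diameter and generally differs from γ; it is only needed that g sends γ into some
A_ε with ε < π/2. -/
theorem SimpleChord.exists_isLocalConformalMap (γ : SimpleChord) {δ : ℝ} (hδ : 0 < δ) :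
    ∃ (ε₀ : ℝ) (f : ℂ → ℂ) (γ' : SimpleChord), IsLocalConformalMap ε₀ f γ' ∧
      ∃ ε, 0 < ε ∧ ε < ε₀ ∧ γ ∈ admissibleNhd f ε ∧
        f '' standardNhd ε ⊆ Metric.thickening δ (γ.1 : Set ℂ) := by
  obtain ⟨V, hV, hc, hVD, hP, hγV, hVδ, hm, hp⟩ := γ.exists_thin_domain hδ
  have hag : ∀ p, p = -1 ∨ p = 1 → AgreesWithDiskNear V p := by
    rintro p (rfl | rfl)
    exacts [hm, hp]
  obtain ⟨g, hgd, hgi, hg, hgp⟩ := hP.exists_normalized_riemann_map hV hc hVD hm hp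
  set f := Function.invFunOn g V with hf
  have hfd : DifferentiableOn ℂ f unitDisk := hg ▸ differentiableOn_invFunOn hV hgd hgi
  have hfV : ∀ z ∈ unitDisk, f z ∈ V := fun z hz => Function.invFunOn_mem (hg.symm.subset hz)
  have hgf : ∀ z ∈ unitDisk, g (f z) = z := fun z hz => Function.invFunOn_eq (hg.symm.subset hz)
  have hfg : ∀ z ∈ V, f (g z) = z := fun z hz => hgi.leftInvOn_invFunOn hz
  have hgD : ∀ z ∈ V, g z ∈ unitDisk := fun z hz => hg.subset (mem_image_of_mem g hz)
  have hfi : InjOn f unitDisk := fun z hz w hw h => by rw [← hgf z hz, h, hgf w hw]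
  have hfp : ∀ p, p = -1 ∨ p = 1 → Tendsto f (𝓝[unitDisk] p) (𝓝 p) := by
    intro p hpe
    obtain ⟨r, hr, hrV⟩ := (hag p hpe).exists_subset
    rw [Metric.tendsto_nhdsWithin_nhds]
    intro r' hr'
    -- The covering property of g at p is exactly continuity of its inverse there.
    obtain ⟨s, hs, hsub⟩ := (hgp p hpe).2 (min r r') (lt_min hr hr')
    refine ⟨s, hs, fun z hz hzs => ?_⟩
    obtain ⟨w, ⟨hwD, hw⟩, rfl⟩ := hsub ⟨hz, hzs⟩
    rw [hfg w (hrV ⟨hwD, Metric.ball_subset_ball (min_le_left _ _) hw⟩)]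
    exact Metric.ball_subset_ball (min_le_right _ _) hw
  obtain ⟨ε, h0, h1, hε⟩ := γ.exists_image_subset_standardNhd
    (fun z hz => (hgd.differentiableAt (hV.mem_nhds (hγV hz))).continuousAt)
    ((image_mono hγV).trans hg.subset)
    (fun p hpe => (hgp p hpe).1.mono_left (nhdsWithin_mono _ γ.openPart_subset_unitDisk))
  set ε₀ := (ε + Real.pi / 2) / 2 with hε₀
  have h00 : 0 < ε₀ := by linarith
  have h01 : ε₀ < Real.pi / 2 := by linarith
  have hAD := standardNhd_subset_unitDisk ε₀
  have hrefD : referenceChord ⊆ unitDisk :=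
    (referenceChord_subset_standardNhd h00 h01).trans hAD
  have himD : ∀ s ⊆ unitDisk, f '' s ⊆ V := by
    rintro s hs _ ⟨z, hz, rfl⟩
    exact hfV z (hs hz)
  have hfag : ∀ p, p = -1 ∨ p = 1 → AgreesWithDiskNear (f '' standardNhd ε₀) p := by
    intro p hpe
    obtain ⟨r, hr, hrV⟩ := (hag p hpe).exists_subset
    obtain ⟨t, ht, htA⟩ :=
      exists_ball_subset_standardNhd h00 h01 (im_eq_zero_and_norm_eq_one hpe).1
    obtain ⟨s, hs, hsub⟩ := Metric.tendsto_nhdsWithin_nhds.1 (hgp p hpe).1 t ht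
    refine agreesWithDiskNear_of_subset ((himD _ hAD).trans hVD) (lt_min hr hs) ?_
    rintro z ⟨hzD, hz⟩
    have hzV := hrV ⟨hzD, Metric.ball_subset_ball (min_le_left _ _) hz⟩
    exact ⟨g z, htA ⟨hgD z hzV, hsub hzD (Metric.ball_subset_ball (min_le_right _ _) hz)⟩,
      hfg z hzV⟩
  obtain ⟨γ', hγ'⟩ := exists_simpleChord_openPart_eq (hfd.continuousOn.mono hrefD)
    (hfi.mono hrefD) ((himD _ hrefD).trans hVD) (hfp _ (Or.inl rfl)) (hfp _ (Or.inr rfl))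
  refine ⟨ε₀, f, γ', ⟨h00, h01, hfd.mono hAD, hfi.mono hAD, (himD _ hAD).trans hVD,
    (hfp _ (Or.inl rfl)).mono_left (nhdsWithin_mono _ hAD),
    (hfp _ (Or.inr rfl)).mono_left (nhdsWithin_mono _ hAD), hfag _ (Or.inl rfl),
    hfag _ (Or.inr rfl), hγ'⟩, ε, h0, by linarith, ?_, ?_⟩
  · intro z hz
    exact ⟨g z, hε (mem_image_of_mem g hz), hfg z (hγV hz)⟩
  · exact (himD _ (standardNhd_subset_unitDisk ε)).trans hVδ

theorem subset_thickening_of_mem_admissibleNhd {f : ℂ → ℂ} {ε δ : ℝ} (hδ : 0 < δ)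
    {γ η : SimpleChord} (h : f '' standardNhd ε ⊆ Metric.thickening δ (γ.1 : Set ℂ))
    (hη : η ∈ admissibleNhd f ε) : (η.1 : Set ℂ) ⊆ Metric.thickening δ (γ.1 : Set ℂ) := by
  intro z hz
  rcases η.mem_cases hz with rfl | rfl | hz
  · exact Metric.self_subset_thickening hδ _ γ.neg_one_mem
  · exact Metric.self_subset_thickening hδ _ γ.one_mem
  · exact h (hη hz)

theorem theorem3p3 :
    IsTopologicalBasis admissibleNhds ∧
      ∀ (ε₀ : ℝ) (f : ℂ → ℂ) (γ : SimpleChord), IsLocalConformalMap ε₀ f γ →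
        (𝓝 γ).HasBasis (fun ε : ℝ => 0 < ε ∧ ε < ε₀) (fun ε : ℝ => admissibleNhd f ε) := by
  constructor
  · refine isTopologicalBasis_of_isOpen_of_nhds ?_ ?_
    · rintro _ ⟨ε₀, f, γ, h, ε, h0, h1, rfl⟩
      exact h.isOpen_admissibleNhd h0 h1
    · intro γ U hγU hU
      obtain ⟨δ, hδ, hδU⟩ := Metric.isOpen_iff.1 hU γ hγU
      obtain ⟨δ', hδ', H⟩ := γ.exists_dist_lt_of_subset_thickening hδ
      -- A basis element only has to contain γ; it need not be centered at γ.
      obtain ⟨ε₀, f, γ', h, ε, h0, h1, hγ, hsub⟩ := γ.exists_isLocalConformalMap hδ'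
      exact ⟨admissibleNhd f ε, ⟨ε₀, f, γ', h, ε, h0, h1, rfl⟩, hγ, fun η hη =>
        hδU (H η (subset_thickening_of_mem_admissibleNhd hδ' hsub hη))⟩
  · intro ε₀ f γ h
    refine ⟨fun U => ⟨fun hU => ?_, ?_⟩⟩
    · obtain ⟨δ, hδ, hδU⟩ := Metric.mem_nhds_iff.1 hU
      obtain ⟨δ', hδ', H⟩ := γ.exists_dist_lt_of_subset_thickening hδ
      obtain ⟨ε, h0, h1, hsub⟩ := h.exists_image_subset_thickening hδ'
      exact ⟨ε, ⟨h0, h1⟩, fun η hη =>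
        hδU (H η (subset_thickening_of_mem_admissibleNhd hδ' hsub hη))⟩
    · rintro ⟨ε, ⟨h0, h1⟩, hsub⟩
      exact mem_of_superset
        ((h.isOpen_admissibleNhd h0 h1).mem_nhds (h.self_mem_admissibleNhd h0 h1)) hsub
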